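/- Let $(M,g)$ be a connected smooth Riemannian manifold of dimension $n$ (Hausdorff, second countable) that is complete as a metric space, let $\mathrm{Vol}$ be its Riemannian volume measure, and let $\exp_x : T_xM \to M$ be the exponential map of the Levi-Civita connection. Let $\delta > 0$ and let $K \subseteq M$ be a measurable set. The geodesic walk in $K$ with step size $\delta$ is the time-homogeneous Markov chain with state space $K$ that, from $x \in K$, draws $u$ from the standard Gaussian distribution $N(0,I)$ on the Euclidean space $(T_xM, g_x)$ and moves to $\exp_x(\delta u)$ if $\exp_x(\delta u) \in K$, and stays at $x$ otherwise. Let $P_x$ be the distribution of the next state. (For $K = M$ this is the unrestricted walk.) 1. $(P_x)_{x\in K}$ is a Markov kernel on $K$ (each $P_x$ is a probability measure and $x \mapsto P_x(A)$ is measurable for every measurable $A \subseteq K$), and the geodesic walk is reversible with respect to the Riemannian volume: for all measurable $A, B \subseteq K$, $$\int_B P_x(A)\, d\mathrm{Vol}(x) = \int_A P_x(B)\, d\mathrm{Vol}(x).$$ 2. Suppose moreover that $0 < \mathrm{Vol}(K) < \infty$ and that $K$ is geodesically convex, i.e. any two points $p,q\in K$ are joined by a geodesic contained in $K$ that is, up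 to reparametrization, the unique length-minimizing curve in $M$ from $p$ to $q$. Then the stationary distribution of the geodesic walk in $K$ is the uniform distribution on $K$: the probability measure $\pi(A) = \mathrm{Vol}(A)/\mathrm{Vol}(K)$ satisfies $\int_K P_x(A)\, d\pi(x) = \pi(A)$ for every measurable $A \subseteq K$, and it is the only probability measure on $K$ with this property. -/

import Mathlib

open MeasureTheory ProbabilityTheory Set Bundle Manifold
open scoped ContDiff ENNReal Manifold

noncomputable section

namespace GeodesicWalk

variable {n : ℕ} {M : Type*} [TopologicalSpace M] [ChartedSpace (EuclideanSpace ℝ (Fin n)) M]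

/-- Tangent spaces carry their Borel σ-algebra. -/
instance instMeasurableSpaceTangentSpace (x : M) : MeasurableSpace (TangentSpace (𝓡 n) x) :=
  borel _

instance instBorelSpaceTangentSpace (x : M) : BorelSpace (TangentSpace (𝓡 n) x) :=
  ⟨rfl⟩

instance instFiniteDimensionalTangentSpace (x : M) :
    FiniteDimensional ℝ (TangentSpace (𝓡 n) x) :=
  inferInstanceAs (FiniteDimensional ℝ (EuclideanSpace ℝ (Fin n)))

/-- The `i`-th coordinate vector field `∂ᵢ` of the chart centred at `x₀`, at the point with
coordinates `y`. -/
def coordField (x₀ : M) (i : Fin n) (y : EuclideanSpace ℝ (Fin n)) :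
    TangentSpace (𝓡 n) ((extChartAt (𝓡 n) x₀).symm y) :=
  mfderiv 𝓘(ℝ, EuclideanSpace ℝ (Fin n)) (𝓡 n) (extChartAt (𝓡 n) x₀).symm y
    (EuclideanSpace.single i (1 : ℝ) : EuclideanSpace ℝ (Fin n))

/-- The velocity of a curve `γ` at time `t`, as a point of the tangent bundle. -/
def velocity (γ : ℝ → M) (t : ℝ) : TangentBundle (𝓡 n) M :=
  ⟨γ t, mfderiv 𝓘(ℝ, ℝ) (𝓡 n) γ t 1⟩

theorem exists_chartCenter (n : ℕ) (M : Type*) [TopologicalSpace M]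
    [ChartedSpace (EuclideanSpace ℝ (Fin n)) M] [SecondCountableTopology M] [Nonempty M] :
    ∃ c : ℕ → M, ⋃ i, (chartAt (EuclideanSpace ℝ (Fin n)) (c i)).source = univ := by
  obtain ⟨s, hs, hU⟩ := TopologicalSpace.countable_cover_nhds
    (fun x : M ↦ chart_source_mem_nhds (EuclideanSpace ℝ (Fin n)) x)
  have hne : s.Nonempty := by
    by_contra h
    rw [not_nonempty_iff_eq_empty] at h
    subst h
    exact empty_ne_univ (by simpa using hU)
  obtain ⟨c, rfl⟩ := hs.exists_eq_range hne
  exact ⟨c, by simpa using hU⟩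

/-- A sequence of points whose charts cover `M`. -/
def chartCenter (n : ℕ) (M : Type*) [TopologicalSpace M]
    [ChartedSpace (EuclideanSpace ℝ (Fin n)) M] [SecondCountableTopology M] [Nonempty M] :
    ℕ → M :=
  (exists_chartCenter n M).choose

variable [RiemannianBundle (fun x : M ↦ TangentSpace (𝓡 n) x)]

/-- The matrix `g_{ij}` of the metric in the chart centred at `x₀`, as a function of the
coordinates `y`. -/
def metricMatrix (x₀ : M) (y : EuclideanSpace ℝ (Fin n)) : Matrix (Fin n) (Fin n) ℝ :=
  Matrix.of fun i j ↦ inner ℝ (coordField x₀ i y) (coordField x₀ j y)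

/-- `∂_l g_{ij}` in the chart centred at `x₀`. -/
def metricDeriv (x₀ : M) (l i j : Fin n) (y : EuclideanSpace ℝ (Fin n)) : ℝ :=
  fderiv ℝ (fun z ↦ metricMatrix x₀ z i j) y (EuclideanSpace.single l (1 : ℝ))

/-- The Christoffel symbols of the Levi-Civita connection in the chart centred at `x₀`:
`Γᵏᵢⱼ = ½ ∑ₗ gᵏˡ (∂ᵢ gⱼₗ + ∂ⱼ gᵢₗ - ∂ₗ gᵢⱼ)`. -/
def christoffel (x₀ : M) (k i j : Fin n) (y : EuclideanSpace ℝ (Fin n)) : ℝ :=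
  (1 / 2 : ℝ) * ∑ l, (metricMatrix x₀ y)⁻¹ k l *
    (metricDeriv x₀ i j l y + metricDeriv x₀ j i l y - metricDeriv x₀ l i j y)

/-- A geodesic `γ : ℝ → M`: a smooth curve with `∇_{γ'} γ' = 0` for the Levi-Civita connection,
written in coordinates: `c̈ᵏ + ∑ᵢⱼ Γᵏᵢⱼ(c) ċⁱ ċʲ = 0` for the local representation `c` of `γ` in
every chart `chartAt _ x₀` around `γ t`. -/
def IsGeodesic (γ : ℝ → M) : Prop :=
  ContMDiff 𝓘(ℝ, ℝ) (𝓡 n) ∞ γ ∧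
    ∀ (t : ℝ) (x₀ : M), γ t ∈ (extChartAt (𝓡 n) x₀).source → ∀ k : Fin n,
      deriv (deriv fun s ↦ extChartAt (𝓡 n) x₀ (γ s) k) t +
        ∑ i, ∑ j, christoffel x₀ k i j (extChartAt (𝓡 n) x₀ (γ t)) *
          deriv (fun s ↦ extChartAt (𝓡 n) x₀ (γ s) i) t *
          deriv (fun s ↦ extChartAt (𝓡 n) x₀ (γ s) j) t = 0

open Classical in
/-- The exponential map `exp_x v = γ(1)`, where `γ` is the geodesic with `γ(0) = x`, `γ'(0) = v`.
Such a `γ : ℝ → M` exists (and is unique) for all `x` and `v` when `M` is complete; the value `x`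
in the other case is a dummy. -/
def expMap (x : M) (v : TangentSpace (𝓡 n) x) : M :=
  if h : ∃ γ : ℝ → M, IsGeodesic (n := n) γ ∧ velocity γ 0 = (⟨x, v⟩ : TangentBundle (𝓡 n) M) then
    h.choose 1
  else x

/-- `γ`, restricted to `[0, 1]`, is a curve of minimal length in `M` from `p` to `q`. -/
def IsLengthMinimizer (p q : M) (γ : ℝ → M) : Prop :=
  ContMDiffOn 𝓘(ℝ, ℝ) (𝓡 n) 1 γ (Icc 0 1) ∧ γ 0 = p ∧ γ 1 = q ∧
    ∀ σ : ℝ → M, ContMDiffOn 𝓘(ℝ, ℝ) (𝓡 n) 1 σ (Icc 0 1) → σ 0 = p → σ 1 = q →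
      pathELength (𝓡 n) γ 0 1 ≤ pathELength (𝓡 n) σ 0 1

variable (n) in
/-- Geodesically convex sets of a complete manifold: any two points of `A` are joined by a geodesic
segment contained in `A` that is, up to reparametrization, the unique length minimizer in `M`
between them. -/
def GeodesicallyConvex (A : Set M) : Prop :=
  ∀ p ∈ A, ∀ q ∈ A, ∃ γ : ℝ → M, IsGeodesic (n := n) γ ∧ IsLengthMinimizer (n := n) p q γ ∧
    γ '' Icc 0 1 ⊆ A ∧
    ∀ σ : ℝ → M, IsLengthMinimizer (n := n) p q σ → σ '' Icc 0 1 = γ '' Icc 0 1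

variable [MeasurableSpace M]

/-- The measure `√(det g) dx¹ ⋯ dxⁿ` on the domain of the chart centred at `x₀`, as a measure
on `M`. -/
def chartVolume (x₀ : M) : Measure M :=
  (((volume : Measure (EuclideanSpace ℝ (Fin n))).restrict
      (extChartAt (𝓡 n) x₀).target).withDensity
    fun y ↦ ENNReal.ofReal (Real.sqrt (metricMatrix x₀ y).det)).map (extChartAt (𝓡 n) x₀).symm

variable (n) in
/-- The Riemannian volume: `√(det g) dx¹ ⋯ dxⁿ` in each chart. The local expressions agree on
overlaps of charts; they are glued along a countable partition of `M` into pieces of charts. -/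
def riemannianVolume [SecondCountableTopology M] [Nonempty M] : Measure M :=
  Measure.sum fun i : ℕ ↦ (chartVolume (n := n) (chartCenter n M i)).restrict
    (disjointed (fun j ↦ (chartAt (EuclideanSpace ℝ (Fin n)) (chartCenter n M j)).source) i)

variable (n) in
/-- The uniform distribution on `K` (for `0 < Vol(K) < ∞`), as a measure on the subtype `K`. -/
def uniformDistribution [SecondCountableTopology M] [Nonempty M] (K : Set M) : Measure K :=
  (riemannianVolume n K)⁻¹ • (riemannianVolume n).comap Subtype.val

/-- The standard Gaussian `N(0, I)` on the Euclidean space `(T_x M, g_x)`. -/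
def tangentGaussian (x : M) : Measure (TangentSpace (𝓡 n) x) :=
  stdGaussian (TangentSpace (𝓡 n) x)

open Classical in
/-- One update of the walk in `K` with step size `δ`: from `x`, with sampled direction `u`, move to
`exp_x (δ u)` if this point lies in `K`, and stay at `x` otherwise. -/
def walkUpdate (δ : ℝ) (K : Set M) (x : K) (u : TangentSpace (𝓡 n) (x : M)) : K :=
  if h : expMap (x : M) (δ • u) ∈ K then ⟨expMap (x : M) (δ • u), h⟩ else x

variable (n) in
/-- The one-step distribution `P_x` of the geodesic walk in `K` with step size `δ`: the law of the
update from `x` when `u` is drawn from `N(0, I)` in `T_x M`. For `K = M` this is the unrestricted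
geodesic walk. -/
def oneStep (δ : ℝ) (K : Set M) (x : K) : Measure K :=
  (tangentGaussian (n := n) (x : M)).map (walkUpdate δ K x)

end GeodesicWalk

end

/-!
The geodesic flow on the tangent bundle, defined for all times because `M` is complete, preserves
both the Liouville measure and the length of velocities; hence it preserves the measure `Λ` obtained
by drawing a base point from the volume and a standard Gaussian velocity over it. Infinitesimally,
`Λ` has a chart density proportional to `det g · exp (-|v|² / 2)`, with respect to which the
geodesic spray is divergence free. Following the flow for time `δ` and then reversing the velocity
is an involution preserving `Λ` and exchanging the endpoints `x` and `exp_x (δ u)`. This is detailed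
balance for proposals, and rejecting a proposal outside `K` does not affect it.

The uniform distribution is the only invariant one because every `P_x` charges every subset of `K`
of positive volume: if `P_x A = 0`, then `A` consists of points `exp_x (δ u)` with `u` in a
Lebesgue-null set, so it is null as the image of a null set under a differentiable map between
manifolds of equal dimension. For two invariant probability measures `μ` and `ν`, the measures
`μ - μ ⊓ ν` and `ν - μ ⊓ ν` are invariant and mutually singular, and each of them, if nonzero,
dominates the volume. Hence one of them vanishes, so `μ ≤ ν` or `ν ≤ μ`, and `μ = ν` since both have
mass one.
-/

noncomputable section

open Filter Topology Metric

namespace GeodesicWalk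

section Determinant

variable {ι : Type*} [Fintype ι] [DecidableEq ι]

theorem sum_det_updateRow_mul {R : Type*} [CommRing R] (A B : Matrix ι ι R) :
    ∑ i, (B.updateRow i ((A * B) i)).det = A.trace * B.det := by
  have row_mul (i : ι) : (A * B) i = ∑ k, A i k • B k := by
    ext j
    simp [Matrix.mul_apply]
  simp [row_mul, Matrix.det_updateRow_sum, Matrix.trace, Finset.sum_mul]

theorem hasDerivAt_matrix_det {B : ℝ → Matrix ι ι ℝ} {B' : Matrix ι ι ℝ} {t : ℝ}
    (hB : ∀ i j, HasDerivAt (fun s ↦ B s i j) (B' i j) t) :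
    HasDerivAt (fun s ↦ (B s).det) (∑ i, ((B t).updateRow i (B' i)).det) t := by
  let det : ContinuousMultilinearMap ℝ (fun _ : ι ↦ ι → ℝ) ℝ :=
    ⟨Matrix.detRowAlternating.toMultilinearMap, continuous_id.matrix_det⟩
  have row (i : ι) : HasDerivAt (fun s ↦ B s i) (B' i) t := hasDerivAt_pi.2 (hB i)
  have h := (HasFDerivAt.multilinear_comp det fun i ↦ (row i).hasFDerivAt).hasDerivAt
  simp only [sum_apply, ContinuousLinearMap.comp_apply,
    ContinuousLinearMap.toSpanSingleton_apply, one_smul] at h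
  exact h

theorem hasDerivAt_clm_det {V : Type*} [NormedAddCommGroup V] [NormedSpace ℝ V]
    [FiniteDimensional ℝ V] {Y : ℝ → V →L[ℝ] V} {A : V →L[ℝ] V} {t : ℝ}
    (hY : HasDerivAt Y (A ∘L Y t) t) :
    HasDerivAt (fun s ↦ (Y s).det) (LinearMap.trace ℝ V A * (Y t).det) t := by
  set b := Module.finBasis ℝ V
  have det_eq (L : V →L[ℝ] V) : L.det = (LinearMap.toMatrix b b (L : V →ₗ[ℝ] V)).det := by
    rw [LinearMap.det_toMatrix]
  simp only [det_eq]
  rw [LinearMap.trace_eq_matrix_trace ℝ b, ← sum_det_updateRow_mul, ← LinearMap.toMatrix_comp,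
    ← ContinuousLinearMap.toLinearMap_comp]
  refine hasDerivAt_matrix_det fun i j ↦ ?_
  have column : HasDerivAt (fun s ↦ Y s (b j)) ((A ∘L Y t) (b j)) t := by
    simpa using hY.clm_apply (hasDerivAt_const t (b j))
  simp only [LinearMap.toMatrix_apply]
  exact (LinearMap.toContinuousLinearMap (b.coord i)).hasFDerivAt.comp_hasDerivAt t column

theorem contDiff_clm_det {V : Type*} [NormedAddCommGroup V] [NormedSpace ℝ V]
    [FiniteDimensional ℝ V] {m : ℕ∞ω} :
    ContDiff ℝ m (ContinuousLinearMap.det : (V →L[ℝ] V) → ℝ) := by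
  let b := Module.finBasis ℝ V
  have hdet : (ContinuousLinearMap.det : (V →L[ℝ] V) → ℝ) = fun A ↦
      ∑ σ : Equiv.Perm _, Equiv.Perm.sign σ • ∏ i, b.coord (σ i) (A (b i)) := by
    ext A
    rw [ContinuousLinearMap.det, ← LinearMap.det_toMatrix b, Matrix.det_apply]
    simp [LinearMap.toMatrix_apply]
  rw [hdet]
  exact ContDiff.sum fun σ _ ↦ (contDiff_prod fun i _ ↦
    (b.coord (σ i)).toContinuousLinearMap.contDiff.comp
      (contDiff_id.clm_apply contDiff_const)).const_smul _

end Determinant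

section LocalFlow

variable {V : Type*} [NormedAddCommGroup V] [NormedSpace ℝ V]

theorem norm_le_gronwallBound_abs {e e' : ℝ → V} {K c ε : ℝ}
    (he : ∀ t ∈ Ioo (-ε) ε, HasDerivAt e (e' t) t) (h0 : e 0 = 0)
    (hb : ∀ t ∈ Ioo (-ε) ε, ‖e' t‖ ≤ K * ‖e t‖ + c) {t : ℝ} (ht : t ∈ Ioo (-ε) ε) :
    ‖e t‖ ≤ gronwallBound 0 K c |t| := by
  wlog h : 0 ≤ t generalizing e e' t
  · have neg_mem {s : ℝ} (hs : s ∈ Ioo (-ε) ε) : -s ∈ Ioo (-ε) ε :=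
      ⟨neg_lt_neg hs.2, neg_lt.1 hs.1⟩
    have reversed := this (e := fun s ↦ e (-s)) (e' := fun s ↦ -e' (-s))
      (fun s hs ↦ by simpa using! (he (-s) (neg_mem hs)).scomp s (hasDerivAt_neg s))
      (by simpa) (fun s hs ↦ by simpa using hb (-s) (neg_mem hs)) (neg_mem ht) (by linarith)
    simpa using reversed
  rw [abs_of_nonneg h]
  have hs : Icc 0 t ⊆ Ioo (-ε) ε := fun s hs ↦ ⟨by linarith [hs.1, ht.2], hs.2.trans_lt ht.2⟩
  simpa using norm_le_gronwallBound_of_norm_deriv_right_le (a := 0) (b := t) (δ := 0)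
    (fun s hs' ↦ (he s (hs hs')).continuousAt.continuousWithinAt)
    (fun s hs' ↦ (he s (hs ⟨hs'.1, hs'.2.le⟩)).hasDerivWithinAt) (by simp [h0])
    (fun s hs' ↦ hb s (hs ⟨hs'.1, hs'.2.le⟩)) t ⟨h, le_rfl⟩

theorem exists_ball_norm_image_sub_sub_fderiv_le {F : V → V} {z₀ : V}
    (hF : ContDiffAt ℝ 2 F z₀) :
    ∃ R > 0, ∃ K > 0, ∃ C : NNReal, ∀ a ∈ ball z₀ R, ‖fderiv ℝ F a‖ ≤ K ∧
      ∀ b ∈ ball z₀ R, ‖F b - F a - fderiv ℝ F a (b - a)‖ ≤ C * ‖b - a‖ ^ 2 := by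
  have hDF : ContDiffAt ℝ 1 (fderiv ℝ F) z₀ := hF.fderiv_right (by norm_num)
  obtain ⟨C, s, hs, hlip⟩ := hDF.exists_lipschitzOnWith
  have hbdd : ∀ᶠ z in 𝓝 z₀, ‖fderiv ℝ F z‖ < ‖fderiv ℝ F z₀‖ + 1 :=
    hDF.continuousAt.norm.eventually_lt continuousAt_const (lt_add_one _)
  have hdiff : ∀ᶠ z in 𝓝 z₀, DifferentiableAt ℝ F z :=
    (hF.eventually (by simp)).mono fun z hz ↦ hz.differentiableAt (by norm_num)
  obtain ⟨R, hR, hball⟩ :=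
    Metric.eventually_nhds_iff_ball.1 (hbdd.and (hdiff.and (eventually_mem_set.2 hs)))
  refine ⟨R, hR, ‖fderiv ℝ F z₀‖ + 1, by positivity, C,
    fun a ha ↦ ⟨(hball a ha).1.le, fun b hb ↦ ?_⟩⟩
  have hseg : segment ℝ a b ⊆ ball z₀ R := (convex_ball z₀ R).segment_subset ha hb
  have mean_value := (convex_segment a b).norm_image_sub_le_of_norm_fderiv_le' (f := F) (𝕜 := ℝ)
    (C := C * ‖b - a‖) (φ := fderiv ℝ F a) (fun z hz ↦ (hball z (hseg hz)).2.1)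
    (fun z hz ↦ (hlip.norm_sub_le (hball z (hseg hz)).2.2 (hball a ha).2.2).trans
      (by gcongr; exact norm_sub_le_of_mem_segment hz))
    (left_mem_segment ℝ a b) (right_mem_segment ℝ a b)
  rwa [mul_assoc, ← sq] at mean_value

theorem exists_lipschitz_local_flow [CompleteSpace V] {F : V → V} {z₀ : V}
    (hF : ContDiffAt ℝ 1 F z₀) {U : Set V} (hU : U ∈ 𝓝 z₀) :
    ∃ r > 0, ∃ ε > 0, ∃ (α : V → ℝ → V) (L : NNReal),
      (∀ z ∈ ball z₀ r, α z 0 = z ∧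
        ∀ t ∈ Ioo (-ε) ε, α z t ∈ U ∧ HasDerivAt (α z) (F (α z t)) t) ∧
      ∀ t ∈ Ioo (-ε) ε, LipschitzOnWith L (α · t) (ball z₀ r) := by
  obtain ⟨ε, hε, a, r, _, _, hr, hpl⟩ := IsPicardLindelof.of_contDiffAt_one hF
  obtain ⟨α, hα, L, hL⟩ := (hpl 0).exists_forall_mem_closedBall_eq_hasDerivWithinAt_lipschitzOnWith
  simp only [zero_sub, zero_add] at hα hL
  have hcont : ContinuousAt (Function.uncurry α) (z₀, 0) :=
    (continuousOn_prod_of_continuousOn_lipschitzOnWith _ L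
      (fun z hz t ht ↦ ((hα z hz).2 t ht).continuousWithinAt) hL).continuousAt
      (prod_mem_nhds (closedBall_mem_nhds _ hr) (Icc_mem_nhds (by simpa) hε))
  have hmem : ∀ᶠ q in 𝓝 (z₀, (0 : ℝ)), α q.1 q.2 ∈ U := by
    refine hcont ?_
    rwa [Function.uncurry_apply_pair, (hα z₀ (mem_closedBall_self r.2)).1]
  obtain ⟨η, hη, hηU⟩ := Metric.eventually_nhds_iff_ball.1 hmem
  have hIoo {t : ℝ} (ht : t ∈ Ioo (-min ε η) (min ε η)) : t ∈ Ioo (-ε) ε :=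
    Ioo_subset_Ioo (neg_le_neg (min_le_left _ _)) (min_le_left _ _) ht
  have hball {z : V} (hz : z ∈ ball z₀ (min r η)) : z ∈ closedBall z₀ r :=
    ball_subset_closedBall (ball_subset_ball (min_le_left _ _) hz)
  refine ⟨min r η, lt_min hr hη, min ε η, lt_min hε hη, α, L, fun z hz ↦
    ⟨(hα z (hball hz)).1, fun t ht ↦ ⟨hηU (z, t) ?_, ?_⟩⟩, fun t ht ↦ ?_⟩
  · rw [mem_ball, Prod.dist_eq, Real.dist_0_eq_abs, max_lt_iff]
    exact ⟨(mem_ball.1 hz).trans_le (min_le_right _ _),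
      (abs_lt.2 ht).trans_le (min_le_right _ _)⟩
  · exact ((hα z (hball hz)).2 t (Ioo_subset_Icc_self (hIoo ht))).hasDerivAt
      (Icc_mem_nhds (hIoo ht).1 (hIoo ht).2)
  · exact (hL t (Ioo_subset_Icc_self (hIoo ht))).mono fun z hz ↦ hball hz

theorem norm_sub_sub_variation_le {F : V → V} {S : Set V} {K C L ε : ℝ} (hC : 0 ≤ C)
    (hS : ∀ a ∈ S, ‖fderiv ℝ F a‖ ≤ K ∧
      ∀ b ∈ S, ‖F b - F a - fderiv ℝ F a (b - a)‖ ≤ C * ‖b - a‖ ^ 2)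
    {a b : ℝ → V} {Y : ℝ → V →L[ℝ] V}
    (ha : ∀ t ∈ Ioo (-ε) ε, a t ∈ S ∧ HasDerivAt a (F (a t)) t)
    (hb : ∀ t ∈ Ioo (-ε) ε, b t ∈ S ∧ HasDerivAt b (F (b t)) t)
    (hY : ∀ t ∈ Ioo (-ε) ε, HasDerivAt Y (fderiv ℝ F (a t) ∘L Y t) t)
    (hY0 : Y 0 = ContinuousLinearMap.id ℝ V)
    (hab : ∀ t ∈ Ioo (-ε) ε, ‖b t - a t‖ ≤ L * ‖b 0 - a 0‖) {t : ℝ} (ht : t ∈ Ioo (-ε) ε) :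
    ‖b t - a t - Y t (b 0 - a 0)‖ ≤ gronwallBound 0 K (C * (L * ‖b 0 - a 0‖) ^ 2) |t| := by
  set h := b 0 - a 0 with hh
  refine norm_le_gronwallBound_abs (e := fun t ↦ b t - a t - Y t h)
    (fun s hs ↦ ((hb s hs).2.sub (ha s hs).2).sub ((hY s hs).clm_apply (hasDerivAt_const s h)))
    (by simp [hY0, hh]) (fun s hs ↦ ?_) ht
  obtain ⟨hK, htaylor⟩ := hS (a s) (ha s hs).1
  have hsplit : F (b s) - F (a s) - ((fderiv ℝ F (a s) ∘L Y s) h + Y s 0) =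
      fderiv ℝ F (a s) (b s - a s - Y s h) +
        (F (b s) - F (a s) - fderiv ℝ F (a s) (b s - a s)) := by
    simp only [map_sub, map_zero, ContinuousLinearMap.comp_apply]
    abel
  rw [hsplit]
  refine (norm_add_le _ _).trans (add_le_add ((fderiv ℝ F (a s)).le_of_opNorm_le hK _) ?_)
  refine (htaylor (b s) (hb s hs).1).trans ?_
  gcongr
  exact hab s hs

theorem hasFDerivAt_flow_of_variation {F : V → V} {S : Set V} {K ε r : ℝ} {C L : NNReal}
    (hK : 0 < K) (hS : ∀ a ∈ S, ‖fderiv ℝ F a‖ ≤ K ∧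
      ∀ b ∈ S, ‖F b - F a - fderiv ℝ F a (b - a)‖ ≤ C * ‖b - a‖ ^ 2)
    {α : V → ℝ → V} {z₀ : V} (hα : ∀ z ∈ ball z₀ r, α z 0 = z ∧
      ∀ t ∈ Ioo (-ε) ε, α z t ∈ S ∧ HasDerivAt (α z) (F (α z t)) t)
    (hL : ∀ t ∈ Ioo (-ε) ε, LipschitzOnWith L (α · t) (ball z₀ r))
    {z : V} (hz : z ∈ ball z₀ r) {Y : ℝ → V →L[ℝ] V}
    (hY : ∀ t ∈ Ioo (-ε) ε, HasDerivAt Y (fderiv ℝ F (α z t) ∘L Y t) t)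
    (hY0 : Y 0 = ContinuousLinearMap.id ℝ V) {t : ℝ} (ht : t ∈ Ioo (-ε) ε) :
    HasFDerivAt (fun z' ↦ α z' t) (Y t) z := by
  rw [hasFDerivAt_iff_isLittleO_nhds_zero]
  refine Asymptotics.IsBigO.trans_isLittleO (g := fun h : V ↦ ‖h‖ ^ 2)
    (Asymptotics.IsBigO.of_bound (C * L ^ 2 / K * (Real.exp (K * |t|) - 1)) ?_)
    (Asymptotics.isLittleO_norm_pow_id one_lt_two)
  have hnear : ∀ᶠ h in 𝓝 (0 : V), z + h ∈ ball z₀ r :=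
    (continuous_const_add z).continuousAt.preimage_mem_nhds
      (isOpen_ball.mem_nhds (by rwa [add_zero]))
  filter_upwards [hnear] with h hh
  have bound := norm_sub_sub_variation_le C.coe_nonneg hS (hα z hz).2 (hα _ hh).2 hY hY0
    (fun s hs ↦ by simpa [(hα z hz).1, (hα _ hh).1, dist_eq_norm] using
      (hL s hs).dist_le_mul _ hh _ hz) ht
  rw [(hα z hz).1, (hα _ hh).1, add_sub_cancel_left, gronwallBound_of_K_ne_0 hK.ne'] at bound
  refine bound.trans (le_of_eq ?_)
  simp only [norm_pow, norm_norm]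
  ring

theorem exists_differentiable_local_flow [CompleteSpace V] {F : V → V} {Ω : Set V} {z₀ : V}
    (hF : ContDiffAt ℝ 2 F z₀) (hΩ : Ω ∈ 𝓝 z₀) :
    ∃ r > 0, ∃ ε > 0, ∃ (α : V → ℝ → V) (Y : V → ℝ → V →L[ℝ] V), ∀ z ∈ ball z₀ r,
      α z 0 = z ∧ Y z 0 = ContinuousLinearMap.id ℝ V ∧ ∀ t ∈ Ioo (-ε) ε,
        α z t ∈ Ω ∧ HasDerivAt (α z) (F (α z t)) t ∧
        HasDerivAt (Y z) (fderiv ℝ F (α z t) ∘L Y z t) t ∧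
        HasFDerivAt (fun z' ↦ α z' t) (Y z t) z := by
  obtain ⟨R, hR, K, hK, C, hS⟩ := exists_ball_norm_image_sub_sub_fderiv_le hF
  -- the flow of the field together with its linearisation
  let G : V × (V →L[ℝ] V) → V × (V →L[ℝ] V) := fun p ↦ (F p.1, fderiv ℝ F p.1 ∘L p.2)
  have hG : ContDiffAt ℝ 1 G (z₀, ContinuousLinearMap.id ℝ V) :=
    (ContDiffAt.comp (g := F) _ (hF.of_le (by norm_num)) contDiffAt_fst).prodMk
      (((hF.fderiv_right (by norm_num)).comp (g := fderiv ℝ F) _ contDiffAt_fst).clm_comp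
        contDiffAt_snd)
  obtain ⟨r, hr, ε, hε, β, L, hβ, hL⟩ := exists_lipschitz_local_flow hG
    (continuousAt_fst (inter_mem hΩ (ball_mem_nhds z₀ hR)))
  have hmem {z : V} (hz : z ∈ ball z₀ r) :
      (z, ContinuousLinearMap.id ℝ V) ∈ ball (z₀, ContinuousLinearMap.id ℝ V) r := by
    rw [mem_ball, Prod.dist_eq, dist_self]
    exact max_lt hz hr
  let α (z : V) (t : ℝ) : V := (β (z, ContinuousLinearMap.id ℝ V) t).1
  let Y (z : V) (t : ℝ) : V →L[ℝ] V := (β (z, ContinuousLinearMap.id ℝ V) t).2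
  have hα : ∀ z ∈ ball z₀ r, α z 0 = z ∧
      ∀ t ∈ Ioo (-ε) ε, α z t ∈ ball z₀ R ∧ HasDerivAt (α z) (F (α z t)) t := fun z hz ↦
    ⟨congrArg Prod.fst (hβ _ (hmem hz)).1, fun t ht ↦
      ⟨((hβ _ (hmem hz)).2 t ht).1.2, ((hβ _ (hmem hz)).2 t ht).2.fst⟩⟩
  have hY : ∀ z ∈ ball z₀ r, Y z 0 = ContinuousLinearMap.id ℝ V ∧
      ∀ t ∈ Ioo (-ε) ε, HasDerivAt (Y z) (fderiv ℝ F (α z t) ∘L Y z t) t := fun z hz ↦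
    ⟨congrArg Prod.snd (hβ _ (hmem hz)).1, fun t ht ↦ ((hβ _ (hmem hz)).2 t ht).2.snd⟩
  have hαL : ∀ t ∈ Ioo (-ε) ε, LipschitzOnWith L (α · t) (ball z₀ r) := fun t ht ↦
    LipschitzOnWith.of_dist_le_mul fun z hz z' hz' ↦ by
      simpa [Prod.dist_eq] using (le_max_left _ _).trans
        ((hL t ht).dist_le_mul _ (hmem hz) _ (hmem hz'))
  refine ⟨r, hr, ε, hε, α, Y, fun z hz ↦ ⟨(hα z hz).1, (hY z hz).1, fun t ht ↦
    ⟨((hβ _ (hmem hz)).2 t ht).1.1, ((hα z hz).2 t ht).2, (hY z hz).2 t ht,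
      hasFDerivAt_flow_of_variation hK hS hα hαL hz (hY z hz).2 (hY z hz).1 ht⟩⟩⟩

end LocalFlow

section ChartField

variable {E H N : Type*} [NormedAddCommGroup E] [NormedSpace ℝ E] [TopologicalSpace H]
  {I : ModelWithCorners ℝ E H} [TopologicalSpace N] [ChartedSpace H N] [IsManifold I 1 N]

/-- The expression of the vector field `v` in the chart of `N` centred at `x₀`; it is meaningful on
the target of that chart. -/
def chartField (v : (x : N) → TangentSpace I x) (x₀ : N) (z : E) : E :=
  tangentCoordChange I ((extChartAt I x₀).symm z) x₀ ((extChartAt I x₀).symm z)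
    (v ((extChartAt I x₀).symm z))

variable {v : (x : N) → TangentSpace I x} {x₀ : N}

theorem chartField_extChartAt {x : N} (hx : x ∈ (extChartAt I x₀).source) :
    chartField v x₀ (extChartAt I x₀ x) = tangentCoordChange I x x₀ x (v x) := by
  rw [chartField, (extChartAt I x₀).left_inv hx]

theorem contMDiff_iff_contDiffOn_chartField {m : ℕ∞ω} [IsManifold I m N]
    [ContMDiffVectorBundle m E (TangentSpace I : N → Type _) I] :
    CMDiff m (fun x ↦ (⟨x, v x⟩ : TangentBundle I N)) ↔
      ∀ x₀, ContDiffOn ℝ m (chartField v x₀) (extChartAt I x₀).target := by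
  have hbase (x₀ : N) : (trivializationAt E (TangentSpace I) x₀).baseSet =
      (extChartAt I x₀).source := by simp [mfld_simps]
  have hchart (x₀ : N) :
      CMDiff[(extChartAt I x₀).source] m (fun x ↦ (⟨x, v x⟩ : TangentBundle I N)) ↔
        ContDiffOn ℝ m (chartField v x₀) (extChartAt I x₀).target := by
    have hloc : ContMDiffOn I 𝓘(ℝ, E) m
        (fun x ↦ (trivializationAt E (TangentSpace I) x₀ ⟨x, v x⟩).2) (extChartAt I x₀).source ↔
          ContDiffOn ℝ m (chartField v x₀) (extChartAt I x₀).target := by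
      rw [contMDiffOn_iff_of_subset_source' (I' := 𝓘(ℝ, E)) (y := 0) subset_rfl
        (fun _ _ ↦ by rw [extChartAt_model_space_eq_id]; trivial),
        (extChartAt I x₀).image_source_eq_target]
      rfl
    rw [← hloc, ← hbase]
    exact (trivializationAt E (TangentSpace I) x₀).contMDiffOn_section_baseSet_iff
  refine ⟨fun h x₀ ↦ (hchart x₀).1 h.contMDiffOn, fun h x₀ ↦ ?_⟩
  exact ((hchart x₀).2 (h x₀)).contMDiffAt (extChartAt_source_mem_nhds x₀)

theorem hasMFDerivAt_iff_hasDerivAt_extChartAt [I.Boundaryless] {γ : ℝ → N} {t : ℝ}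
    (ht : γ t ∈ (extChartAt I x₀).source) {w : E} :
    HasMFDerivAt% γ t ((1 : ℝ →L[ℝ] ℝ).smulRight (w : TangentSpace I (γ t))) ↔
      ContinuousAt γ t ∧
        HasDerivAt (extChartAt I x₀ ∘ γ) (tangentCoordChange I (γ t) x₀ (γ t) w) t := by
  have hself : γ t ∈ (extChartAt I (γ t)).source := mem_extChartAt_source (γ t)
  have htransition {x y : N} (hx : γ t ∈ (extChartAt I x).source)
      (hy : γ t ∈ (extChartAt I y).source) :
      HasFDerivAt (extChartAt I y ∘ (extChartAt I x).symm) (tangentCoordChange I x y (γ t))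
        (extChartAt I x (γ t)) := by
    simpa [I.range_eq_univ] using hasFDerivWithinAt_tangentCoordChange ⟨hx, hy⟩
  have hchange {x y : N} (hc : ContinuousAt γ t) (hx : γ t ∈ (extChartAt I x).source)
      (hy : γ t ∈ (extChartAt I y).source) {w' : E} (h : HasDerivAt (extChartAt I x ∘ γ) w' t) :
      HasDerivAt (extChartAt I y ∘ γ) (tangentCoordChange I x y (γ t) w') t := by
    refine ((htransition hx hy).comp_hasDerivAt t h).congr_of_eventuallyEq ?_
    filter_upwards [hc ((isOpen_extChartAt_source x).mem_nhds hx)] with s hs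
    simp only [Function.comp_apply, (extChartAt I x).left_inv hs]
  have hdef : HasMFDerivAt% γ t ((1 : ℝ →L[ℝ] ℝ).smulRight (w : TangentSpace I (γ t))) ↔
      ContinuousAt γ t ∧ HasDerivAt (extChartAt I (γ t) ∘ γ) w t := by
    simp only [HasMFDerivAt, writtenInExtChartAt, mfld_simps]
    have hlin : (1 : ℝ →L[ℝ] ℝ).smulRight w = ContinuousLinearMap.toSpanSingleton ℝ w := by
      ext; simp
    refine and_congr_right fun _ ↦ ?_
    change HasFDerivWithinAt (extChartAt I (γ t) ∘ γ) ((1 : ℝ →L[ℝ] ℝ).smulRight w) univ t ↔ _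
    rw [hasFDerivWithinAt_univ, hlin, hasDerivAt_iff_hasFDerivAt]
    rfl
  rw [hdef]
  refine and_congr_right fun hc ↦ ⟨hchange hc hself ht, fun h ↦ ?_⟩
  have h' := hchange hc ht hself h
  rwa [tangentCoordChange_comp ⟨⟨hself, ht⟩, hself⟩, tangentCoordChange_self hself] at h'

end ChartField

section IntegralCurve

variable {E H N : Type*} [NormedAddCommGroup E] [NormedSpace ℝ E] [TopologicalSpace H]
  {I : ModelWithCorners ℝ E H} [I.Boundaryless] [TopologicalSpace N] [ChartedSpace H N]
  [IsManifold I ∞ N] {v : (x : N) → TangentSpace I x} {x₀ : N}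

theorem hasMFDerivAt_iff_hasDerivAt_chartField {γ : ℝ → N} {t : ℝ}
    (ht : γ t ∈ (extChartAt I x₀).source) :
    HasMFDerivAt% γ t ((1 : ℝ →L[ℝ] ℝ).smulRight (v (γ t))) ↔
      ContinuousAt γ t ∧
        HasDerivAt (extChartAt I x₀ ∘ γ) (chartField v x₀ (extChartAt I x₀ (γ t))) t := by
  rw [chartField_extChartAt ht]
  exact hasMFDerivAt_iff_hasDerivAt_extChartAt ht

theorem hasMFDerivAt_extChartAt_symm_comp {z : ℝ → E} {t : ℝ}
    (hz : z t ∈ (extChartAt I x₀).target) (h : HasDerivAt z (chartField v x₀ (z t)) t) :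
    HasMFDerivAt% ((extChartAt I x₀).symm ∘ z) t
      ((1 : ℝ →L[ℝ] ℝ).smulRight (v ((extChartAt I x₀).symm (z t)))) := by
  refine (hasMFDerivAt_iff_hasDerivAt_chartField (γ := (extChartAt I x₀).symm ∘ z)
    ((extChartAt I x₀).map_target hz)).2 ⟨?_, ?_⟩
  · exact (continuousAt_extChartAt_symm'' hz).comp h.continuousAt
  · simp only [Function.comp_apply, (extChartAt I x₀).right_inv hz]
    refine h.congr_of_eventuallyEq ?_
    filter_upwards [h.continuousAt ((isOpen_extChartAt_target x₀).mem_nhds hz)] with s hs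
    exact (extChartAt I x₀).right_inv hs

theorem exists_nhds_isMIntegralCurveOn [CompleteSpace E]
    (hv : CMDiff 1 (fun x ↦ (⟨x, v x⟩ : TangentBundle I N))) (x₀ : N) :
    ∃ U ∈ 𝓝 x₀, ∃ ε > 0, ∀ x ∈ U, ∃ γ : ℝ → N, γ 0 = x ∧ IsMIntegralCurveOn γ v (Ioo (-ε) ε) := by
  have hx₀ := mem_extChartAt_source (I := I) x₀
  have htarget := (isOpen_extChartAt_target (I := I) x₀).mem_nhds
    ((extChartAt I x₀).map_source hx₀)
  obtain ⟨r, hr, ε, hε, α, -, hα, -⟩ := exists_lipschitz_local_flow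
    ((contMDiff_iff_contDiffOn_chartField.1 hv x₀).contDiffAt htarget) htarget
  refine ⟨_, inter_mem (extChartAt_source_mem_nhds (I := I) x₀)
    (continuousAt_extChartAt (I := I) x₀ (ball_mem_nhds _ hr)), ε, hε, ?_⟩
  rintro x ⟨hx, hxr⟩
  refine ⟨(extChartAt I x₀).symm ∘ α (extChartAt I x₀ x), ?_, fun t ht ↦ ?_⟩
  · rw [Function.comp_apply, (hα _ hxr).1, (extChartAt I x₀).left_inv hx]
  · obtain ⟨hmem, hderiv⟩ := (hα _ hxr).2 t ht
    exact (hasMFDerivAt_extChartAt_symm_comp hmem hderiv).hasMFDerivWithinAt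

theorem exists_isMIntegralCurveOn_of_isCompact [CompleteSpace E]
    (hv : CMDiff 1 (fun x ↦ (⟨x, v x⟩ : TangentBundle I N))) {K : Set N} (hK : IsCompact K) :
    ∃ ε > 0, ∀ x ∈ K, ∃ γ : ℝ → N, γ 0 = x ∧ IsMIntegralCurveOn γ v (Ioo (-ε) ε) := by
  have hshrink {ε ε' : ℝ} (hle : ε ≤ ε') {x : N}
      (h : ∃ γ : ℝ → N, γ 0 = x ∧ IsMIntegralCurveOn γ v (Ioo (-ε') ε')) :
      ∃ γ : ℝ → N, γ 0 = x ∧ IsMIntegralCurveOn γ v (Ioo (-ε) ε) :=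
    h.imp fun γ hγ ↦ ⟨hγ.1, hγ.2.mono (Ioo_subset_Ioo (neg_le_neg hle) hle)⟩
  refine hK.induction_on (p := fun S ↦ ∃ ε > 0, ∀ x ∈ S, ∃ γ : ℝ → N,
    γ 0 = x ∧ IsMIntegralCurveOn γ v (Ioo (-ε) ε)) ⟨1, one_pos, by simp⟩ ?_ ?_ ?_
  · rintro S S' hS ⟨ε, hε, h⟩
    exact ⟨ε, hε, fun x hx ↦ h x (hS hx)⟩
  · rintro S S' ⟨ε, hε, h⟩ ⟨ε', hε', h'⟩
    refine ⟨min ε ε', lt_min hε hε', fun x hx ↦ ?_⟩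
    exact hx.elim (fun hx ↦ hshrink (min_le_left _ _) (h x hx))
      (fun hx ↦ hshrink (min_le_right _ _) (h' x hx))
  · intro x _
    obtain ⟨U, hU, hε⟩ := exists_nhds_isMIntegralCurveOn hv x
    exact ⟨U, mem_nhdsWithin_of_mem_nhds hU, hε⟩

theorem contMDiffAt_of_isMIntegralCurveAt [CompleteSpace E] {γ : ℝ → N} {t : ℝ}
    (hv : CMDiff ∞ (fun x ↦ (⟨x, v x⟩ : TangentBundle I N))) (h : IsMIntegralCurveAt γ v t) :
    CMDiffAt ∞ γ t := by
  have hmem : ∀ᶠ s in 𝓝 t, γ s ∈ (extChartAt I (γ t)).source :=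
    h.continuousAt (extChartAt_source_mem_nhds (γ t))
  obtain ⟨ε, hε, hsub⟩ := nhds_basis_closedBall.eventually_iff.1 (h.and hmem)
  rw [Real.closedBall_eq_Icc] at hsub
  have hderiv : ∀ s ∈ Icc (t - ε) (t + ε), HasDerivWithinAt (extChartAt I (γ t) ∘ γ)
      (chartField v (γ t) ((extChartAt I (γ t) ∘ γ) s)) (Icc (t - ε) (t + ε)) s := fun s hs ↦
    ((hasMFDerivAt_iff_hasDerivAt_chartField (hsub hs).2).1 (hsub hs).1).2.hasDerivWithinAt
  have hfield : ContDiffOn ℝ ∞ (fun z : ℝ × E ↦ chartField v (γ t) z.2)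
      (Icc (t - ε) (t + ε) ×ˢ (extChartAt I (γ t)).target) :=
    (contMDiff_iff_contDiffOn_chartField.1 hv (γ t)).comp contDiffOn_snd fun z hz ↦ hz.2
  have hchart := ODE.contDiffOn_enat_Icc_of_hasDerivWithinAt (n := ⊤) hfield hderiv
    fun s hs ↦ (extChartAt I (γ t)).map_source (hsub hs).2
  refine contMDiffAt_iff.2 ⟨h.continuousAt, ?_⟩
  have hsmooth := hchart.contDiffAt
    (Icc_mem_nhds (sub_lt_self t hε) (lt_add_of_pos_right t hε))
  simpa [mfld_simps, contDiffWithinAt_univ] using! hsmooth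

variable [T2Space N]

theorem exists_isMIntegralCurveOn_Ioo_of_forall_lt
    (hv : CMDiff 1 (fun x ↦ (⟨x, v x⟩ : TangentBundle I N))) {x : N} {T : ℝ} (hT : 0 < T)
    (h : ∀ a < T, ∃ γ : ℝ → N, γ 0 = x ∧ IsMIntegralCurveOn γ v (Ioo (-a) a)) :
    ∃ γ : ℝ → N, γ 0 = x ∧ IsMIntegralCurveOn γ v (Ioo (-T) T) := by
  have : Nonempty N := ⟨x⟩
  choose! γ hγx hγ using h
  have hunique {a b : ℝ} (haT : a < T) (hbT : b < T) {t : ℝ} (hta : |t| < a) (htb : |t| < b) :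
      γ a t = γ b t := by
    have hpos : 0 < min a b := (abs_nonneg t).trans_lt (lt_min hta htb)
    exact isMIntegralCurveOn_Ioo_eqOn_of_contMDiff_boundaryless (t₀ := 0)
      ⟨neg_lt_zero.2 hpos, hpos⟩ hv
      ((hγ a haT).mono (Ioo_subset_Ioo (neg_le_neg (min_le_left _ _)) (min_le_left _ _)))
      ((hγ b hbT).mono (Ioo_subset_Ioo (neg_le_neg (min_le_right _ _)) (min_le_right _ _)))
      ((hγx a haT).trans (hγx b hbT).symm) (abs_lt.1 (lt_min hta htb))
  have hmid {t : ℝ} (ht : |t| < T) : |t| < (|t| + T) / 2 ∧ (|t| + T) / 2 < T := by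
    constructor <;> linarith
  refine ⟨fun t ↦ γ ((|t| + T) / 2) t, hγx _ (hmid (by simpa using hT)).2, fun t ht ↦ ?_⟩
  have hatT := hmid (abs_lt.2 ht)
  have hmem := abs_lt.1 hatT.1
  refine HasMFDerivAt.hasMFDerivWithinAt (HasMFDerivAt.congr_of_eventuallyEq
    ((hγ _ hatT.2 t hmem).hasMFDerivAt (Ioo_mem_nhds hmem.1 hmem.2)) ?_)
  filter_upwards [Ioo_mem_nhds hmem.1 hmem.2] with s hs
  have hsT := hmid ((abs_lt.2 hs).trans hatT.2)
  exact hunique hsT.2 hatT.2 hsT.1 (abs_lt.2 hs)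

theorem exists_isMIntegralCurveOn_Ioo_extension
    (hv : CMDiff 1 (fun x ↦ (⟨x, v x⟩ : TangentBundle I N))) {γ : ℝ → N} {T ε : ℝ}
    (hε : 0 < ε) (hεT : ε ≤ T) (hγ : IsMIntegralCurveOn γ v (Ioo (-T) T))
    (hext : ∀ t ∈ Ioo (-T) T, ∃ γ' : ℝ → N, γ' 0 = γ t ∧ IsMIntegralCurveOn γ' v (Ioo (-ε) ε)) :
    ∃ γ' : ℝ → N, γ' 0 = γ 0 ∧ IsMIntegralCurveOn γ' v (Ioo (-(T + ε / 2)) (T + ε / 2)) := by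
  have hshift (s : ℝ) (hs : s ∈ Ioo (-T) T) :
      ∃ γ' : ℝ → N, γ' s = γ s ∧ IsMIntegralCurveOn γ' v (Ioo (s - ε) (s + ε)) := by
    obtain ⟨γ', hγ'0, hγ'⟩ := hext s hs
    refine ⟨γ' ∘ (· - s), by simpa using hγ'0, ?_⟩
    refine (isMIntegralCurveOn_comp_sub.2 hγ').mono fun t ht ↦ ?_
    exact ⟨by linarith [ht.1], by linarith [ht.2]⟩
  obtain ⟨γ₁, hγ₁s, hγ₁⟩ := hshift (-(T - ε / 2)) ⟨by linarith, by linarith⟩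
  obtain ⟨γ₂, hγ₂s, hγ₂⟩ := hshift (T - ε / 2) ⟨by linarith, by linarith⟩
  have hsub₁ : Ioo (-(T + ε / 2)) T ⊆
      Ioo (-T) T ∪ Ioo (-(T - ε / 2) - ε) (-(T - ε / 2) + ε) := by
    rw [union_comm]
    exact Ioo_subset_Ioo_union_Ioo (by linarith) (by linarith) le_rfl
  have hsub₂ : Ioo (-(T + ε / 2)) (T + ε / 2) ⊆
      Ioo (-(T + ε / 2)) T ∪ Ioo (T - ε / 2 - ε) (T - ε / 2 + ε) :=
    Ioo_subset_Ioo_union_Ioo le_rfl (by linarith) (by linarith)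
  have hleft := (isMIntegralCurveOn_piecewise hv hγ hγ₁ (t₀ := -(T - ε / 2))
    ⟨⟨by linarith, by linarith⟩, ⟨by linarith, by linarith⟩⟩ hγ₁s.symm).mono hsub₁
  have hright := (isMIntegralCurveOn_piecewise hv hleft hγ₂ (t₀ := T - ε / 2)
    ⟨⟨by linarith, by linarith⟩, ⟨by linarith, by linarith⟩⟩
    (by rw [piecewise, if_pos ⟨by linarith, by linarith⟩, hγ₂s])).mono hsub₂
  refine ⟨_, ?_, hright⟩
  rw [piecewise, if_pos ⟨by linarith, by linarith⟩, piecewise,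
    if_pos ⟨by linarith, by linarith⟩]

theorem exists_isMIntegralCurve_of_isCompact_image [CompleteSpace E]
    (hv : CMDiff 1 (fun x ↦ (⟨x, v x⟩ : TangentBundle I N)))
    (h : ∀ (γ : ℝ → N) (T : ℝ), 0 < T → IsMIntegralCurveOn γ v (Ioo (-T) T) →
      ∃ K, IsCompact K ∧ MapsTo γ (Ioo (-T) T) K) (x : N) :
    ∃ γ : ℝ → N, γ 0 = x ∧ IsMIntegralCurve γ v := by
  set A : Set ℝ := {a | ∃ γ : ℝ → N, γ 0 = x ∧ IsMIntegralCurveOn γ v (Ioo (-a) a)}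
  have hlt {a b : ℝ} (hb : b ∈ A) (hab : a ≤ b) : a ∈ A :=
    hb.imp fun γ hγ ↦ ⟨hγ.1, hγ.2.mono (Ioo_subset_Ioo (neg_le_neg hab) hab)⟩
  suffices hunbounded : ¬ BddAbove A by
    refine (exists_isMIntegralCurve_iff_exists_isMIntegralCurveOn_Ioo hv x).2 fun a ↦ ?_
    obtain ⟨b, hb, hab⟩ := not_bddAbove_iff.1 hunbounded a
    exact hlt hb hab.le
  intro hbdd
  obtain ⟨U, hU, ε₀, hε₀, hlocal⟩ := exists_nhds_isMIntegralCurveOn hv x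
  have hε₀A : ε₀ ∈ A := hlocal x (mem_of_mem_nhds hU)
  have hT : 0 < sSup A := hε₀.trans_le (le_csSup hbdd hε₀A)
  obtain ⟨γ, hγx, hγ⟩ := exists_isMIntegralCurveOn_Ioo_of_forall_lt hv hT fun a ha ↦ by
    obtain ⟨b, hb, hab⟩ := exists_lt_of_lt_csSup ⟨ε₀, hε₀A⟩ ha
    exact hlt hb hab.le
  obtain ⟨K, hK, hγK⟩ := h γ _ hT hγ
  obtain ⟨ε, hε, huniform⟩ := exists_isMIntegralCurveOn_of_isCompact hv hK
  have hmin : 0 < min ε (sSup A) := lt_min hε hT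
  obtain ⟨γ', hγ'0, hγ'⟩ := exists_isMIntegralCurveOn_Ioo_extension hv hmin (min_le_right _ _) hγ
    fun t ht ↦ (huniform _ (hγK ht)).imp fun _ hq ↦
      ⟨hq.1, hq.2.mono (Ioo_subset_Ioo (neg_le_neg (min_le_left _ _)) (min_le_left _ _))⟩
  have hmem : sSup A + min ε (sSup A) / 2 ∈ A := ⟨γ', hγ'0.trans hγx, hγ'⟩
  linarith [le_csSup hbdd hmem]

end IntegralCurve

section Flow

variable {E H N : Type*} [NormedAddCommGroup E] [NormedSpace ℝ E] [TopologicalSpace H]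
  {I : ModelWithCorners ℝ E H} [TopologicalSpace N] [ChartedSpace H N]
  {v : (x : N) → TangentSpace I x}

/-- A vector field is complete if every point lies on an integral curve defined for all times. -/
def IsCompleteField (v : (x : N) → TangentSpace I x) : Prop :=
  ∀ x : N, ∃ γ : ℝ → N, γ 0 = x ∧ IsMIntegralCurve γ v

/-- The flow of a complete vector field. -/
def flow (h : IsCompleteField v) (t : ℝ) (x : N) : N := (h x).choose t

variable (h : IsCompleteField v)

theorem flow_zero (x : N) : flow h 0 x = x := (h x).choose_spec.1

theorem isMIntegralCurve_flow (x : N) : IsMIntegralCurve (fun t ↦ flow h t x) v :=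
  (h x).choose_spec.2

theorem flow_induction {Q : ℝ → N → Prop}
    (hlocal : ∀ x₀, ∃ U ∈ 𝓝 x₀, ∃ ε > 0, ∀ x ∈ U, ∀ t ∈ Ioo (-ε) ε, Q t x)
    (hadd : ∀ s t x, Q t x → Q s (flow h t x) → Q (s + t) x) (t : ℝ) (x : N) : Q t x := by
  have hconst : IsLocallyConstant fun t ↦ Q t x := by
    rw [IsLocallyConstant.iff_eventually_eq]
    intro t₀
    obtain ⟨U, hU, ε, hε, hQ⟩ := hlocal (flow h t₀ x)
    have htransfer (a b : ℝ) (ha : flow h a x ∈ U) (hab : |b - a| < ε) (hQa : Q a x) : Q b x := by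
      simpa using hadd (b - a) a x hQa (hQ _ ha _ (abs_lt.1 hab))
    filter_upwards [(isMIntegralCurve_flow h x).continuous.continuousAt hU, ball_mem_nhds t₀ hε]
      with t htU ht
    rw [mem_ball, Real.dist_eq] at ht
    exact propext ⟨htransfer t t₀ htU (by rwa [abs_sub_comm]),
      htransfer t₀ t (mem_of_mem_nhds hU) ht⟩
  obtain ⟨U, hU, ε, hε, hQ⟩ := hlocal x
  rw [hconst.apply_eq_of_preconnectedSpace t 0]
  exact hQ x (mem_of_mem_nhds hU) 0 ⟨neg_lt_zero.2 hε, hε⟩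

variable [I.Boundaryless] [IsManifold I ∞ N] [T2Space N]

section

variable (hv : CMDiff 1 (fun x ↦ (⟨x, v x⟩ : TangentBundle I N)))
include hv

theorem eqOn_flow {γ : ℝ → N} {a b : ℝ} (h0 : 0 ∈ Ioo a b)
    (hγ : IsMIntegralCurveOn γ v (Ioo a b)) : EqOn γ (fun t ↦ flow h t (γ 0)) (Ioo a b) :=
  isMIntegralCurveOn_Ioo_eqOn_of_contMDiff_boundaryless h0 hv hγ
    ((isMIntegralCurve_flow h _).isMIntegralCurveOn _) (flow_zero h _).symm

theorem eq_flow {γ : ℝ → N} (hγ : IsMIntegralCurve γ v) : γ = fun t ↦ flow h t (γ 0) :=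
  isMIntegralCurve_Ioo_eq_of_contMDiff_boundaryless (t₀ := 0) hv hγ (isMIntegralCurve_flow h _)
    (flow_zero h _).symm

theorem flow_add (s t : ℝ) (x : N) : flow h (s + t) x = flow h s (flow h t x) := by
  simpa using! congrFun (eq_flow h hv ((isMIntegralCurve_flow h x).comp_add t)) s

theorem flow_neg_flow (t : ℝ) (x : N) : flow h (-t) (flow h t x) = x := by
  rw [← flow_add h hv, neg_add_cancel, flow_zero]

theorem image_flow (t : ℝ) (A : Set N) : flow h t '' A = flow h (-t) ⁻¹' A := by
  refine image_eq_preimage_of_inverse (flow_neg_flow h hv t) (fun x ↦ ?_) |> congrFun <| A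
  simpa using flow_neg_flow h hv (-t) x

end

variable [CompleteSpace E]
  (hv : CMDiff 2 (fun x ↦ (⟨x, v x⟩ : TangentBundle I N)))
include hv

theorem exists_nhds_hasFDerivAt_flow (x₀ : N) :
    ∃ U ∈ 𝓝 x₀, IsOpen U ∧ U ⊆ (extChartAt I x₀).source ∧ ∃ ε > 0, ∀ x ∈ U,
      ∃ Y : ℝ → E →L[ℝ] E, Y 0 = ContinuousLinearMap.id ℝ E ∧ ∀ t ∈ Ioo (-ε) ε,
        flow h t x ∈ (extChartAt I x₀).source ∧
        HasDerivAt Y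
          (fderiv ℝ (chartField v x₀) (extChartAt I x₀ (flow h t x)) ∘L Y t) t ∧
        HasFDerivAt (extChartAt I x₀ ∘ flow h t ∘ (extChartAt I x₀).symm) (Y t)
          (extChartAt I x₀ x) := by
  set φ := extChartAt I x₀
  have hx₀ : x₀ ∈ φ.source := mem_extChartAt_source x₀
  have htarget := (isOpen_extChartAt_target (I := I) x₀).mem_nhds (φ.map_source hx₀)
  obtain ⟨r, hr, ε, hε, α, Y, hα⟩ := exists_differentiable_local_flow
    ((contMDiff_iff_contDiffOn_chartField.1 hv x₀).contDiffAt htarget) htarget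
  have hflow {z : E} (hz : z ∈ φ.target ∩ ball (φ x₀) r) {t : ℝ} (ht : t ∈ Ioo (-ε) ε) :
      flow h t (φ.symm z) = φ.symm (α z t) := by
    have hcurve : IsMIntegralCurveOn (φ.symm ∘ α z) v (Ioo (-ε) ε) := fun s hs ↦ by
      obtain ⟨hmem, hderiv, -⟩ := (hα z hz.2).2.2 s hs
      exact (hasMFDerivAt_extChartAt_symm_comp hmem hderiv).hasMFDerivWithinAt
    simpa [(hα z hz.2).1] using
      (eqOn_flow h (hv.of_le one_le_two) ⟨neg_lt_zero.2 hε, hε⟩ hcurve ht).symm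
  have hopen : IsOpen (φ.target ∩ ball (φ x₀) r) :=
    (isOpen_extChartAt_target x₀).inter isOpen_ball
  have hU : IsOpen (φ.source ∩ φ ⁻¹' ball (φ x₀) r) := isOpen_extChartAt_preimage' x₀ isOpen_ball
  refine ⟨_, hU.mem_nhds ⟨hx₀, mem_ball_self hr⟩, hU, inter_subset_left, ε, hε, fun x hx ↦
    ⟨Y (φ x), (hα _ hx.2).2.1, fun t ht ↦ ?_⟩⟩
  have hz : φ x ∈ φ.target ∩ ball (φ x₀) r := ⟨φ.map_source hx.1, hx.2⟩
  obtain ⟨hmem, -, hY, hfderiv⟩ := (hα _ hx.2).2.2 t ht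
  have hx' : flow h t x = φ.symm (α (φ x) t) := by rw [← hflow hz ht, φ.left_inv hx.1]
  refine ⟨hx' ▸ φ.map_target hmem, by rwa [hx', φ.right_inv hmem],
    hfderiv.congr_of_eventuallyEq ?_⟩
  filter_upwards [hopen.mem_nhds hz] with z' hz'
  rw [Function.comp_apply, Function.comp_apply, hflow hz' ht,
    φ.right_inv ((hα z' hz'.2).2.2 t ht).1]

theorem mdifferentiable_flow (t : ℝ) : MDiff (flow h t) := by
  refine fun x ↦ flow_induction h (Q := fun t x ↦ MDiffAt (flow h t) x)
    (fun x₀ ↦ ?_) (fun s t x ht hs ↦ ?_) t x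
  · obtain ⟨U, hU, hUo, hUs, ε, hε, hY⟩ := exists_nhds_hasFDerivAt_flow h hv x₀
    refine ⟨U, hU, ε, hε, fun x hx t ht ↦ ?_⟩
    choose! Y _ hY using hY
    set φ := extChartAt I x₀
    have hderiv := ((hY x hx t ht).2.2).differentiableAt
    refine (mdifferentiableAt_iff_of_mem_source (x := x₀) (y := x₀)
      (by simpa [φ, extChartAt_source] using hUs hx)
      (by simpa [φ, extChartAt_source] using (hY x hx t ht).1)).2
      ⟨?_, hderiv.differentiableWithinAt⟩
    have hcont := (continuousAt_extChartAt_symm' (hY x hx t ht).1).comp_of_eq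
      (hderiv.continuousAt.comp (continuousAt_extChartAt' (hUs hx)))
      (by rw [Function.comp_apply, Function.comp_apply, Function.comp_apply, φ.left_inv (hUs hx)])
    refine hcont.congr ?_
    filter_upwards [hUo.mem_nhds hx] with x' hx'
    simp only [Function.comp_apply]
    rw [φ.left_inv (hUs hx'), φ.left_inv (hY x' hx' t ht).1]
  · rw [show flow h (s + t) = flow h s ∘ flow h t from
      funext (flow_add h (hv.of_le one_le_two) s t)]
    exact hs.comp x ht

theorem continuous_flow (t : ℝ) : Continuous (flow h t) := (mdifferentiable_flow h hv t).continuous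

end Flow

section Liouville

variable {E H N : Type*} [NormedAddCommGroup E] [NormedSpace ℝ E] [TopologicalSpace H]
  {I : ModelWithCorners ℝ E H} [TopologicalSpace N] [ChartedSpace H N]

theorem det_mul_density_eq_of_continuity_equation [FiniteDimensional ℝ E] {F : E → E} {ρ : E → ℝ}
    {z : ℝ → E} {Y : ℝ → E →L[ℝ] E} {ε t : ℝ}
    (hz : ∀ s ∈ Ioo (-ε) ε, HasDerivAt z (F (z s)) s)
    (hY : ∀ s ∈ Ioo (-ε) ε, HasDerivAt Y (fderiv ℝ F (z s) ∘L Y s) s)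
    (hY0 : Y 0 = ContinuousLinearMap.id ℝ E)
    (hρ : ∀ s ∈ Ioo (-ε) ε, DifferentiableAt ℝ ρ (z s))
    (hdiv : ∀ s ∈ Ioo (-ε) ε, fderiv ℝ ρ (z s) (F (z s)) +
      LinearMap.trace ℝ E (fderiv ℝ F (z s)) * ρ (z s) = 0) (ht : t ∈ Ioo (-ε) ε) :
    (Y t).det * ρ (z t) = ρ (z 0) := by
  have hderiv (s : ℝ) (hs : s ∈ Ioo (-ε) ε) :
      HasDerivAt (fun s ↦ (Y s).det * ρ (z s)) 0 s :=
    ((hasDerivAt_clm_det (hY s hs)).mul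
      ((hρ s hs).hasFDerivAt.comp_hasDerivAt s (hz s hs))).congr_deriv
        (by simp only [Function.comp_apply]; linear_combination (Y s).det * hdiv s hs)
  have hconst := isOpen_Ioo.is_const_of_deriv_eq_zero isPreconnected_Ioo
    (fun s hs ↦ (hderiv s hs).differentiableAt.differentiableWithinAt)
    (fun s hs ↦ (hderiv s hs).deriv) ht
    (show (0 : ℝ) ∈ Ioo (-ε) ε from ⟨by linarith [ht.1, ht.2], by linarith [ht.1, ht.2]⟩)
  simpa [hY0, ContinuousLinearMap.det] using hconst

variable [MeasurableSpace E] [MeasurableSpace N]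

variable (I) in
/-- The measure `μ` has the density `ρ x₀` with respect to `ν` in the chart centred at `x₀`, for
every `x₀`. -/
def HasChartDensity (ρ : N → E → ℝ) (ν : Measure E) (μ : Measure N) : Prop :=
  ∀ (x₀ : N) (A : Set N), MeasurableSet A → A ⊆ (extChartAt I x₀).source →
    μ A = ∫⁻ z in extChartAt I x₀ '' A, ENNReal.ofReal (ρ x₀ z) ∂ν

theorem measurableSet_image_extChartAt [I.Boundaryless] [BorelSpace E] [BorelSpace N] {x₀ : N}
    {A : Set N} (hA : MeasurableSet A) (hAs : A ⊆ (extChartAt I x₀).source) :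
    MeasurableSet (extChartAt I x₀ '' A) := by
  rw [(extChartAt I x₀).image_eq_target_inter_inv_preimage hAs, ← Subtype.image_preimage_coe]
  exact (isOpen_extChartAt_target x₀).measurableSet.subtype_image
    ((continuousOn_iff_continuous_domRestrict.1 (continuousOn_extChartAt_symm x₀)).measurable hA)

namespace HasChartDensity

variable {ρ : N → E → ℝ} {ν : Measure E} {μ : Measure N}
  [I.Boundaryless] [BorelSpace E] [BorelSpace N] [FiniteDimensional ℝ E] [ν.IsAddHaarMeasure]

theorem measure_image_eq (hμ : HasChartDensity I ρ ν μ) {f : N → N} {f' : N → E →L[ℝ] E} {x₀ : N}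
    {A : Set N} (hA : MeasurableSet A) (hAs : A ⊆ (extChartAt I x₀).source)
    (hfA : MeasurableSet (f '' A)) (hfs : MapsTo f A (extChartAt I x₀).source) (hf : InjOn f A)
    (hf' : ∀ x ∈ A, HasFDerivAt (extChartAt I x₀ ∘ f ∘ (extChartAt I x₀).symm) (f' x)
      (extChartAt I x₀ x))
    (hdet : ∀ x ∈ A, |(f' x).det| * ρ x₀ (extChartAt I x₀ (f x)) = ρ x₀ (extChartAt I x₀ x)) :
    μ (f '' A) = μ A := by
  set φ := extChartAt I x₀
  have himage : φ '' (f '' A) = (φ ∘ f ∘ φ.symm) '' (φ '' A) := by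
    rw [image_image, image_image]
    exact image_congr fun x hx ↦ by simp only [Function.comp_apply, φ.left_inv (hAs hx)]
  have hmeas : MeasurableSet (φ '' A) := measurableSet_image_extChartAt hA hAs
  rw [hμ x₀ _ hfA hfs.image_subset, hμ x₀ A hA hAs, himage,
    lintegral_image_eq_lintegral_abs_det_fderiv_mul ν hmeas (f' := f' ∘ φ.symm)]
  · refine setLIntegral_congr_fun hmeas ?_
    rintro _ ⟨x, hx, rfl⟩
    simp only [Function.comp_apply, φ.left_inv (hAs hx)]
    rw [← ENNReal.ofReal_mul (abs_nonneg _), hdet x hx]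
  · rintro _ ⟨x, hx, rfl⟩
    simpa only [Function.comp_apply, φ.left_inv (hAs hx)] using (hf' x hx).hasFDerivWithinAt
  · rintro _ ⟨x, hx, rfl⟩ _ ⟨y, hy, rfl⟩ hxy
    simp only [Function.comp_apply, φ.left_inv (hAs hx), φ.left_inv (hAs hy)] at hxy
    rw [hf hx hy (φ.injOn (hfs hx) (hfs hy) hxy)]

variable [IsManifold I ∞ N] [T2Space N] {v : (x : N) → TangentSpace I x} {h : IsCompleteField v}

theorem exists_nhds_measure_flow_image_eq (hμ : HasChartDensity I ρ ν μ)
    (hv : CMDiff 2 (fun x ↦ (⟨x, v x⟩ : TangentBundle I N)))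
    (hρ0 : ∀ x₀, ∀ z ∈ (extChartAt I x₀).target, 0 ≤ ρ x₀ z)
    (hρ : ∀ x₀, ∀ z ∈ (extChartAt I x₀).target, DifferentiableAt ℝ (ρ x₀) z)
    (hdiv : ∀ x₀, ∀ z ∈ (extChartAt I x₀).target, fderiv ℝ (ρ x₀) z (chartField v x₀ z) +
      LinearMap.trace ℝ E (fderiv ℝ (chartField v x₀) z) * ρ x₀ z = 0) (t : ℝ) (x : N) :
    ∃ U ∈ 𝓝 x, ∀ A ⊆ U, MeasurableSet A → μ (flow h t '' A) = μ A := by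
  have : CompleteSpace E := FiniteDimensional.complete ℝ E
  have hmeas (t : ℝ) {A : Set N} (hA : MeasurableSet A) : MeasurableSet (flow h t '' A) := by
    rw [image_flow h (hv.of_le one_le_two)]
    exact (continuous_flow h hv _).measurable hA
  refine flow_induction h
    (Q := fun t x ↦ ∃ U ∈ 𝓝 x, ∀ A ⊆ U, MeasurableSet A → μ (flow h t '' A) = μ A)
    (fun x₀ ↦ ?_) (fun s t x hQt hQs ↦ ?_) t x
  · obtain ⟨U, hU, hUo, hUs, ε, hε, hY⟩ := exists_nhds_hasFDerivAt_flow h hv x₀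
    choose! Y hY0 hY using hY
    refine ⟨U, hU, ε, hε, fun x hx t ht ↦ ⟨U, hUo.mem_nhds hx, fun A hAU hA ↦ ?_⟩⟩
    refine hμ.measure_image_eq hA (hAU.trans hUs) (hmeas t hA)
      (fun y hy ↦ (hY y (hAU hy) t ht).1)
      (Function.LeftInverse.injective (flow_neg_flow h (hv.of_le one_le_two) t)).injOn
      (fun y hy ↦ (hY y (hAU hy) t ht).2.2) (fun y hy ↦ ?_)
    have htarget (s : ℝ) (hs : s ∈ Ioo (-ε) ε) := (extChartAt I x₀).map_source
      (hY y (hAU hy) s hs).1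
    have hjacobian := det_mul_density_eq_of_continuity_equation
      (z := extChartAt I x₀ ∘ fun s ↦ flow h s y)
      (fun s hs ↦ ((hasMFDerivAt_iff_hasDerivAt_chartField (hY y (hAU hy) s hs).1).1
        (isMIntegralCurve_flow h y s)).2)
      (fun s hs ↦ (hY y (hAU hy) s hs).2.1) (hY0 y (hAU hy)) (fun s hs ↦ hρ x₀ _ (htarget s hs))
      (fun s hs ↦ hdiv x₀ _ (htarget s hs)) ht
    simp only [Function.comp_apply, flow_zero] at hjacobian
    rw [← abs_of_nonneg (hρ0 x₀ _ (htarget t ht)), ← abs_mul, hjacobian,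
      abs_of_nonneg (hρ0 x₀ _ ((extChartAt I x₀).map_source (hUs (hAU hy))))]
  · obtain ⟨U, hU, hUA⟩ := hQt
    obtain ⟨W, hW, hWA⟩ := hQs
    refine ⟨U ∩ flow h t ⁻¹' W, inter_mem hU ((continuous_flow h hv t).continuousAt hW),
      fun A hAU hA ↦ ?_⟩
    have himage : flow h (s + t) '' A = flow h s '' (flow h t '' A) := by
      rw [image_image]
      exact image_congr fun x _ ↦ flow_add h (hv.of_le one_le_two) s t x
    rw [himage, hWA _ (image_subset_iff.2 fun x hx ↦ (hAU hx).2) (hmeas t hA),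
      hUA A (fun x hx ↦ (hAU hx).1) hA]

theorem measurePreserving_flow [SecondCountableTopology N] (hμ : HasChartDensity I ρ ν μ)
    (hv : CMDiff 2 (fun x ↦ (⟨x, v x⟩ : TangentBundle I N)))
    (hρ0 : ∀ x₀, ∀ z ∈ (extChartAt I x₀).target, 0 ≤ ρ x₀ z)
    (hρ : ∀ x₀, ∀ z ∈ (extChartAt I x₀).target, DifferentiableAt ℝ (ρ x₀) z)
    (hdiv : ∀ x₀, ∀ z ∈ (extChartAt I x₀).target, fderiv ℝ (ρ x₀) z (chartField v x₀ z) +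
      LinearMap.trace ℝ E (fderiv ℝ (chartField v x₀) z) * ρ x₀ z = 0) (t : ℝ) :
    MeasurePreserving (flow h t) μ μ := by
  have : CompleteSpace E := FiniteDimensional.complete ℝ E
  have hmeas : Measurable (flow h t) := (continuous_flow h hv t).measurable
  refine ⟨hmeas, ?_⟩
  choose U hU hUA using exists_nhds_measure_flow_image_eq (h := h) hμ hv hρ0 hρ hdiv (-t)
  obtain ⟨c, hc, hcU⟩ := TopologicalSpace.countable_cover_nhds fun x ↦ interior_mem_nhds.2 (hU x)
  refine (Measure.ext_iff_of_biUnion_eq_univ hc hcU).2 fun x _ ↦ ?_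
  ext A hA
  have hAU : MeasurableSet (A ∩ interior (U x)) := hA.inter isOpen_interior.measurableSet
  rw [Measure.restrict_apply hA, Measure.restrict_apply hA, Measure.map_apply hmeas hAU,
    ← hUA x _ (inter_subset_right.trans interior_subset) hAU,
    image_flow h (hv.of_le one_le_two), neg_neg]

end HasChartDensity

end Liouville

section Trace

theorem trace_prod_eq {R M N : Type*} [CommRing R] [AddCommGroup M] [Module R M]
    [Module.Free R M] [Module.Finite R M] [AddCommGroup N] [Module R N] [Module.Free R N]
    [Module.Finite R N] (L : M × N →ₗ[R] M × N) :
    LinearMap.trace R _ L =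
      LinearMap.trace R M (LinearMap.fst R M N ∘ₗ L ∘ₗ LinearMap.inl R M N) +
      LinearMap.trace R N (LinearMap.snd R M N ∘ₗ L ∘ₗ LinearMap.inr R M N) := by
  have hL : L = (L ∘ₗ LinearMap.inl R M N) ∘ₗ LinearMap.fst R M N +
      (L ∘ₗ LinearMap.inr R M N) ∘ₗ LinearMap.snd R M N := by
    ext <;> simp [show ((0 : M), (0 : N)) = 0 from rfl]
  conv_lhs => rw [hL]
  rw [map_add, LinearMap.trace_comp_comm',
    LinearMap.trace_comp_comm' (LinearMap.snd R M N) (L ∘ₗ LinearMap.inr R M N)]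

theorem trace_adjoint {V : Type*} [NormedAddCommGroup V] [InnerProductSpace ℝ V]
    [FiniteDimensional ℝ V] (A : V →L[ℝ] V) :
    LinearMap.trace ℝ V (ContinuousLinearMap.adjoint A) = LinearMap.trace ℝ V A := by
  rw [LinearMap.trace_eq_sum_inner _ (stdOrthonormalBasis ℝ V),
    LinearMap.trace_eq_sum_inner _ (stdOrthonormalBasis ℝ V)]
  refine Finset.sum_congr rfl fun i _ ↦ ?_
  simp [ContinuousLinearMap.adjoint_inner_right, real_inner_comm]

end Trace

section Spray

variable {𝕜 V W : Type*} [NontriviallyNormedField 𝕜] [NormedAddCommGroup V] [NormedSpace 𝕜 V]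
  [NormedAddCommGroup W] [NormedSpace 𝕜 W] {m : ℕ∞ω}

theorem contDiffAt_clm_flip {B : W → V →L[𝕜] V →L[𝕜] V} {y : W} (hB : ContDiffAt 𝕜 m B y) :
    ContDiffAt 𝕜 m (fun z ↦ (B z).flip) y :=
  (LinearIsometryEquiv.contDiff (E := V →L[𝕜] V →L[𝕜] V) (F := V →L[𝕜] V →L[𝕜] V)
    (ContinuousLinearMap.flipₗᵢ 𝕜 V V V)).contDiffAt.comp y hB

theorem contDiffAt_compL_comp {A : W → V →L[𝕜] V} {B : W → V →L[𝕜] V →L[𝕜] V} {y : W}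
    (hA : ContDiffAt 𝕜 m A y) (hB : ContDiffAt 𝕜 m B y) :
    ContDiffAt 𝕜 m (fun z ↦ ContinuousLinearMap.compL 𝕜 V V V (A z) ∘L B z) y :=
  (hA.continuousLinearMap_comp (ContinuousLinearMap.compL 𝕜 V V V)).clm_comp hB

/-- The vector field on phase space whose integral curves are the geodesics, with their velocities,
of the connection with Christoffel symbols `Γ`. -/
def spray (Γ : V → V →L[𝕜] V →L[𝕜] V) (z : V × V) : V × V := (z.2, -Γ z.1 z.2 z.2)

theorem contDiffAt_spray {Γ : V → V →L[𝕜] V →L[𝕜] V} {z : V × V} (hΓ : ContDiffAt 𝕜 m Γ z.1) :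
    ContDiffAt 𝕜 m (spray Γ) z :=
  contDiffAt_snd.prodMk
    (((hΓ.comp z contDiffAt_fst).clm_apply contDiffAt_snd).clm_apply contDiffAt_snd).neg

theorem trace_fderiv_spray [FiniteDimensional 𝕜 V] {Γ : V → V →L[𝕜] V →L[𝕜] V} {z : V × V}
    (hΓ : DifferentiableAt 𝕜 Γ z.1) (hsymm : ∀ u w, Γ z.1 u w = Γ z.1 w u) :
    LinearMap.trace 𝕜 _ (fderiv 𝕜 (spray Γ) z : V × V →ₗ[𝕜] V × V) =
      -2 * LinearMap.trace 𝕜 V (Γ z.1 z.2) := by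
  have hspray : HasFDerivAt (spray Γ) _ z := hasFDerivAt_snd.prodMk
    (((hΓ.hasFDerivAt.comp z hasFDerivAt_fst).clm_apply hasFDerivAt_snd).clm_apply
      hasFDerivAt_snd).neg
  have hfst : LinearMap.fst 𝕜 V V ∘ₗ (fderiv 𝕜 (spray Γ) z : V × V →ₗ[𝕜] V × V) ∘ₗ
      LinearMap.inl 𝕜 V V = 0 := by
    rw [hspray.fderiv]
    ext a
    simp
  have hsnd : LinearMap.snd 𝕜 V V ∘ₗ (fderiv 𝕜 (spray Γ) z : V × V →ₗ[𝕜] V × V) ∘ₗ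
      LinearMap.inr 𝕜 V V = (-2 : 𝕜) • (Γ z.1 z.2 : V →ₗ[𝕜] V) := by
    rw [hspray.fderiv]
    ext b
    simp [hsymm b]
    module
  rw [trace_prod_eq, hfst, hsnd, map_zero, map_smul, zero_add, smul_eq_mul]

theorem hasFDerivAt_prodMk_fderiv {ψ : V → W} {z : V × V} (hψ : ContDiffAt 𝕜 2 ψ z.1) :
    HasFDerivAt (fun z : V × V ↦ (ψ z.1, fderiv 𝕜 ψ z.1 z.2))
      ((fderiv 𝕜 ψ z.1 ∘L .fst 𝕜 V V).prod (fderiv 𝕜 ψ z.1 ∘L .snd 𝕜 V V +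
        (fderiv 𝕜 (fderiv 𝕜 ψ) z.1 ∘L .fst 𝕜 V V).flip z.2)) z := by
  have hψ1 : HasFDerivAt ψ (fderiv 𝕜 ψ z.1) z.1 :=
    (hψ.differentiableAt two_ne_zero).hasFDerivAt
  have hψ2 : HasFDerivAt (fderiv 𝕜 ψ) (fderiv 𝕜 (fderiv 𝕜 ψ) z.1) z.1 :=
    ((hψ.fderiv_right (m := 1) (by norm_num)).differentiableAt one_ne_zero).hasFDerivAt
  exact (hψ1.comp z hasFDerivAt_fst).prodMk
    ((hψ2.comp z hasFDerivAt_fst).clm_apply hasFDerivAt_snd)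

end Spray

namespace LocalMetric

variable {V : Type*} [NormedAddCommGroup V] [InnerProductSpace ℝ V] [FiniteDimensional ℝ V]

/-- The Christoffel symbols `Γ(u, w)` at `y` of the metric `⟪u, G y w⟫`, as a bilinear map: by the
Koszul formula, `G y (Γ(u, w))` is half of `∂_u G w + ∂_w G u - ⟪∂_· G u, w⟫`, the last term being
`L† w` for `L = ∂_· G u`. -/
def christoffelMap (G : V → V →L[ℝ] V) (y : V) : V →L[ℝ] V →L[ℝ] V :=
  ContinuousLinearMap.compL ℝ V V V (Ring.inverse (G y)) ∘L ((1 / 2 : ℝ) •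
    (fderiv ℝ G y + ((fderiv ℝ G y).flip - (starL' ℝ : (V →L[ℝ] V) ≃L[ℝ] (V →L[ℝ] V)) ∘L
      (fderiv ℝ G y).flip)))

/-- The density `c · det G · exp (-|v|² / 2)` on phase space. -/
def density (G : V → V →L[ℝ] V) (c : ℝ) (z : V × V) : ℝ :=
  c * ((G z.1).det * Real.exp (-inner ℝ z.2 (G z.1 z.2) / 2))

variable {G : V → V →L[ℝ] V} {y : V}

theorem isSelfAdjoint_fderiv (hs : ∀ y, IsSelfAdjoint (G y)) (y u : V) :
    IsSelfAdjoint (fderiv ℝ G y u) := by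
  have hstar : (fun z ↦ star (G z)) = G := funext hs
  have := DFunLike.congr_fun (fderiv_star (𝕜 := ℝ) (f := G) (x := y)) u
  rw [hstar] at this
  exact this.symm

theorem inner_christoffelMap (hG : IsUnit (G y)) (u w x : V) :
    inner ℝ x (G y (christoffelMap G y u w)) = (1 / 2 : ℝ) *
      (inner ℝ x (fderiv ℝ G y u w) + inner ℝ x (fderiv ℝ G y w u) -
        inner ℝ w (fderiv ℝ G y x u)) := by
  have hinv : G y (christoffelMap G y u w) = ((1 / 2 : ℝ) • (fderiv ℝ G y u +
      ((fderiv ℝ G y).flip u - ContinuousLinearMap.adjoint ((fderiv ℝ G y).flip u)))) w :=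
    DFunLike.congr_fun (Ring.mul_inverse_cancel_left (G y) _ hG) w
  rw [hinv]
  simp [ContinuousLinearMap.adjoint_inner_right, inner_add_right, inner_sub_right,
    inner_smul_right, real_inner_comm w]
  ring

theorem christoffelMap_comm (hG : IsUnit (G y)) (hs : ∀ y, IsSelfAdjoint (G y)) (u w : V) :
    christoffelMap G y u w = christoffelMap G y w u := by
  refine (ContinuousLinearMap.isUnit_iff_bijective.1 hG).1 (ext_inner_left ℝ fun x ↦ ?_)
  have hsymm : inner ℝ w (fderiv ℝ G y x u) = inner ℝ u (fderiv ℝ G y x w) := by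
    rw [real_inner_comm]
    exact (isSelfAdjoint_fderiv hs y x).isSymmetric u w
  rw [inner_christoffelMap hG, inner_christoffelMap hG, hsymm]
  ring

theorem trace_christoffelMap (hs : ∀ y, IsSelfAdjoint (G y)) (u : V) :
    LinearMap.trace ℝ V (christoffelMap G y u) =
      (1 / 2 : ℝ) * LinearMap.trace ℝ V (Ring.inverse (G y) * fderiv ℝ G y u : V →L[ℝ] V) := by
  set D := fderiv ℝ G y
  have hsplit : christoffelMap G y u = (1 / 2 : ℝ) • (Ring.inverse (G y) * D u +
      (Ring.inverse (G y) * D.flip u - Ring.inverse (G y) * star (D.flip u))) := by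
    rw [← mul_sub, ← mul_add, ← mul_smul_comm]
    rfl
  have hadj : Ring.inverse (G y) * star (D.flip u) = star (D.flip u * Ring.inverse (G y)) := by
    rw [star_mul, ← Ring.inverse_star, (hs y).star_eq]
  have htrace : LinearMap.trace ℝ V (Ring.inverse (G y) * D.flip u : V →L[ℝ] V) =
      LinearMap.trace ℝ V (Ring.inverse (G y) * star (D.flip u) : V →L[ℝ] V) := by
    rw [hadj]
    exact (LinearMap.trace_mul_comm ℝ _ _).trans
      (trace_adjoint (D.flip u * Ring.inverse (G y))).symm
  rw [hsplit]
  simp only [ContinuousLinearMap.toLinearMap_smul, ContinuousLinearMap.toLinearMap_add,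
    ContinuousLinearMap.toLinearMap_sub, map_smul, map_add, map_sub, htrace, sub_self, add_zero,
    smul_eq_mul]

theorem contDiffAt_christoffelMap {m : ℕ∞ω} (hG : ContDiffAt ℝ (m + 1) G y)
    (hu : IsUnit (G y)) : ContDiffAt ℝ m (christoffelMap G) y := by
  have hD : ContDiffAt ℝ m (fderiv ℝ G) y := hG.fderiv_right le_rfl
  have hinv : ContDiffAt ℝ m (fun z ↦ Ring.inverse (G z)) y := by
    obtain ⟨A, hA⟩ := hu
    exact ContDiffAt.comp y (hA ▸ contDiffAt_ringInverse ℝ A) (hG.of_le le_self_add)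
  exact contDiffAt_compL_comp hinv ((hD.add ((contDiffAt_clm_flip hD).sub
    (contDiffAt_const.clm_comp (contDiffAt_clm_flip hD)))).const_smul (1 / 2 : ℝ))

theorem differentiableAt_density {z : V × V} (hG : DifferentiableAt ℝ G z.1) (c : ℝ) :
    DifferentiableAt ℝ (density G c) z := by
  have hG' : DifferentiableAt ℝ (fun z : V × V ↦ G z.1) z := hG.comp z differentiableAt_fst
  have hdet : DifferentiableAt ℝ (fun z : V × V ↦ (G z.1).det) z :=
    (contDiff_clm_det.differentiable one_ne_zero).differentiableAt.comp z hG'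
  have henergy : DifferentiableAt ℝ (fun z : V × V ↦ -inner ℝ z.2 (G z.1 z.2)) z :=
    (differentiableAt_snd.inner ℝ (hG'.clm_apply differentiableAt_snd)).neg
  exact (hdet.mul ((henergy.mul_const (2⁻¹ : ℝ)).exp)).const_mul c

theorem hasDerivAt_energy (hs : ∀ y, IsSelfAdjoint (G y)) {c w : ℝ → V} {t : ℝ}
    (hu : IsUnit (G (c t))) (hG : DifferentiableAt ℝ G (c t)) (hc : HasDerivAt c (w t) t)
    (hw : HasDerivAt w (-christoffelMap G (c t) (w t) (w t)) t) :
    HasDerivAt (fun s ↦ inner ℝ (w s) (G (c s) (w s))) 0 t := by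
  have hGc : HasDerivAt (fun s ↦ G (c s)) (fderiv ℝ G (c t) (w t)) t :=
    hG.hasFDerivAt.comp_hasDerivAt t hc
  refine (hw.inner ℝ (hGc.clm_apply hw)).congr_deriv ?_
  have hsymm : inner ℝ (christoffelMap G (c t) (w t) (w t)) (G (c t) (w t)) =
      inner ℝ (w t) (G (c t) (christoffelMap G (c t) (w t) (w t))) := by
    rw [real_inner_comm]
    exact (hs (c t)).isSymmetric (w t) (christoffelMap G (c t) (w t) (w t))
  simp only [map_neg, inner_add_right, inner_neg_left, inner_neg_right, hsymm,
    inner_christoffelMap hu]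
  ring

theorem density_continuity_equation (hs : ∀ y, IsSelfAdjoint (G y)) {z : V × V}
    (hu : IsUnit (G z.1)) (hG : ContDiffAt ℝ 2 G z.1) (c : ℝ) :
    fderiv ℝ (density G c) z (spray (christoffelMap G) z) + LinearMap.trace ℝ _
      (fderiv ℝ (spray (christoffelMap G)) z : V × V →ₗ[ℝ] V × V) * density G c z = 0 := by
  have hG1 : DifferentiableAt ℝ G z.1 := hG.differentiableAt two_ne_zero
  let ζ : ℝ → V × V := fun r ↦ z + r • spray (christoffelMap G) z
  have hζ0 : ζ 0 = z := by simp [ζ]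
  have hζ' : HasDerivAt ζ (spray (christoffelMap G) z) 0 := by
    simpa [ζ] using! ((hasDerivAt_id' (0 : ℝ)).smul_const (spray (christoffelMap G) z)).const_add z
  have hρ : HasDerivAt (density G c ∘ ζ)
      (fderiv ℝ (density G c) z (spray (christoffelMap G) z)) 0 :=
    HasFDerivAt.comp_hasDerivAt (0 : ℝ)
      (hζ0.symm ▸ (differentiableAt_density hG1 c).hasFDerivAt) hζ'
  have hζ1 : HasDerivAt (fun r ↦ (ζ r).1) z.2 0 := hζ'.fst
  have hζ2 : HasDerivAt (fun r ↦ (ζ r).2) (-christoffelMap G z.1 z.2 z.2) 0 := hζ'.snd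
  have henergy : HasDerivAt (fun r ↦ inner ℝ (ζ r).2 (G (ζ r).1 (ζ r).2)) 0 0 :=
    hasDerivAt_energy (c := fun r ↦ (ζ r).1) (w := fun r ↦ (ζ r).2) hs
      (by simpa [hζ0] using hu) (by simpa [hζ0] using hG1)
      (by rw [hζ0]; exact hζ1) (by rw [hζ0]; exact hζ2)
  have hGζ : HasDerivAt (fun r ↦ G (ζ r).1) (fderiv ℝ G z.1 z.2) 0 :=
    HasFDerivAt.comp_hasDerivAt (l := G) (0 : ℝ) (by simpa [hζ0] using hG1.hasFDerivAt) hζ1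
  have hdet : HasDerivAt (fun r ↦ (G (ζ r).1).det)
      (LinearMap.trace ℝ V (fderiv ℝ G z.1 z.2 * Ring.inverse (G z.1) : V →L[ℝ] V) *
        (G z.1).det) 0 := by
    have hcancel : (fderiv ℝ G z.1 z.2 * Ring.inverse (G z.1)) ∘L G (ζ 0).1 =
        fderiv ℝ G z.1 z.2 := by
      rw [hζ0]
      exact Ring.inverse_mul_cancel_right _ _ hu
    simpa [hζ0] using hasDerivAt_clm_det (hGζ.congr_deriv hcancel.symm)
  have htrace : LinearMap.trace ℝ V (fderiv ℝ G z.1 z.2 * Ring.inverse (G z.1) : V →L[ℝ] V) =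
      LinearMap.trace ℝ V (Ring.inverse (G z.1) * fderiv ℝ G z.1 z.2 : V →L[ℝ] V) :=
    LinearMap.trace_mul_comm ℝ _ _
  rw [hρ.unique ((hdet.mul ((henergy.neg.div_const 2).exp)).const_mul c),
    trace_fderiv_spray ((contDiffAt_christoffelMap (m := 1) hG hu).differentiableAt one_ne_zero)
      (christoffelMap_comm hu hs), trace_christoffelMap hs, htrace]
  simp [density, hζ0]
  ring

theorem christoffelMap_transform {g : V → V →L[ℝ] V} {ψ : V → V}
    (hs : IsSelfAdjoint (G (ψ y))) (hu : IsUnit (g y)) (hU : IsUnit (G (ψ y)))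
    (hg : DifferentiableAt ℝ g y) (hG : DifferentiableAt ℝ G (ψ y)) (hψ : ContDiffAt ℝ 2 ψ y)
    (hsurj : Function.Surjective (fderiv ℝ ψ y))
    (hpull : ∀ᶠ z in 𝓝 y, ∀ u w,
      inner ℝ u (g z w) = inner ℝ (fderiv ℝ ψ z u) (G (ψ z) (fderiv ℝ ψ z w))) (v : V) :
    fderiv ℝ ψ y (christoffelMap g y v v) = fderiv ℝ (fderiv ℝ ψ) y v v +
      christoffelMap G (ψ y) (fderiv ℝ ψ y v) (fderiv ℝ ψ y v) := by
  have hψ1 : HasFDerivAt ψ (fderiv ℝ ψ y) y :=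
    (hψ.differentiableAt two_ne_zero).hasFDerivAt
  have hψ2 : HasFDerivAt (fderiv ℝ ψ) (fderiv ℝ (fderiv ℝ ψ) y) y :=
    ((hψ.fderiv_right (m := 1) (by norm_num)).differentiableAt one_ne_zero).hasFDerivAt
  have hsymm : ∀ a b, fderiv ℝ (fderiv ℝ ψ) y a b = fderiv ℝ (fderiv ℝ ψ) y b a :=
    hψ.isSymmSndFDerivAt (by simp)
  have hD : ∀ a b c, inner ℝ b (fderiv ℝ g y a c) =
      inner ℝ (fderiv ℝ ψ y b) (fderiv ℝ G (ψ y) (fderiv ℝ ψ y a) (fderiv ℝ ψ y c)) +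
      inner ℝ (fderiv ℝ (fderiv ℝ ψ) y a b) (G (ψ y) (fderiv ℝ ψ y c)) +
      inner ℝ (fderiv ℝ ψ y b) (G (ψ y) (fderiv ℝ (fderiv ℝ ψ) y a c)) := by
    intro a b c
    have hl := (hasFDerivAt_const b y).inner ℝ (hg.hasFDerivAt.clm_apply (hasFDerivAt_const c y))
    have hr := (hψ2.clm_apply (hasFDerivAt_const b y)).inner ℝ
      ((hG.hasFDerivAt.comp y hψ1).clm_apply (hψ2.clm_apply (hasFDerivAt_const c y)))
    have hderiv := DFunLike.congr_fun
      (hl.unique (hr.congr_of_eventuallyEq (hpull.mono fun z hz ↦ hz b c))) a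
    simp only [ContinuousLinearMap.comp_zero, zero_add, ContinuousLinearMap.comp_apply,
      ContinuousLinearMap.prod_apply, zero_apply, ContinuousLinearMap.flip_apply,
      fderivInnerCLM_apply, inner_zero_left, add_zero, Function.comp_apply, add_apply,
      inner_add_right] at hderiv
    linear_combination hderiv
  set X := fderiv ℝ ψ y (christoffelMap g y v v) - (fderiv ℝ (fderiv ℝ ψ) y v v +
    christoffelMap G (ψ y) (fderiv ℝ ψ y v) (fderiv ℝ ψ y v)) with hX
  suffices hX0 : G (ψ y) X = 0 by
    have hX0 := (ContinuousLinearMap.isUnit_iff_bijective.1 hU).1 (hX0.trans (map_zero _).symm)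
    exact sub_eq_zero.1 hX0
  refine ext_inner_left ℝ fun x ↦ ?_
  obtain ⟨u, rfl⟩ := hsurj x
  have hswap : inner ℝ (fderiv ℝ ψ y v) (G (ψ y) (fderiv ℝ (fderiv ℝ ψ) y v u)) =
      inner ℝ (fderiv ℝ (fderiv ℝ ψ) y v u) (G (ψ y) (fderiv ℝ ψ y v)) := by
    rw [real_inner_comm]
    exact hs.isSymmetric _ _
  simp only [hX, map_sub, map_add, inner_sub_right, inner_add_right, ← hpull.self_of_nhds,
    inner_christoffelMap hu, inner_christoffelMap hU, hD, inner_zero_right,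
    hsymm u v, hswap]
  ring

theorem spray_transform {g : V → V →L[ℝ] V} {ψ : V → V} {z : V × V}
    (hs : IsSelfAdjoint (G (ψ z.1))) (hu : IsUnit (g z.1)) (hU : IsUnit (G (ψ z.1)))
    (hg : DifferentiableAt ℝ g z.1) (hG : DifferentiableAt ℝ G (ψ z.1))
    (hψ : ContDiffAt ℝ 2 ψ z.1) (hsurj : Function.Surjective (fderiv ℝ ψ z.1))
    (hpull : ∀ᶠ y in 𝓝 z.1, ∀ u w,
      inner ℝ u (g y w) = inner ℝ (fderiv ℝ ψ y u) (G (ψ y) (fderiv ℝ ψ y w))) :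
    fderiv ℝ (fun z ↦ (ψ z.1, fderiv ℝ ψ z.1 z.2)) z (spray (christoffelMap g) z) =
      spray (christoffelMap G) (ψ z.1, fderiv ℝ ψ z.1 z.2) := by
  rw [(hasFDerivAt_prodMk_fderiv hψ).fderiv]
  simp [spray, christoffelMap_transform hs hu hU hg hG hψ hsurj hpull z.2]

end LocalMetric

section TangentCoordinates

/-- The space in which the charts of an `n`-dimensional manifold take their values. -/
abbrev Coord (n : ℕ) := EuclideanSpace ℝ (Fin n)

variable {n : ℕ} {M : Type*} [TopologicalSpace M] [ChartedSpace (EuclideanSpace ℝ (Fin n)) M]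

/-- The change of coordinates from the chart at `x₀` to the chart at `x₁`. -/
abbrev transition (x₀ x₁ : M) : Coord n → Coord n :=
  extChartAt (𝓡 n) x₁ ∘ (extChartAt (𝓡 n) x₀).symm

theorem eventually_mem_source {x₀ x₁ x : M} (h₀ : x ∈ (extChartAt (𝓡 n) x₀).source)
    (h₁ : x ∈ (extChartAt (𝓡 n) x₁).source) :
    ∀ᶠ y in 𝓝 (extChartAt (𝓡 n) x₀ x), y ∈ (extChartAt (𝓡 n) x₀).target ∧
      (extChartAt (𝓡 n) x₀).symm y ∈ (extChartAt (𝓡 n) x₁).source := by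
  have hc : ContinuousAt (extChartAt (𝓡 n) x₀).symm (extChartAt (𝓡 n) x₀ x) :=
    continuousAt_extChartAt_symm' h₀
  rw [ContinuousAt, (extChartAt (𝓡 n) x₀).left_inv h₀] at hc
  exact ((isOpen_extChartAt_target x₀).eventually_mem ((extChartAt (𝓡 n) x₀).map_source h₀)).and
    (hc (extChartAt_source_mem_nhds' h₁))

variable [IsManifold (𝓡 n) ∞ M]

theorem contDiffAt_transition {x₀ x₁ x : M} (h₀ : x ∈ (extChartAt (𝓡 n) x₀).source)
    (h₁ : x ∈ (extChartAt (𝓡 n) x₁).source) :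
    ContDiffAt ℝ ∞ (transition (n := n) x₀ x₁) (extChartAt (𝓡 n) x₀ x) := by
  have h := contDiffWithinAt_ext_coord_change (I := 𝓡 n) (n := ∞) x₁ x₀
    (y := extChartAt (𝓡 n) x₀ x) (by
      rw [PartialEquiv.trans_source'', PartialEquiv.symm_symm, PartialEquiv.symm_target]
      exact mem_image_of_mem _ ⟨h₀, h₁⟩)
  rwa [ModelWithCorners.range_eq_univ, contDiffWithinAt_univ] at h

/-- The tangent vector at `x` with the given coordinates in the chart at `x₀`. -/
def toTangent (x₀ x : M) : Coord n →L[ℝ] TangentSpace (𝓡 n) x :=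
  (trivializationAt (Coord n) (TangentSpace (𝓡 n)) x₀).symmL ℝ x

/-- The coordinates of a tangent vector at `x` in the chart at `x₀`. -/
def ofTangent (x₀ x : M) : TangentSpace (𝓡 n) x →L[ℝ] Coord n :=
  (trivializationAt (Coord n) (TangentSpace (𝓡 n)) x₀).continuousLinearMapAt ℝ x

variable {x₀ x₁ x : M}

theorem ofTangent_toTangent_self (hx : x ∈ (extChartAt (𝓡 n) x₀).source) (u : Coord n) :
    ofTangent x₀ x (toTangent x₀ x u) = u :=
  Trivialization.continuousLinearMapAt_symmL _ (by simpa using hx) u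

theorem toTangent_ofTangent (hx : x ∈ (extChartAt (𝓡 n) x₀).source)
    (v : TangentSpace (𝓡 n) x) : toTangent x₀ x (ofTangent x₀ x v) = v :=
  Trivialization.symmL_continuousLinearMapAt _ (by simpa using hx) v

theorem ofTangent_apply (hx : x ∈ (extChartAt (𝓡 n) x₀).source) (v : TangentSpace (𝓡 n) x) :
    ofTangent x₀ x v = tangentCoordChange (𝓡 n) x x₀ x v := by
  rw [ofTangent, TangentBundle.continuousLinearMapAt_trivializationAt_eq_core (by simpa using hx)]
  rfl

theorem toTangent_apply (hx : x ∈ (extChartAt (𝓡 n) x₀).source) (u : Coord n) :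
    toTangent x₀ x u = tangentCoordChange (𝓡 n) x₀ x x u := by
  rw [toTangent, TangentBundle.symmL_trivializationAt_eq_core (by simpa using hx)]
  rfl

theorem ofTangent_toTangent (h₀ : x ∈ (extChartAt (𝓡 n) x₀).source)
    (h₁ : x ∈ (extChartAt (𝓡 n) x₁).source) (u : Coord n) :
    ofTangent x₁ x (toTangent x₀ x u) =
      fderiv ℝ (transition (n := n) x₀ x₁) (extChartAt (𝓡 n) x₀ x) u := by
  rw [ofTangent_apply h₁, toTangent_apply h₀,
    tangentCoordChange_comp ⟨⟨h₀, mem_extChartAt_source x⟩, h₁⟩, tangentCoordChange_def,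
    ModelWithCorners.range_eq_univ, fderivWithin_univ]

theorem toTangent_fderiv_transition (h₀ : x ∈ (extChartAt (𝓡 n) x₀).source)
    (h₁ : x ∈ (extChartAt (𝓡 n) x₁).source) (u : Coord n) :
    toTangent x₁ x (fderiv ℝ (transition (n := n) x₀ x₁) (extChartAt (𝓡 n) x₀ x) u) =
      toTangent x₀ x u := by
  rw [← ofTangent_toTangent h₀ h₁, toTangent_ofTangent h₁]

theorem surjective_fderiv_transition (h₀ : x ∈ (extChartAt (𝓡 n) x₀).source)
    (h₁ : x ∈ (extChartAt (𝓡 n) x₁).source) :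
    Function.Surjective (fderiv ℝ (transition (n := n) x₀ x₁) (extChartAt (𝓡 n) x₀ x)) := fun v ↦
  ⟨ofTangent x₀ x (toTangent x₁ x v), by
    rw [← ofTangent_toTangent h₀ h₁, toTangent_ofTangent h₀, ofTangent_toTangent_self h₁]⟩

theorem mfderiv_extChartAt_symm {y : Coord n} (hy : y ∈ (extChartAt (𝓡 n) x₀).target)
    (u : Coord n) :
    mfderiv 𝓘(ℝ, Coord n) (𝓡 n) (extChartAt (𝓡 n) x₀).symm y u =
      toTangent x₀ ((extChartAt (𝓡 n) x₀).symm y) u := by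
  have hx := (extChartAt (𝓡 n) x₀).map_target hy
  have h := TangentBundle.symmL_trivializationAt (𝕜 := ℝ) (I := 𝓡 n) (x₀ := x₀)
    (x := (extChartAt (𝓡 n) x₀).symm y) (by simpa using hx)
  rw [ModelWithCorners.range_eq_univ, mfderivWithin_univ, PartialEquiv.right_inv _ hy] at h
  exact (DFunLike.congr_fun h u).symm

variable {p₀ p : TangentBundle (𝓡 n) M}

theorem mem_extChartAt_tangent_source :
    p ∈ (extChartAt (𝓡 n).tangent p₀).source ↔ p.1 ∈ (extChartAt (𝓡 n) p₀.1).source := by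
  simp

theorem extChartAt_tangent_target :
    (extChartAt (𝓡 n).tangent p₀).target = (extChartAt (𝓡 n) p₀.1).target ×ˢ univ := by
  ext z
  rw [extChartAt_target, ModelWithCorners.range_eq_univ, inter_univ, mem_preimage,
    TangentBundle.mem_chart_target_iff]
  simp

theorem extChartAt_tangent_apply (hp : p.1 ∈ (extChartAt (𝓡 n) p₀.1).source) :
    extChartAt (𝓡 n).tangent p₀ p = (extChartAt (𝓡 n) p₀.1 p.1, ofTangent p₀.1 p.1 p.2) := by
  rw [ofTangent_apply hp]
  rfl

theorem extChartAt_tangent_symm_apply {z : Coord n × Coord n}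
    (hz : z.1 ∈ (extChartAt (𝓡 n) p₀.1).target) :
    (extChartAt (𝓡 n).tangent p₀).symm z = ⟨(extChartAt (𝓡 n) p₀.1).symm z.1,
      toTangent p₀.1 ((extChartAt (𝓡 n) p₀.1).symm z.1) z.2⟩ := by
  rw [toTangent_apply ((extChartAt (𝓡 n) p₀.1).map_target hz)]
  rfl

theorem extChartAt_tangent_comp_symm {z : Coord n × Coord n}
    (h₀ : z.1 ∈ (extChartAt (𝓡 n) p.1).target)
    (h₁ : (extChartAt (𝓡 n) p.1).symm z.1 ∈ (extChartAt (𝓡 n) p₀.1).source) :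
    (extChartAt (𝓡 n).tangent p₀ ∘ (extChartAt (𝓡 n).tangent p).symm) z =
      (transition p.1 p₀.1 z.1, fderiv ℝ (transition (n := n) p.1 p₀.1) z.1 z.2) := by
  rw [Function.comp_apply, extChartAt_tangent_symm_apply h₀, extChartAt_tangent_apply h₁,
    ofTangent_toTangent ((extChartAt (𝓡 n) p.1).map_target h₀) h₁,
    (extChartAt (𝓡 n) p.1).right_inv h₀]
  rfl

end TangentCoordinates

section Metric

variable {n : ℕ} {M : Type*} [TopologicalSpace M] [ChartedSpace (EuclideanSpace ℝ (Fin n)) M]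
  [RiemannianBundle (fun x : M ↦ TangentSpace (𝓡 n) x)]

/-- The metric tensor in the chart at `x₀`, as an operator: `⟪u, metricOperator x₀ y w⟫` is the
`g`-inner product of the tangent vectors with coordinates `u` and `w`. -/
def metricOperator (x₀ : M) (y : Coord n) : Coord n →L[ℝ] Coord n :=
  Matrix.toEuclideanCLM (𝕜 := ℝ) (metricMatrix x₀ y)

theorem metricMatrix_eq_gram (x₀ : M) (y : Coord n) :
    metricMatrix x₀ y = Matrix.gram ℝ fun i ↦ coordField x₀ i y :=
  rfl

theorem det_metricMatrix_nonneg (x₀ : M) (y : Coord n) : 0 ≤ (metricMatrix x₀ y).det := by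
  rw [metricMatrix_eq_gram]
  exact (Matrix.posSemidef_gram ℝ _).det_nonneg

theorem det_metricOperator (x₀ : M) (y : Coord n) :
    (metricOperator x₀ y).det = (metricMatrix x₀ y).det := by
  rw [metricOperator, ContinuousLinearMap.det, Matrix.coe_toEuclideanCLM_eq_toEuclideanLin,
    LinearMap.det_toLpLin]

theorem isSelfAdjoint_metricOperator (x₀ : M) (y : Coord n) :
    IsSelfAdjoint (metricOperator x₀ y) := by
  rw [metricOperator, metricMatrix_eq_gram]
  exact (Matrix.isHermitian_gram ℝ _).isSelfAdjoint.map _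

theorem metricDeriv_comm (x₀ : M) (l i j : Fin n) (y : Coord n) :
    metricDeriv x₀ l i j y = metricDeriv x₀ l j i y := by
  simp only [metricDeriv, metricMatrix, Matrix.of_apply, real_inner_comm]

theorem inner_metricOperator_mfderiv (x₀ : M) (y u w : Coord n) :
    inner ℝ u (metricOperator x₀ y w) =
      inner ℝ (mfderiv 𝓘(ℝ, Coord n) (𝓡 n) (extChartAt (𝓡 n) x₀).symm y u)
        (mfderiv 𝓘(ℝ, Coord n) (𝓡 n) (extChartAt (𝓡 n) x₀).symm y w) := by
  let D : Coord n →L[ℝ] TangentSpace (𝓡 n) ((extChartAt (𝓡 n) x₀).symm y) :=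
    mfderiv 𝓘(ℝ, Coord n) (𝓡 n) (extChartAt (𝓡 n) x₀).symm y
  have hsum (v : Coord n) : D v = ∑ i, v i • D (EuclideanSpace.single i 1) := by
    conv_lhs => rw [← (EuclideanSpace.basisFun (Fin n) ℝ).sum_repr v]
    simp only [EuclideanSpace.basisFun_repr, EuclideanSpace.basisFun_apply, map_sum, map_smul]
  change _ = inner ℝ (D u) (D w)
  rw [metricOperator, Matrix.inner_toEuclideanCLM, metricMatrix_eq_gram, hsum u, hsum w]
  exact Matrix.star_dotProduct_gram_mulVec (fun i ↦ coordField x₀ i y) u w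

variable [IsManifold (𝓡 n) ∞ M] {x₀ x₁ x : M}

theorem inner_metricOperator (hx : x ∈ (extChartAt (𝓡 n) x₀).source) (u w : Coord n) :
    inner ℝ u (metricOperator x₀ (extChartAt (𝓡 n) x₀ x) w) =
      inner ℝ (toTangent x₀ x u) (toTangent x₀ x w) := by
  have hy := (extChartAt (𝓡 n) x₀).map_source hx
  rw [inner_metricOperator_mfderiv, mfderiv_extChartAt_symm hy, mfderiv_extChartAt_symm hy,
    (extChartAt (𝓡 n) x₀).left_inv hx]

theorem inner_metricOperator_ofTangent (hx : x ∈ (extChartAt (𝓡 n) x₀).source)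
    (v w : TangentSpace (𝓡 n) x) :
    inner ℝ (ofTangent x₀ x v) (metricOperator x₀ (extChartAt (𝓡 n) x₀ x) (ofTangent x₀ x w)) =
      inner ℝ v w := by
  rw [inner_metricOperator hx, toTangent_ofTangent hx, toTangent_ofTangent hx]

theorem inner_metricOperator_transition (h₀ : x ∈ (extChartAt (𝓡 n) x₀).source)
    (h₁ : x ∈ (extChartAt (𝓡 n) x₁).source) (u w : Coord n) :
    inner ℝ u (metricOperator x₀ (extChartAt (𝓡 n) x₀ x) w) =
      inner ℝ (fderiv ℝ (transition (n := n) x₀ x₁) (extChartAt (𝓡 n) x₀ x) u)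
        (metricOperator x₁ (extChartAt (𝓡 n) x₁ x)
          (fderiv ℝ (transition (n := n) x₀ x₁) (extChartAt (𝓡 n) x₀ x) w)) := by
  rw [inner_metricOperator h₀, inner_metricOperator h₁, toTangent_fderiv_transition h₀ h₁,
    toTangent_fderiv_transition h₀ h₁]

theorem isUnit_metricOperator {y : Coord n} (hy : y ∈ (extChartAt (𝓡 n) x₀).target) :
    IsUnit (metricOperator x₀ y) := by
  have hx := (extChartAt (𝓡 n) x₀).map_target hy
  have hinj : Function.Injective (metricOperator x₀ y) :=
    (injective_iff_map_eq_zero _).2 fun w hw ↦ by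
      have h0 : inner ℝ w (metricOperator x₀ y w) = 0 := by rw [hw, inner_zero_right]
      rw [← (extChartAt (𝓡 n) x₀).right_inv hy, inner_metricOperator hx, inner_self_eq_zero] at h0
      rw [← ofTangent_toTangent_self hx w, h0, map_zero]
  exact ContinuousLinearMap.isUnit_iff_bijective.2
    ⟨hinj, (metricOperator x₀ y : Coord n →ₗ[ℝ] Coord n).injective_iff_surjective.1 hinj⟩

theorem isUnit_metricMatrix {y : Coord n} (hy : y ∈ (extChartAt (𝓡 n) x₀).target) :
    IsUnit (metricMatrix x₀ y) :=
  (MulEquiv.isUnit_map (Matrix.toEuclideanCLM (n := Fin n) (𝕜 := ℝ))).1 (isUnit_metricOperator hy)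

variable [IsContMDiffRiemannianBundle (𝓡 n) ∞ (EuclideanSpace ℝ (Fin n))
      (fun x : M ↦ TangentSpace (𝓡 n) x)]

theorem contDiffOn_metricMatrix (x₀ : M) (i j : Fin n) :
    ContDiffOn ℝ ∞ (fun y ↦ metricMatrix x₀ y i j) (extChartAt (𝓡 n) x₀).target := by
  have hmem : ∀ y ∈ (extChartAt (𝓡 n) x₀).target,
      (extChartAt (𝓡 n) x₀).symm y ∈ (extChartAt (𝓡 n) x₀).source := fun y hy ↦
    (extChartAt (𝓡 n) x₀).map_target hy
  have hcoord (i : Fin n) : ContMDiffOn 𝓘(ℝ, Coord n) (𝓡 n).tangent ∞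
      (fun y ↦ (⟨(extChartAt (𝓡 n) x₀).symm y, coordField x₀ i y⟩ : TangentBundle (𝓡 n) M))
      (extChartAt (𝓡 n) x₀).target := by
    rw [(trivializationAt (Coord n) (TangentSpace (𝓡 n)) x₀).contMDiffOn_iff
      fun y hy ↦ by simpa using hmem y hy]
    refine ⟨contMDiffOn_extChartAt_symm x₀,
      (contMDiffOn_const (c := (EuclideanSpace.single i 1 : Coord n))).congr fun y hy ↦ ?_⟩
    rw [← ofTangent_toTangent_self (hmem y hy) (EuclideanSpace.single i 1),
      ← mfderiv_extChartAt_symm hy, ofTangent, Trivialization.continuousLinearMapAt_apply,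
      Trivialization.coe_linearMapAt_of_mem _ (by simpa using hmem y hy)]
    rfl
  exact (ContMDiffOn.inner_bundle (hcoord i) (hcoord j)).contDiffOn

theorem contDiffOn_metricOperator (x₀ : M) :
    ContDiffOn ℝ ∞ (metricOperator (n := n) x₀) (extChartAt (𝓡 n) x₀).target := by
  have hsum : metricOperator (n := n) x₀ = fun y ↦ ∑ i, ∑ j,
      metricMatrix x₀ y i j • Matrix.toEuclideanCLM (𝕜 := ℝ) (Matrix.single i j (1 : ℝ)) := by
    ext1 y
    rw [metricOperator]
    conv_lhs => rw [Matrix.matrix_eq_sum_single (metricMatrix x₀ y)]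
    simp [← map_smul, Matrix.smul_single]
  rw [hsum]
  exact ContDiffOn.sum fun i _ ↦ ContDiffOn.sum fun j _ ↦
    (contDiffOn_metricMatrix x₀ i j).smul contDiffOn_const

end Metric

section TangentBundle

variable {n : ℕ} {M : Type*} [TopologicalSpace M] [ChartedSpace (EuclideanSpace ℝ (Fin n)) M]
  [IsManifold (𝓡 n) ∞ M]

instance instT2SpaceTangentBundle [T2Space M] : T2Space (TangentBundle (𝓡 n) M) := by
  have hproj : Continuous fun p : TangentBundle (𝓡 n) M ↦ p.1 :=
    FiberBundle.continuous_proj (Coord n) (TangentSpace (𝓡 n) : M → Type _)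
  rw [t2Space_iff_disjoint_nhds]
  intro p q hpq
  by_cases h : p.1 = q.1
  · have hp : p ∈ (extChartAt (𝓡 n).tangent p).source := mem_extChartAt_source p
    have hq : q ∈ (extChartAt (𝓡 n).tangent p).source := by
      rw [mem_extChartAt_tangent_source, h]
      exact mem_extChartAt_source q.1
    exact (continuousAt_extChartAt' hp).disjoint
      (disjoint_nhds_nhds.2 fun he ↦ hpq ((extChartAt (𝓡 n).tangent p).injOn hp hq he))
      (continuousAt_extChartAt' hq)
  · exact hproj.continuousAt.disjoint (disjoint_nhds_nhds.2 h) hproj.continuousAt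

instance instSecondCountableTangentBundle [SecondCountableTopology M] :
    SecondCountableTopology (TangentBundle (𝓡 n) M) := by
  obtain ⟨s, hs, hU⟩ := TopologicalSpace.countable_cover_nhds
    (fun x : M ↦ extChartAt_source_mem_nhds (I := 𝓡 n) x)
  let c (x : M) := chartAt (ModelProd (Coord n) (Coord n)) (⟨x, 0⟩ : TangentBundle (𝓡 n) M)
  have := hs.to_subtype
  have : SecondCountableTopology (ModelProd (Coord n) (Coord n)) :=
    inferInstanceAs (SecondCountableTopology (Coord n × Coord n))
  have (x : s) : SecondCountableTopology (c x).source := (c x).secondCountableTopology_source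
  refine TopologicalSpace.secondCountableTopology_of_countable_cover (U := fun x : s ↦ (c x).source)
    (fun x ↦ (c x).open_source) (eq_univ_of_forall fun p ↦ ?_)
  obtain ⟨x, hx, hp⟩ := mem_iUnion₂.1 (hU ▸ mem_univ p.1)
  exact mem_iUnion.2 ⟨⟨x, hx⟩, by simpa [c] using hp⟩

/-- The tangent bundle carries its Borel σ-algebra. -/
instance instMeasurableSpaceTangentBundle : MeasurableSpace (TangentBundle (𝓡 n) M) := borel _

instance instBorelSpaceTangentBundle : BorelSpace (TangentBundle (𝓡 n) M) := ⟨rfl⟩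

end TangentBundle

section GeodesicField

variable {n : ℕ} {M : Type*} [TopologicalSpace M] [ChartedSpace (EuclideanSpace ℝ (Fin n)) M]
  [IsManifold (𝓡 n) ∞ M] [RiemannianBundle (fun x : M ↦ TangentSpace (𝓡 n) x)]

open LocalMetric

/-- The geodesic spray in the chart of the tangent bundle induced by the chart of `M` at `x₀`. -/
def chartSpray (x₀ : M) : Coord n × Coord n → Coord n × Coord n :=
  spray (christoffelMap (metricOperator x₀))

variable (n M) in
/-- The vector field on the tangent bundle whose integral curves are the velocities of geodesics,
given at each point by the spray in the preferred chart at that point. -/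
def geodesicField (p : TangentBundle (𝓡 n) M) : TangentSpace (𝓡 n).tangent p :=
  (chartSpray p.1 (extChartAt (𝓡 n).tangent p p) : Coord n × Coord n)

variable [IsContMDiffRiemannianBundle (𝓡 n) ∞ (EuclideanSpace ℝ (Fin n))
      (fun x : M ↦ TangentSpace (𝓡 n) x)]

theorem contDiffAt_metricOperator {x₀ : M} {y : Coord n}
    (hy : y ∈ (extChartAt (𝓡 n) x₀).target) : ContDiffAt ℝ ∞ (metricOperator (n := n) x₀) y :=
  (contDiffOn_metricOperator x₀).contDiffAt ((isOpen_extChartAt_target x₀).mem_nhds hy)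

theorem differentiableAt_metricOperator {x₀ : M} {y : Coord n}
    (hy : y ∈ (extChartAt (𝓡 n) x₀).target) : DifferentiableAt ℝ (metricOperator (n := n) x₀) y :=
  (contDiffAt_metricOperator hy).differentiableAt (by simp)

theorem contDiffAt_chartSpray {x₀ : M} {z : Coord n × Coord n}
    (hz : z.1 ∈ (extChartAt (𝓡 n) x₀).target) : ContDiffAt ℝ ∞ (chartSpray (n := n) x₀) z :=
  contDiffAt_spray (contDiffAt_christoffelMap (contDiffAt_metricOperator hz)
    (isUnit_metricOperator hz))

theorem chartField_geodesicField {p₀ : TangentBundle (𝓡 n) M} {z : Coord n × Coord n}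
    (hz : z ∈ (extChartAt (𝓡 n).tangent p₀).target) :
    chartField (geodesicField n M) p₀ z = chartSpray p₀.1 z := by
  set p := (extChartAt (𝓡 n).tangent p₀).symm z with hp
  have h₀ : p.1 ∈ (extChartAt (𝓡 n) p.1).source := mem_extChartAt_source p.1
  have h₁ : p.1 ∈ (extChartAt (𝓡 n) p₀.1).source :=
    mem_extChartAt_tangent_source.1 ((extChartAt _ p₀).map_target hz)
  have hy := (extChartAt (𝓡 n) p.1).map_source h₀
  have hy₁ := (extChartAt (𝓡 n) p₀.1).map_source h₁
  set ψ := transition (n := n) p.1 p₀.1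
  set w := extChartAt (𝓡 n).tangent p p with hw
  have hψw : ψ w.1 = extChartAt (𝓡 n) p₀.1 p.1 :=
    congrArg (extChartAt (𝓡 n) p₀.1) ((extChartAt (𝓡 n) p.1).left_inv h₀)
  have hev := eventually_mem_source h₀ h₁
  have hchange : (extChartAt (𝓡 n).tangent p₀ ∘ (extChartAt (𝓡 n).tangent p).symm) =ᶠ[𝓝 w]
      fun z ↦ (ψ z.1, fderiv ℝ ψ z.1 z.2) :=
    (continuous_fst.tendsto w).eventually (hev.mono fun y hy ↦ hy) |>.mono fun z hz ↦
      extChartAt_tangent_comp_symm hz.1 hz.2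
  have hwz : (ψ w.1, fderiv ℝ ψ w.1 w.2) = z := by
    refine hchange.eq_of_nhds.symm.trans ?_
    rw [hw, Function.comp_apply, extChartAt_to_inv, hp, (extChartAt _ p₀).right_inv hz]
  have htransform := spray_transform (g := metricOperator p.1) (G := metricOperator p₀.1) (ψ := ψ)
    (z := w) (isSelfAdjoint_metricOperator _ _) (isUnit_metricOperator hy)
    (isUnit_metricOperator (hψw ▸ hy₁)) (differentiableAt_metricOperator hy)
    (differentiableAt_metricOperator (hψw ▸ hy₁))
    ((contDiffAt_transition h₀ h₁).of_le ENat.LEInfty.out)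
    (surjective_fderiv_transition h₀ h₁) (hev.mono fun y hy u v ↦ by
      have h := inner_metricOperator_transition ((extChartAt (𝓡 n) p.1).map_target hy.1) hy.2 u v
      rwa [(extChartAt (𝓡 n) p.1).right_inv hy.1] at h)
  rw [hwz, ← hchange.fderiv_eq] at htransform
  rw [chartField, tangentCoordChange_def, ModelWithCorners.range_eq_univ, fderivWithin_univ]
  exact htransform

theorem contMDiff_geodesicField :
    CMDiff ∞ (fun p ↦ (⟨p, geodesicField n M p⟩ :
      TangentBundle (𝓡 n).tangent (TangentBundle (𝓡 n) M))) :=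
  contMDiff_iff_contDiffOn_chartField.2 fun p₀ ↦ by
    refine ContDiffOn.congr (fun z hz ↦ ?_) fun z hz ↦ chartField_geodesicField hz
    exact (contDiffAt_chartSpray (extChartAt_tangent_target (p₀ := p₀) ▸ hz).1).contDiffWithinAt

end GeodesicField

section Christoffel

variable {n : ℕ} {M : Type*} [TopologicalSpace M] [ChartedSpace (EuclideanSpace ℝ (Fin n)) M]
  [IsManifold (𝓡 n) ∞ M] [RiemannianBundle (fun x : M ↦ TangentSpace (𝓡 n) x)]
  [IsContMDiffRiemannianBundle (𝓡 n) ∞ (EuclideanSpace ℝ (Fin n))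
      (fun x : M ↦ TangentSpace (𝓡 n) x)]

open LocalMetric

theorem fderiv_metricOperator_apply {x₀ : M} {y : Coord n}
    (hy : y ∈ (extChartAt (𝓡 n) x₀).target) (u w : Coord n) (l : Fin n) :
    fderiv ℝ (metricOperator x₀) y u w l = ∑ i, ∑ j, u i * w j * metricDeriv x₀ i l j y := by
  have hentry (j : Fin n) : HasFDerivAt (fun z ↦ metricMatrix x₀ z l j)
      (fderiv ℝ (fun z ↦ metricMatrix x₀ z l j) y) y :=
    (((contDiffOn_metricMatrix x₀ l j).contDiffAt
      ((isOpen_extChartAt_target x₀).mem_nhds hy)).differentiableAt (by simp)).hasFDerivAt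
  have hop : HasFDerivAt (fun z ↦ metricOperator x₀ z w l)
      (EuclideanSpace.proj l ∘L (fderiv ℝ (metricOperator x₀) y).flip w) y := by
    simpa using! (EuclideanSpace.proj (𝕜 := ℝ) l).hasFDerivAt.comp y
      ((differentiableAt_metricOperator hy).hasFDerivAt.clm_apply (hasFDerivAt_const w y))
  have hsum : (fun z ↦ metricOperator x₀ z w l) = fun z ↦ ∑ j, metricMatrix x₀ z l j * w j := by
    ext z
    simp only [metricOperator, Matrix.ofLp_toEuclideanCLM, Matrix.mulVec, dotProduct]
  have heq := DFunLike.congr_fun (hop.unique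
    (hsum ▸ HasFDerivAt.fun_sum fun j _ ↦ (hentry j).mul_const (w j))) u
  have hbasis (j : Fin n) : fderiv ℝ (fun z ↦ metricMatrix x₀ z l j) y u =
      ∑ i, u i * metricDeriv x₀ i l j y := by
    conv_lhs => rw [← (EuclideanSpace.basisFun (Fin n) ℝ).sum_repr u]
    simp [metricDeriv]
  refine heq.trans ?_
  simp only [FunLike.coe_sum, Finset.sum_apply, smul_apply, smul_eq_mul, hbasis,
    Finset.mul_sum]
  rw [Finset.sum_comm]
  exact Finset.sum_congr rfl fun i _ ↦ Finset.sum_congr rfl fun j _ ↦ by ring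

theorem christoffelMap_metricOperator_apply {x₀ : M} {y : Coord n}
    (hy : y ∈ (extChartAt (𝓡 n) x₀).target) (u w : Coord n) (k : Fin n) :
    christoffelMap (metricOperator x₀) y u w k =
      ∑ i, ∑ j, christoffel x₀ k i j y * u i * w j := by
  set Γ := christoffelMap (metricOperator x₀) y u w
  have hlower (l : Fin n) : metricOperator x₀ y Γ l = 1 / 2 * ∑ i, ∑ j, u i * w j *
      (metricDeriv x₀ i j l y + metricDeriv x₀ j i l y - metricDeriv x₀ l i j y) := by
    have h := inner_christoffelMap (isUnit_metricOperator hy) u w (EuclideanSpace.single l (1 : ℝ))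
    have hlast : inner ℝ w (fderiv ℝ (metricOperator x₀) y (EuclideanSpace.single l 1) u) =
        ∑ i, ∑ j, u i * w j * metricDeriv x₀ l i j y := by
      simp only [PiLp.inner_apply, fderiv_metricOperator_apply hy]
      rw [Finset.sum_comm]
      simp only [PiLp.single_apply, ite_mul, one_mul, zero_mul, Finset.sum_ite_irrel,
        Finset.sum_const_zero, Finset.sum_ite_eq', Finset.mem_univ, ↓reduceIte,
        RCLike.inner_apply, Real.ringHom_apply, Finset.sum_mul]
      exact Finset.sum_congr rfl fun i _ ↦ Finset.sum_congr rfl fun j _ ↦ by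
        rw [metricDeriv_comm]
        ring
    rw [hlast] at h
    simp only [EuclideanSpace.inner_single_left, map_one, one_mul,
      fderiv_metricOperator_apply hy] at h
    rw [h, Finset.sum_comm (f := fun i j ↦ w i * u j * _), ← Finset.sum_add_distrib,
      ← Finset.sum_sub_distrib]
    congr 1
    refine Finset.sum_congr rfl fun i _ ↦ ?_
    rw [← Finset.sum_add_distrib, ← Finset.sum_sub_distrib]
    refine Finset.sum_congr rfl fun j _ ↦ ?_
    rw [metricDeriv_comm x₀ i l j, metricDeriv_comm x₀ j l i]
    ring
  have hraise : Γ k = ∑ l, (metricMatrix x₀ y)⁻¹ k l * metricOperator x₀ y Γ l := by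
    have h : (metricMatrix x₀ y)⁻¹.mulVec ((metricMatrix x₀ y).mulVec Γ.ofLp) = Γ.ofLp := by
      rw [Matrix.mulVec_mulVec, Matrix.nonsing_inv_mul _
        ((Matrix.isUnit_iff_isUnit_det _).1 (isUnit_metricMatrix hy)), Matrix.one_mulVec]
    exact (congrFun h k).symm
  rw [hraise]
  simp only [hlower, christoffel, Finset.mul_sum, Finset.sum_mul]
  rw [Finset.sum_comm]
  refine Finset.sum_congr rfl fun i _ ↦ ?_
  rw [Finset.sum_comm]
  exact Finset.sum_congr rfl fun j _ ↦ Finset.sum_congr rfl fun l _ ↦ by ring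

end Christoffel

section Geodesic

variable {n : ℕ} {M : Type*} [TopologicalSpace M] [ChartedSpace (EuclideanSpace ℝ (Fin n)) M]
  [IsManifold (𝓡 n) ∞ M] {p₀ : TangentBundle (𝓡 n) M}

theorem hasDerivAt_extChartAt_comp {γ : ℝ → M} {t : ℝ} {x₀ : M}
    (h : MDifferentiableAt 𝓘(ℝ, ℝ) (𝓡 n) γ t)
    (hx : γ t ∈ (extChartAt (𝓡 n) x₀).source) :
    HasDerivAt (extChartAt (𝓡 n) x₀ ∘ γ)
      (ofTangent x₀ (γ t) (mfderiv 𝓘(ℝ, ℝ) (𝓡 n) γ t (1 : ℝ))) t := by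
  let D : ℝ →L[ℝ] Coord n := mfderiv 𝓘(ℝ, ℝ) (𝓡 n) γ t
  have hD : (1 : ℝ →L[ℝ] ℝ).smulRight (D 1) = D := by ext; simp
  rw [ofTangent_apply hx]
  refine (hasMFDerivAt_iff_hasDerivAt_extChartAt hx (w := D 1)).1 ?_ |>.2
  exact hD.symm ▸ h.hasMFDerivAt

theorem extChartAt_tangent_velocity {γ : ℝ → M} {t : ℝ}
    (h : MDifferentiableAt 𝓘(ℝ, ℝ) (𝓡 n) γ t)
    (hx : γ t ∈ (extChartAt (𝓡 n) p₀.1).source) :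
    extChartAt (𝓡 n).tangent p₀ (velocity γ t) =
      (extChartAt (𝓡 n) p₀.1 (γ t), deriv (extChartAt (𝓡 n) p₀.1 ∘ γ) t) :=
  (extChartAt_tangent_apply hx).trans
    (congrArg _ (hasDerivAt_extChartAt_comp h hx).deriv.symm)

theorem continuous_velocity {γ : ℝ → M} (h : ContMDiff 𝓘(ℝ, ℝ) (𝓡 n) ∞ γ) :
    Continuous (velocity (n := n) γ) :=
  (h.continuous_tangentMap (by simp)).comp (f := fun t ↦ (⟨t, 1⟩ : TangentBundle 𝓘(ℝ, ℝ) ℝ))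
    ((tangentBundleModelSpaceHomeomorph 𝓘(ℝ, ℝ)).symm.continuous.comp
      (continuous_id.prodMk continuous_const))

/-- The fibrewise dilation of the tangent bundle. -/
def dilate (a : ℝ) (p : TangentBundle (𝓡 n) M) : TangentBundle (𝓡 n) M := ⟨p.1, a • p.2⟩

theorem extChartAt_tangent_dilate {p : TangentBundle (𝓡 n) M}
    (hp : p.1 ∈ (extChartAt (𝓡 n) p₀.1).source) (a : ℝ) :
    extChartAt (𝓡 n).tangent p₀ (dilate a p) =
      Prod.map id (a • ·) (extChartAt (𝓡 n).tangent p₀ p) := by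
  rw [extChartAt_tangent_apply hp, extChartAt_tangent_apply (p := dilate a p) hp]
  exact congrArg _ (map_smul (ofTangent p₀.1 p.1) a p.2)

theorem continuous_dilate (a : ℝ) : Continuous (dilate (n := n) (M := M) a) := by
  refine continuous_iff_continuousAt.2 fun p ↦ ?_
  have hscale : ContinuousAt (fun q ↦ Prod.map id (a • ·) (extChartAt (𝓡 n).tangent p q)) p :=
    (continuous_id.prodMap (continuous_const_smul a)).continuousAt.comp (continuousAt_extChartAt p)
  have hsymm : ContinuousAt (extChartAt (𝓡 n).tangent p).symm
      (Prod.map id (a • ·) (extChartAt (𝓡 n).tangent p p)) := by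
    refine continuousAt_extChartAt_symm'' ?_
    rw [extChartAt_tangent_target]
    exact ⟨(extChartAt (𝓡 n) p.1).map_source (mem_extChartAt_source p.1), mem_univ _⟩
  refine (ContinuousAt.comp (f := fun q ↦ Prod.map id (a • ·) (extChartAt (𝓡 n).tangent p q))
    hsymm hscale).congr ?_
  filter_upwards [extChartAt_source_mem_nhds (I := (𝓡 n).tangent) p] with q hq
  have hq' : q.1 ∈ (extChartAt (𝓡 n) p.1).source := mem_extChartAt_tangent_source.1 hq
  rw [Function.comp_apply, ← extChartAt_tangent_dilate hq']
  exact (extChartAt _ p).left_inv (mem_extChartAt_tangent_source.2 hq')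

variable [RiemannianBundle (fun x : M ↦ TangentSpace (𝓡 n) x)]
  [IsContMDiffRiemannianBundle (𝓡 n) ∞ (EuclideanSpace ℝ (Fin n))
      (fun x : M ↦ TangentSpace (𝓡 n) x)]

open LocalMetric

theorem geodesic_equation_iff {x₀ : M} {c w : ℝ → Coord n} {a : Coord n} {t : ℝ}
    (hy : c t ∈ (extChartAt (𝓡 n) x₀).target) (hc : ∀ᶠ s in 𝓝 t, HasDerivAt c (w s) s)
    (hw : HasDerivAt w a t) :
    (∀ k, deriv (deriv fun s ↦ c s k) t + ∑ i, ∑ j, christoffel x₀ k i j (c t) *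
      deriv (fun s ↦ c s i) t * deriv (fun s ↦ c s j) t = 0) ↔
      a = -christoffelMap (metricOperator x₀) (c t) (w t) (w t) := by
  have hproj {f : ℝ → Coord n} {f' : Coord n} {s : ℝ} (k : Fin n) (h : HasDerivAt f f' s) :
      deriv (fun s ↦ f s k) s = f' k :=
    ((EuclideanSpace.proj (𝕜 := ℝ) k).hasFDerivAt.comp_hasDerivAt s h).deriv
  have hderiv (k : Fin n) : deriv (fun s ↦ c s k) =ᶠ[𝓝 t] fun s ↦ w s k :=
    hc.mono fun s hs ↦ hproj k hs
  simp only [(hderiv _).deriv_eq, hproj _ hw, (hderiv _).eq_of_nhds,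
    ← christoffelMap_metricOperator_apply hy, add_eq_zero_iff_eq_neg]
  exact ⟨fun h ↦ by ext k; exact h k, fun h k ↦ congrArg (· k) h⟩

theorem hasMFDerivAt_geodesicField_iff {p : ℝ → TangentBundle (𝓡 n) M} {t : ℝ}
    (hx : (p t).1 ∈ (extChartAt (𝓡 n) p₀.1).source) :
    HasMFDerivAt% p t ((1 : ℝ →L[ℝ] ℝ).smulRight (geodesicField n M (p t))) ↔
      ContinuousAt p t ∧ HasDerivAt (extChartAt (𝓡 n).tangent p₀ ∘ p)
        (chartSpray p₀.1 (extChartAt (𝓡 n).tangent p₀ (p t))) t := by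
  have hp := mem_extChartAt_tangent_source.2 hx
  rw [hasMFDerivAt_iff_hasDerivAt_chartField hp,
    chartField_geodesicField ((extChartAt _ p₀).map_source hp)]

theorem hasMFDerivAt_base {p : ℝ → TangentBundle (𝓡 n) M} {t : ℝ}
    (h : HasMFDerivAt% p t ((1 : ℝ →L[ℝ] ℝ).smulRight (geodesicField n M (p t)))) :
    HasMFDerivAt 𝓘(ℝ, ℝ) (𝓡 n) (fun s ↦ (p s).1) t ((1 : ℝ →L[ℝ] ℝ).smulRight (p t).2) := by
  have hx : (p t).1 ∈ (extChartAt (𝓡 n) (p t).1).source := mem_extChartAt_source (p t).1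
  have hcont : ContinuousAt (fun s ↦ (p s).1) t :=
    (FiberBundle.continuous_proj (Coord n) (TangentSpace (𝓡 n))).continuousAt.comp h.1
  refine (hasMFDerivAt_iff_hasDerivAt_extChartAt (γ := fun s ↦ (p s).1) hx).2 ⟨hcont, ?_⟩
  have hderiv : HasDerivAt (fun s ↦ (extChartAt (𝓡 n).tangent (p t) (p s)).1)
      (extChartAt (𝓡 n).tangent (p t) (p t)).2 t :=
    ((hasMFDerivAt_geodesicField_iff hx).1 h).2.fst
  rw [extChartAt_tangent_apply hx, ofTangent_apply hx] at hderiv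
  refine hderiv.congr_of_eventuallyEq ?_
  filter_upwards [hcont (extChartAt_source_mem_nhds (I := 𝓡 n) (p t).1)] with s hs
  simp only [Function.comp_apply, extChartAt_tangent_apply hs]

theorem velocity_base {p : ℝ → TangentBundle (𝓡 n) M} {t : ℝ}
    (h : HasMFDerivAt% p t ((1 : ℝ →L[ℝ] ℝ).smulRight (geodesicField n M (p t)))) :
    velocity (fun s ↦ (p s).1) t = p t := by
  have hvel : (mfderiv 𝓘(ℝ, ℝ) (𝓡 n) (fun s ↦ (p s).1) t (1 : ℝ) : TangentSpace (𝓡 n) (p t).1) =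
      (p t).2 :=
    (DFunLike.congr_fun (hasMFDerivAt_base h).mfderiv (1 : ℝ)).trans (one_smul ℝ (p t).2)
  exact congrArg (TotalSpace.mk (p t).1) hvel

theorem contMDiffAt_base {p : ℝ → TangentBundle (𝓡 n) M} {t : ℝ}
    (h : IsMIntegralCurveAt p (geodesicField n M) t) :
    ContMDiffAt 𝓘(ℝ, ℝ) (𝓡 n) ∞ (fun s ↦ (p s).1) t :=
  (contMDiff_proj (TangentSpace (𝓡 n) : M → Type _)).contMDiffAt.comp t
    (contMDiffAt_of_isMIntegralCurveAt contMDiff_geodesicField h)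

theorem isGeodesic_base {p : ℝ → TangentBundle (𝓡 n) M}
    (h : IsMIntegralCurve p (geodesicField n M)) : IsGeodesic (n := n) fun s ↦ (p s).1 := by
  refine ⟨fun t ↦ contMDiffAt_base (h.isMIntegralCurveAt t), fun t x₀ hx ↦ ?_⟩
  let z (s : ℝ) := extChartAt (𝓡 n).tangent (⟨x₀, 0⟩ : TangentBundle (𝓡 n) M) (p s)
  have hmem : ∀ᶠ s in 𝓝 t, (p s).1 ∈ (extChartAt (𝓡 n) x₀).source :=
    (contMDiffAt_base (h.isMIntegralCurveAt t)).continuousAt (extChartAt_source_mem_nhds' hx)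
  have hchart {s : ℝ} (hs : (p s).1 ∈ (extChartAt (𝓡 n) x₀).source) :
      extChartAt (𝓡 n) x₀ (p s).1 = (z s).1 :=
    congrArg Prod.fst (extChartAt_tangent_apply (p₀ := ⟨x₀, 0⟩) hs).symm
  have hz {s : ℝ} (hs : (p s).1 ∈ (extChartAt (𝓡 n) x₀).source) :
      HasDerivAt z (chartSpray x₀ (z s)) s :=
    ((hasMFDerivAt_geodesicField_iff (p₀ := ⟨x₀, 0⟩) hs).1 (h s)).2
  refine (geodesic_equation_iff ((extChartAt (𝓡 n) x₀).map_source hx) ?_ (hz hx).snd).2 ?_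
  · filter_upwards [hmem.eventually_nhds] with s hs
    have hfst : HasDerivAt (fun r ↦ (z r).1) (z s).2 s := (hz hs.self_of_nhds).fst
    exact hfst.congr_of_eventuallyEq (hs.mono fun _ ↦ hchart)
  · rw [hchart hx]
    rfl

theorem isMIntegralCurve_velocity {γ : ℝ → M} (h : IsGeodesic (n := n) γ) :
    IsMIntegralCurve (velocity γ) (geodesicField n M) := by
  intro t
  have hx : γ t ∈ (extChartAt (𝓡 n) (γ t)).source := mem_extChartAt_source (γ t)
  let c := extChartAt (𝓡 n) (γ t) ∘ γ
  have hdiff (s : ℝ) : MDifferentiableAt 𝓘(ℝ, ℝ) (𝓡 n) γ s := (h.1 s).mdifferentiableAt (by simp)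
  have hmem : ∀ᶠ s in 𝓝 t, γ s ∈ (extChartAt (𝓡 n) (γ t)).source :=
    h.1.continuous.continuousAt (extChartAt_source_mem_nhds (γ t))
  have hsmooth : ContDiffAt ℝ ∞ c t := by
    simpa [mfld_simps, contDiffWithinAt_univ] using! (contMDiffAt_iff.1 (h.1 t)).2
  have hc : ∀ᶠ s in 𝓝 t, HasDerivAt c (deriv c s) s := by
    filter_upwards [(hsmooth.of_le (m := 1) (by simp)).eventually (by simp)] with s hs
    exact (hs.differentiableAt one_ne_zero).hasDerivAt
  have hc' : HasDerivAt (deriv c) (deriv (deriv c) t) t :=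
    ((hsmooth.derivWithin (m := ∞) (by simp)).differentiableAt (by simp)).hasDerivAt
  have hode := (geodesic_equation_iff ((extChartAt (𝓡 n) (γ t)).map_source hx) hc hc').1
    (h.2 t (γ t) hx)
  refine (hasMFDerivAt_geodesicField_iff (p₀ := velocity γ t) hx).2
    ⟨(continuous_velocity h.1).continuousAt, ?_⟩
  rw [extChartAt_tangent_velocity (hdiff t) hx]
  refine ((hc.self_of_nhds.prodMk (hode ▸ hc')).congr_of_eventuallyEq ?_)
  filter_upwards [hmem] with s hs using extChartAt_tangent_velocity (hdiff s) hs

theorem isMIntegralCurve_dilate {p : ℝ → TangentBundle (𝓡 n) M}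
    (h : IsMIntegralCurve p (geodesicField n M)) (a : ℝ) :
    IsMIntegralCurve (fun s ↦ dilate a (p (a * s))) (geodesicField n M) := by
  intro t
  have hx : (p (a * t)).1 ∈ (extChartAt (𝓡 n) (p (a * t)).1).source := mem_extChartAt_source _
  have hmul : HasDerivAt (fun s ↦ a * s) a t := by simpa using (hasDerivAt_id t).const_mul a
  have hpa : ContinuousAt (fun s ↦ p (a * s)) t := h.continuous.continuousAt.comp hmul.continuousAt
  refine (hasMFDerivAt_geodesicField_iff (p := fun s ↦ dilate a (p (a * s))) hx).2
    ⟨(continuous_dilate a).continuousAt.comp hpa, ?_⟩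
  set z := fun s ↦ extChartAt (𝓡 n).tangent (p (a * t)) (p s) with hz
  have hderiv : HasDerivAt (fun s ↦ z (a * s)) (a • chartSpray (p (a * t)).1 (z (a * t))) t :=
    HasDerivAt.scomp (g₁ := z) t ((hasMFDerivAt_geodesicField_iff hx).1 (h (a * t))).2 hmul
  have hscaled := ((ContinuousLinearMap.id ℝ (Coord n)).prodMap
    (a • ContinuousLinearMap.id ℝ (Coord n))).hasFDerivAt.comp_hasDerivAt t hderiv
  rw [extChartAt_tangent_dilate hx]
  refine (hscaled.congr_deriv ?_).congr_of_eventuallyEq ?_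
  · simp [chartSpray, spray, hz]
  · filter_upwards [hpa (extChartAt_source_mem_nhds (I := (𝓡 n).tangent) (p (a * t)))] with s hs
    exact extChartAt_tangent_dilate (mem_extChartAt_tangent_source.1 hs) a

end Geodesic

section Energy

variable {n : ℕ} {M : Type*} [TopologicalSpace M] [ChartedSpace (EuclideanSpace ℝ (Fin n)) M]
  [IsManifold (𝓡 n) ∞ M] [RiemannianBundle (fun x : M ↦ TangentSpace (𝓡 n) x)]
  [IsContMDiffRiemannianBundle (𝓡 n) ∞ (EuclideanSpace ℝ (Fin n))
      (fun x : M ↦ TangentSpace (𝓡 n) x)]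

theorem hasDerivAt_norm_sq {p : ℝ → TangentBundle (𝓡 n) M} {t : ℝ}
    (h : HasMFDerivAt% p t ((1 : ℝ →L[ℝ] ℝ).smulRight (geodesicField n M (p t)))) :
    HasDerivAt (fun s ↦ ‖(p s).2‖ ^ 2) 0 t := by
  have hx : (p t).1 ∈ (extChartAt (𝓡 n) (p t).1).source := mem_extChartAt_source (p t).1
  let c (s : ℝ) : Coord n := extChartAt (𝓡 n) (p t).1 (p s).1
  let w (s : ℝ) : Coord n := ofTangent (p t).1 (p s).1 (p s).2
  have hy : c t ∈ (extChartAt (𝓡 n) (p t).1).target := (extChartAt (𝓡 n) (p t).1).map_source hx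
  have hsource : ∀ᶠ s in 𝓝 t, (p s).1 ∈ (extChartAt (𝓡 n) (p t).1).source :=
    (h.1.eventually (extChartAt_source_mem_nhds (I := (𝓡 n).tangent) (p t))).mono
      fun s hs ↦ mem_extChartAt_tangent_source.1 hs
  have hcw : HasDerivAt (fun s ↦ (c s, w s)) (chartSpray (p t).1 (c t, w t)) t := by
    have hz := ((hasMFDerivAt_geodesicField_iff hx).1 h).2
    rw [extChartAt_tangent_apply hx] at hz
    exact hz.congr_of_eventuallyEq (hsource.mono fun s hs ↦ (extChartAt_tangent_apply hs).symm)
  have hc : HasDerivAt c (w t) t := hcw.fst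
  refine (LocalMetric.hasDerivAt_energy (isSelfAdjoint_metricOperator (p t).1)
    (isUnit_metricOperator hy) (differentiableAt_metricOperator hy) hc
    hcw.snd).congr_of_eventuallyEq ?_
  filter_upwards [hsource] with s hs
  exact ((inner_metricOperator_ofTangent hs _ _).trans (real_inner_self_eq_norm_sq _)).symm

theorem norm_eq_of_isMIntegralCurveOn {p : ℝ → TangentBundle (𝓡 n) M} {D : Set ℝ} (hD : IsOpen D)
    (hconn : IsPreconnected D) (h : IsMIntegralCurveOn p (geodesicField n M) D) {s t : ℝ}
    (hs : s ∈ D) (ht : t ∈ D) : ‖(p s).2‖ = ‖(p t).2‖ := by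
  have hderiv : ∀ r ∈ D, HasDerivAt (fun s ↦ ‖(p s).2‖ ^ 2) 0 r := fun r hr ↦
    hasDerivAt_norm_sq (h.isMIntegralCurveAt (hD.mem_nhds hr)).hasMFDerivAt
  have hsq : ‖(p s).2‖ ^ 2 = ‖(p t).2‖ ^ 2 := hD.is_const_of_deriv_eq_zero hconn
    (fun r hr ↦ (hderiv r hr).differentiableAt.differentiableWithinAt)
    (fun r hr ↦ (hderiv r hr).deriv) hs ht
  exact (pow_left_inj₀ (norm_nonneg _) (norm_nonneg _) two_ne_zero).1 hsq

theorem eventually_norm_ofTangent_le (x : M) :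
    ∃ C > 0, ∀ᶠ y in 𝓝 x, ∀ v : TangentSpace (𝓡 n) y, ‖ofTangent x y v‖ ≤ C * ‖v‖ := by
  have : IsContinuousRiemannianBundle (EuclideanSpace ℝ (Fin n))
      (fun x : M ↦ TangentSpace (𝓡 n) x) := by
    obtain ⟨g, hg, h⟩ := IsContMDiffRiemannianBundle.exists_contMDiff (IB := 𝓡 n) (n := ∞)
      (F := EuclideanSpace ℝ (Fin n)) (E := fun x : M ↦ TangentSpace (𝓡 n) x)
    exact ⟨g, hg.continuous, h⟩
  obtain ⟨C, hC, h⟩ := eventually_norm_trivializationAt_lt (EuclideanSpace ℝ (Fin n))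
    (fun x : M ↦ TangentSpace (𝓡 n) x) x
  refine ⟨C, hC, h.mono fun y hy v ↦ ?_⟩
  have hbound := (Trivialization.continuousLinearMapAt ℝ (trivializationAt
    (EuclideanSpace ℝ (Fin n)) (fun x : M ↦ TangentSpace (𝓡 n) x) x) y).le_of_opNorm_le hy.le v
  rw [Trivialization.continuousLinearMapAt_apply] at hbound
  rw [ofTangent, Trivialization.continuousLinearMapAt_apply]
  exact hbound

theorem exists_nhds_isCompact_norm_le (x : M) (R : ℝ) :
    ∃ U ∈ 𝓝 x, ∃ K : Set (TangentBundle (𝓡 n) M), IsCompact K ∧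
      ∀ p : TangentBundle (𝓡 n) M, p.1 ∈ U → ‖p.2‖ ≤ R → p ∈ K := by
  obtain ⟨p₀, rfl⟩ : ∃ p₀ : TangentBundle (𝓡 n) M, p₀.1 = x := ⟨⟨x, 0⟩, rfl⟩
  obtain ⟨C, hC, hbound⟩ := eventually_norm_ofTangent_le (n := n) p₀.1
  obtain ⟨r, hr, hball⟩ := nhds_basis_closedBall.mem_iff.1
    (extChartAt_target_mem_nhds (I := 𝓡 n) p₀.1)
  let B := closedBall (extChartAt (𝓡 n) p₀.1 p₀.1) r ×ˢ closedBall (0 : Coord n) (C * R)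
  have hB : B ⊆ (extChartAt (𝓡 n).tangent p₀).target := by
    rw [extChartAt_tangent_target]
    exact Set.prod_mono hball (subset_univ _)
  have hcompact : IsCompact B := (isCompact_closedBall _ _).prod (isCompact_closedBall _ _)
  have hnhds : ∀ᶠ y in 𝓝 p₀.1,
      extChartAt (𝓡 n) p₀.1 y ∈ closedBall (extChartAt (𝓡 n) p₀.1 p₀.1) r :=
    continuousAt_extChartAt (I := 𝓡 n) p₀.1 (closedBall_mem_nhds _ hr)
  refine ⟨_, inter_mem hbound (inter_mem (extChartAt_source_mem_nhds (I := 𝓡 n) p₀.1) hnhds),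
    _, hcompact.image_of_continuousOn ((continuousOn_extChartAt_symm p₀).mono hB), ?_⟩
  rintro p ⟨hp, hps, hpr⟩ hpR
  refine ⟨extChartAt (𝓡 n).tangent p₀ p, ?_,
    (extChartAt _ p₀).left_inv (mem_extChartAt_tangent_source.2 hps)⟩
  rw [extChartAt_tangent_apply hps]
  exact ⟨hpr, mem_closedBall_zero_iff.2
    ((hp p.2).trans (mul_le_mul_of_nonneg_left hpR hC.le))⟩

theorem exists_isCompact_norm_le {S : Set M} (hS : IsCompact S) (R : ℝ) :
    ∃ K : Set (TangentBundle (𝓡 n) M), IsCompact K ∧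
      ∀ p : TangentBundle (𝓡 n) M, p.1 ∈ S → ‖p.2‖ ≤ R → p ∈ K := by
  refine hS.induction_on ⟨∅, isCompact_empty, by simp⟩ ?_ ?_ fun x _ ↦ ?_
  · rintro S S' hSS' ⟨K, hK, h⟩
    exact ⟨K, hK, fun p hp ↦ h p (hSS' hp)⟩
  · rintro S S' ⟨K, hK, h⟩ ⟨K', hK', h'⟩
    exact ⟨K ∪ K', hK.union hK', fun p hp hR ↦
      hp.imp (fun hp ↦ h p hp hR) (fun hp ↦ h' p hp hR)⟩
  · obtain ⟨U, hU, h⟩ := exists_nhds_isCompact_norm_le (n := n) x R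
    exact ⟨U, mem_nhdsWithin_of_mem_nhds hU, h⟩

end Energy

section Complete

variable {n : ℕ} {M : Type*} [MetricSpace M] [ChartedSpace (EuclideanSpace ℝ (Fin n)) M]
  [IsManifold (𝓡 n) ∞ M] [RiemannianBundle (fun x : M ↦ TangentSpace (𝓡 n) x)]
  [IsContMDiffRiemannianBundle (𝓡 n) ∞ (EuclideanSpace ℝ (Fin n))
      (fun x : M ↦ TangentSpace (𝓡 n) x)]
  [IsRiemannianManifold (𝓡 n) M]

theorem edist_base_le {p : ℝ → TangentBundle (𝓡 n) M} {s t R : ℝ} (hst : s ≤ t)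
    (h : ∀ r ∈ Icc s t, IsMIntegralCurveAt p (geodesicField n M) r)
    (hR : ∀ r ∈ Icc s t, ‖(p r).2‖ ≤ R) :
    edist (p s).1 (p t).1 ≤ ENNReal.ofReal R * edist s t := calc
  edist (p s).1 (p t).1 ≤ pathELength (𝓡 n) (fun r ↦ (p r).1) s t := by
    rw [IsRiemannianManifold.out (I := 𝓡 n)]
    exact riemannianEDist_le_pathELength (fun r hr ↦ ((contMDiffAt_base (h r hr)).of_le
      (by simp)).contMDiffWithinAt) rfl rfl hst
  _ ≤ ∫⁻ _ in Icc s t, ENNReal.ofReal R := by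
    rw [pathELength_eq_lintegral_mfderiv_Icc]
    refine setLIntegral_mono measurable_const fun r hr ↦ ?_
    have hspeed : ‖(p r).2‖ₑ ≤ ENNReal.ofReal R :=
      (ofReal_norm (p r).2).symm.trans_le (ENNReal.ofReal_le_ofReal (hR r hr))
    have hvel := velocity_base (h r hr).hasMFDerivAt
    exact (congrArg (fun q : TangentBundle (𝓡 n) M ↦ ‖q.2‖ₑ) hvel).trans_le hspeed
  _ = ENNReal.ofReal R * edist s t := by
    rw [setLIntegral_const, Real.volume_Icc, edist_comm, edist_dist, Real.dist_eq,
      abs_of_nonneg (sub_nonneg.2 hst)]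

theorem lipschitzOnWith_base {p : ℝ → TangentBundle (𝓡 n) M} {T : ℝ}
    (h : IsMIntegralCurveOn p (geodesicField n M) (Ioo (-T) T)) (hT : 0 < T) :
    LipschitzOnWith ‖(p 0).2‖.toNNReal (fun s ↦ (p s).1) (Ioo (-T) T) := by
  intro s hs t ht
  wlog hst : s ≤ t generalizing s t
  · rw [edist_comm, edist_comm s t]
    exact this ht hs (le_of_not_ge hst)
  have hsub : Icc s t ⊆ Ioo (-T) T := Icc_subset_Ioo hs.1 ht.2
  exact edist_base_le hst (fun r hr ↦ h.isMIntegralCurveAt (isOpen_Ioo.mem_nhds (hsub hr)))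
    fun r hr ↦ (norm_eq_of_isMIntegralCurveOn isOpen_Ioo isPreconnected_Ioo h (hsub hr)
      ⟨neg_lt_zero.2 hT, hT⟩).le

variable [CompleteSpace M]

variable (n M) in
theorem isCompleteField_geodesicField : IsCompleteField (geodesicField n M) := by
  refine exists_isMIntegralCurve_of_isCompact_image
    (contMDiff_geodesicField.of_le (by simp)) fun p T hT hp ↦ ?_
  have hbounded : TotallyBounded ((fun r ↦ (p r).1) '' Ioo (-T) T) := by
    have hdomain : TotallyBounded (univ : Set (Ioo (-T) T)) :=
      preimage_eq_univ_iff.2 Subtype.range_coe.le ▸ totallyBounded_preimage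
        isUniformEmbedding_subtype_val.isUniformInducing (totallyBounded_Ioo (-T) T)
    simpa only [image_univ, range_domRestrict] using
      hdomain.image (lipschitzOnWith_base hp hT).to_restrict.uniformContinuous
  obtain ⟨K, hK, hmem⟩ := exists_isCompact_norm_le (n := n)
    (hbounded.closure.isCompact_of_isClosed isClosed_closure) ‖(p 0).2‖
  exact ⟨K, hK, fun t ht ↦ hmem (p t) (subset_closure (mem_image_of_mem _ ht))
    (norm_eq_of_isMIntegralCurveOn isOpen_Ioo isPreconnected_Ioo hp ht
      ⟨neg_lt_zero.2 hT, hT⟩).le⟩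

variable (n M) in
/-- The geodesic flow on the tangent bundle of a complete Riemannian manifold. -/
def geodesicFlow (t : ℝ) (p : TangentBundle (𝓡 n) M) : TangentBundle (𝓡 n) M :=
  flow (isCompleteField_geodesicField n M) t p

theorem isMIntegralCurve_geodesicFlow (p : TangentBundle (𝓡 n) M) :
    IsMIntegralCurve (fun t ↦ geodesicFlow n M t p) (geodesicField n M) :=
  isMIntegralCurve_flow _ p

theorem geodesicFlow_zero (p : TangentBundle (𝓡 n) M) : geodesicFlow n M 0 p = p :=
  flow_zero _ p

theorem eq_geodesicFlow {p : ℝ → TangentBundle (𝓡 n) M}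
    (h : IsMIntegralCurve p (geodesicField n M)) (t : ℝ) : p t = geodesicFlow n M t (p 0) :=
  congrFun (eq_flow _ (contMDiff_geodesicField.of_le (by simp)) h) t

theorem expMap_eq (x : M) (v : TangentSpace (𝓡 n) x) :
    expMap x v = (geodesicFlow n M 1 ⟨x, v⟩).1 := by
  have hflow := isMIntegralCurve_geodesicFlow (⟨x, v⟩ : TangentBundle (𝓡 n) M)
  have hex : ∃ γ : ℝ → M, IsGeodesic (n := n) γ ∧
      velocity γ 0 = (⟨x, v⟩ : TangentBundle (𝓡 n) M) :=
    ⟨fun s ↦ (geodesicFlow n M s ⟨x, v⟩).1, isGeodesic_base hflow,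
      (velocity_base (hflow 0)).trans (geodesicFlow_zero _)⟩
  obtain ⟨hgeodesic, hvelocity⟩ := hex.choose_spec
  rw [expMap, dif_pos hex]
  have heq := eq_geodesicFlow (isMIntegralCurve_velocity hgeodesic) 1
  rw [hvelocity] at heq
  exact congrArg TotalSpace.proj heq

theorem geodesicFlow_dilate (a t : ℝ) (p : TangentBundle (𝓡 n) M) :
    geodesicFlow n M t (dilate a p) = dilate a (geodesicFlow n M (a * t) p) := by
  have h := eq_geodesicFlow (isMIntegralCurve_dilate (isMIntegralCurve_geodesicFlow p) a) t
  rw [mul_zero, geodesicFlow_zero] at h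
  exact h.symm

theorem expMap_smul (δ : ℝ) (x : M) (u : TangentSpace (𝓡 n) x) :
    expMap x (δ • u) = (geodesicFlow n M δ ⟨x, u⟩).1 := by
  have h := geodesicFlow_dilate δ 1 (⟨x, u⟩ : TangentBundle (𝓡 n) M)
  rw [mul_one] at h
  rw [expMap_eq]
  change (geodesicFlow n M 1 (dilate δ ⟨x, u⟩)).1 = _
  rw [h]
  rfl

theorem GeodesicallyConvex.exists_expMap_eq {K : Set M} (hK : GeodesicallyConvex n K) {x y : M}
    (hx : x ∈ K) (hy : y ∈ K) : ∃ v : TangentSpace (𝓡 n) x, expMap x v = y := by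
  obtain ⟨γ, hγ, ⟨-, rfl, rfl, -⟩, -⟩ := hK x hx y hy
  exact ⟨(velocity γ 0).2, (expMap_eq (γ 0) _).trans
    (congrArg TotalSpace.proj (eq_geodesicFlow (isMIntegralCurve_velocity hγ) 1)).symm⟩

end Complete

section Gaussian

variable {V : Type*} [NormedAddCommGroup V] [InnerProductSpace ℝ V] [FiniteDimensional ℝ V]

theorem det_eq_sq_mul_of_inner_eq {A B L : V →L[ℝ] V}
    (h : ∀ u w, inner ℝ u (A w) = inner ℝ (L u) (B (L w))) : A.det = L.det ^ 2 * B.det := by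
  have : CompleteSpace V := FiniteDimensional.complete ℝ V
  have hA : A = (ContinuousLinearMap.adjoint L).comp (B.comp L) := by
    ext w
    refine ext_inner_left ℝ fun u ↦ ?_
    rw [h, ContinuousLinearMap.comp_apply, ContinuousLinearMap.adjoint_inner_right,
      ContinuousLinearMap.comp_apply]
  have hadjoint : (ContinuousLinearMap.adjoint L).det = L.det := by
    let b := stdOrthonormalBasis ℝ V
    have htranspose : LinearMap.toMatrix b.toBasis b.toBasis
        (ContinuousLinearMap.adjoint L).toLinearMap =
          (LinearMap.toMatrix b.toBasis b.toBasis L.toLinearMap).conjTranspose :=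
      LinearMap.toMatrix_adjoint b b L.toLinearMap
    rw [ContinuousLinearMap.det, ← LinearMap.det_toMatrix b.toBasis, htranspose,
      Matrix.det_conjTranspose, star_trivial, LinearMap.det_toMatrix]
  rw [hA, ContinuousLinearMap.det, ContinuousLinearMap.toLinearMap_comp,
    ContinuousLinearMap.toLinearMap_comp, LinearMap.det_comp, LinearMap.det_comp]
  change (ContinuousLinearMap.adjoint L).det * (B.det * L.det) = _
  rw [hadjoint]
  ring

/-- The constant `(2π)^(-d/2)` normalizing the density of the standard Gaussian in dimension
`d`. -/
def gaussianConst (d : ℕ) : ℝ := ((2 * Real.pi) ^ ((d : ℝ) / 2))⁻¹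

theorem gaussianConst_pos (d : ℕ) : 0 < gaussianConst d := by
  unfold gaussianConst
  positivity

variable [MeasurableSpace V] [BorelSpace V]

variable (V) in
theorem integrable_exp_neg_norm_sq_div_two :
    Integrable fun v : V ↦ Real.exp (-‖v‖ ^ 2 / 2) := by
  refine (GaussianFourier.integrable_cexp_neg_mul_sq_norm_add (V := V) (b := 1 / 2)
    (by norm_num) 0 0).norm.congr (Eventually.of_forall fun v ↦ ?_)
  simp only [Complex.norm_exp, inner_zero_left]
  congr 1
  simp only [one_div, ← Complex.ofReal_pow, neg_mul, Complex.ofReal_zero, mul_zero, add_zero,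
    Complex.neg_re, Complex.mul_re, Complex.inv_re, Complex.re_ofNat, Complex.normSq_ofNat,
    div_self_mul_self', Complex.ofReal_re, Complex.inv_im, Complex.im_ofNat, neg_zero, zero_div,
    Complex.ofReal_im, sub_zero]
  ring

theorem integral_cexp_neg_norm_sq_div_two_add (t : V) :
    ∫ v : V, Complex.exp (-(1 / 2 : ℂ) * ‖v‖ ^ 2 + Complex.I * inner ℝ t v) =
      ((gaussianConst (Module.finrank ℝ V))⁻¹ : ℝ) * Complex.exp (-‖t‖ ^ 2 / 2) := by
  have hconst : ((Real.pi : ℂ) / (1 / 2)) ^ ((Module.finrank ℝ V : ℂ) / 2) =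
      ((gaussianConst (Module.finrank ℝ V))⁻¹ : ℝ) := by
    rw [gaussianConst, inv_inv, Complex.ofReal_cpow (by positivity)]
    push_cast
    congr 1
    ring
  rw [GaussianFourier.integral_cexp_neg_mul_sq_norm_add (by norm_num), hconst, Complex.I_sq]
  ring_nf

variable (V) in
theorem stdGaussian_eq_withDensity : stdGaussian V = volume.withDensity fun v ↦
    ENNReal.ofReal (gaussianConst (Module.finrank ℝ V) * Real.exp (-‖v‖ ^ 2 / 2)) := by
  set c := gaussianConst (Module.finrank ℝ V) with hc
  have hc0 : 0 < c := gaussianConst_pos _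
  have : IsFiniteMeasure ((volume : Measure V).withDensity fun v ↦
      ENNReal.ofReal (c * Real.exp (-‖v‖ ^ 2 / 2))) :=
    isFiniteMeasure_withDensity_ofReal ((integrable_exp_neg_norm_sq_div_two V).const_mul c).2
  refine Measure.ext_of_charFun (funext fun t ↦ ?_)
  have hintegrand (v : V) : (ENNReal.ofReal (c * Real.exp (-‖v‖ ^ 2 / 2))).toReal •
      Complex.exp (inner ℝ v t * Complex.I) =
        (c : ℂ) * Complex.exp (-(1 / 2 : ℂ) * ‖v‖ ^ 2 + Complex.I * inner ℝ t v) := by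
    rw [ENNReal.toReal_ofReal (by positivity), Complex.real_smul, Complex.ofReal_mul, mul_assoc,
      Complex.ofReal_exp, ← Complex.exp_add, real_inner_comm]
    congr 2
    push_cast
    ring
  rw [charFun_stdGaussian, charFun_apply, integral_withDensity_eq_integral_toReal_smul
    (by fun_prop) (Eventually.of_forall fun v ↦ ENNReal.ofReal_lt_top)]
  simp_rw [hintegrand]
  rw [integral_const_mul, integral_cexp_neg_norm_sq_div_two_add, ← hc, ← mul_assoc,
    ← Complex.ofReal_mul, mul_inv_cancel₀ hc0.ne', Complex.ofReal_one, one_mul]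

theorem stdGaussian_preimage {A L : V →L[ℝ] V}
    (h : ∀ u w, inner ℝ (L u) (A (L w)) = inner ℝ u w) {B : Set V} (hB : MeasurableSet B) :
    stdGaussian V (L ⁻¹' B) = ∫⁻ w in B, ENNReal.ofReal (gaussianConst (Module.finrank ℝ V) *
      (√A.det * Real.exp (-inner ℝ w (A w) / 2))) := by
  have hdet : |L.det| * √A.det = 1 := by
    rw [← Real.sqrt_sq_eq_abs, ← Real.sqrt_mul (sq_nonneg _),
      ← det_eq_sq_mul_of_inner_eq (A := ContinuousLinearMap.id ℝ V) fun u w ↦ (h u w).symm,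
      ContinuousLinearMap.det, ContinuousLinearMap.coe_id, LinearMap.det_id, Real.sqrt_one]
  have hinj : Function.Injective L := by
    refine (injective_iff_map_eq_zero L).2 fun u hu ↦ ?_
    rw [← inner_self_eq_zero (𝕜 := ℝ), ← h, hu, inner_zero_left]
  have hsurj : Function.Surjective L := LinearMap.surjective_of_injective (f := L.toLinearMap) hinj
  have hLB : MeasurableSet (L ⁻¹' B) := L.continuous.measurable hB
  rw [stdGaussian_eq_withDensity, withDensity_apply _ hLB]
  conv_rhs => rw [← image_preimage_eq B hsurj]
  rw [lintegral_image_eq_lintegral_abs_det_fderiv_mul volume hLB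
    (fun v _ ↦ L.hasFDerivAt.hasFDerivWithinAt) hinj.injOn]
  refine lintegral_congr fun v ↦ ?_
  rw [← ENNReal.ofReal_mul (abs_nonneg _), h, real_inner_self_eq_norm_sq]
  congr 1
  linear_combination
    (-gaussianConst (Module.finrank ℝ V) * Real.exp (-‖v‖ ^ 2 / 2)) * hdet

end Gaussian

section ChartNull

variable {E : Type*} [NormedAddCommGroup E] [NormedSpace ℝ E] {H : Type*} [TopologicalSpace H]
  {I : ModelWithCorners ℝ E H} {N : Type*} [TopologicalSpace N] [ChartedSpace H N]

variable [MeasurableSpace N] [BorelSpace N]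

theorem measurableSet_extChartAt_source (x₀ : N) : MeasurableSet (extChartAt I x₀).source :=
  (isOpen_extChartAt_source x₀).measurableSet

variable [MeasurableSpace E] [BorelSpace E] {ρ : N → E → ℝ} {ν : Measure E} {μ : Measure N}

theorem HasChartDensity.measure_eq_zero_of_subset_image [FiniteDimensional ℝ E] [IsManifold I 1 N]
    [SecondCountableTopology N] [ν.IsAddHaarMeasure] (hμ : HasChartDensity I ρ ν μ) {f : E → N}
    (hf : MDifferentiable 𝓘(ℝ, E) I f) {S : Set E} (hS : ν S = 0) {A : Set N}
    (hA : MeasurableSet A) (hAS : A ⊆ f '' S) : μ A = 0 := by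
  obtain ⟨c, hc, hcover⟩ := TopologicalSpace.countable_cover_nhds
    fun x : N ↦ extChartAt_source_mem_nhds (I := I) x
  have hsub : A ⊆ ⋃ x ∈ c, (extChartAt I x).source ∩ A := by
    rw [← iUnion₂_inter, hcover, univ_inter]
  refine measure_mono_null hsub ((measure_biUnion_null_iff hc).2 fun x _ ↦ ?_)
  rw [hμ x _ ((measurableSet_extChartAt_source x).inter hA) inter_subset_left]
  refine setLIntegral_measure_zero _ _ ?_
  have himage : extChartAt I x '' ((extChartAt I x).source ∩ A) ⊆
      (extChartAt I x ∘ f) '' (f ⁻¹' (extChartAt I x).source ∩ S) := by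
    rintro _ ⟨y, ⟨hy, hyA⟩, rfl⟩
    obtain ⟨w, hw, rfl⟩ := hAS hyA
    exact ⟨w, ⟨hy, hw⟩, rfl⟩
  refine measure_mono_null himage (addHaar_image_eq_zero_of_differentiableOn_of_addHaar_eq_zero ν
    (fun w hw ↦ ?_) (measure_mono_null inter_subset_right hS))
  exact (((mdifferentiableAt_extChartAt (by simpa using hw.1)).comp w
    (hf w)).differentiableAt).differentiableWithinAt

end ChartNull

section ChartDensity

variable {E : Type*} [NormedAddCommGroup E] [NormedSpace ℝ E] [MeasurableSpace E] [BorelSpace E]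
  {H : Type*} [TopologicalSpace H] {I : ModelWithCorners ℝ E H} [I.Boundaryless]
  {N : Type*} [TopologicalSpace N] [ChartedSpace H N]

theorem measurableSet_extChartAt_target (x₀ : N) : MeasurableSet (extChartAt I x₀).target :=
  (isOpen_extChartAt_target x₀).measurableSet

variable [MeasurableSpace N] [BorelSpace N] {ρ : N → E → ℝ} {ν : Measure E} {μ : Measure N}

theorem aemeasurable_extChartAt_symm (x₀ : N) (ν : Measure E) (d : E → ℝ≥0∞) :
    AEMeasurable (extChartAt I x₀).symm ((ν.restrict (extChartAt I x₀).target).withDensity d) :=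
  ((continuousOn_extChartAt_symm x₀).aemeasurable (measurableSet_extChartAt_target x₀)).mono_ac
    (withDensity_absolutelyContinuous _ _)

theorem map_extChartAt_symm_withDensity_apply (x₀ : N) (ν : Measure E) [SFinite ν]
    (d : E → ℝ≥0∞) {A : Set N} (hA : MeasurableSet A) :
    ((ν.restrict (extChartAt I x₀).target).withDensity d).map (extChartAt I x₀).symm A =
      ∫⁻ z in extChartAt I x₀ '' ((extChartAt I x₀).source ∩ A), d z ∂ν := by
  rw [Measure.map_apply_of_aemeasurable (aemeasurable_extChartAt_symm x₀ ν d) hA,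
    withDensity_apply', Measure.restrict_restrict' (measurableSet_extChartAt_target x₀),
    PartialEquiv.image_source_inter_eq', inter_comm]

namespace HasChartDensity

theorem restrict_source_eq [SFinite ν] (hμ : HasChartDensity I ρ ν μ) (x₀ : N) :
    μ.restrict (extChartAt I x₀).source =
      ((ν.restrict (extChartAt I x₀).target).withDensity
        fun z ↦ ENNReal.ofReal (ρ x₀ z)).map (extChartAt I x₀).symm := by
  ext A hA
  have hs := measurableSet_extChartAt_source (I := I) x₀
  rw [map_extChartAt_symm_withDensity_apply x₀ ν _ hA, Measure.restrict_apply hA, inter_comm,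
    hμ x₀ _ (hs.inter hA) inter_subset_left]

theorem setLIntegral_source [SFinite ν] (hμ : HasChartDensity I ρ ν μ) {x₀ : N}
    (hρ : ContinuousOn (ρ x₀) (extChartAt I x₀).target) {f : N → ℝ≥0∞} (hf : Measurable f) :
    ∫⁻ x in (extChartAt I x₀).source, f x ∂μ = ∫⁻ z in (extChartAt I x₀).target,
      ENNReal.ofReal (ρ x₀ z) * f ((extChartAt I x₀).symm z) ∂ν := by
  have ht := measurableSet_extChartAt_target (I := I) x₀
  rw [hμ.restrict_source_eq,
    lintegral_map' hf.aemeasurable (aemeasurable_extChartAt_symm x₀ ν _)]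
  exact lintegral_withDensity_eq_lintegral_mul₀ (hρ.aemeasurable ht).ennreal_ofReal
    (hf.comp_aemeasurable ((continuousOn_extChartAt_symm x₀).aemeasurable ht))

end HasChartDensity

end ChartDensity

section Volume

variable {n : ℕ} {M : Type*} [TopologicalSpace M] [ChartedSpace (EuclideanSpace ℝ (Fin n)) M]
  [IsManifold (𝓡 n) ∞ M] [RiemannianBundle (fun x : M ↦ TangentSpace (𝓡 n) x)]

theorem sqrt_det_metricMatrix_eq {x₀ x₁ x : M} (h₀ : x ∈ (extChartAt (𝓡 n) x₀).source)
    (h₁ : x ∈ (extChartAt (𝓡 n) x₁).source) :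
    √(metricMatrix x₀ (extChartAt (𝓡 n) x₀ x)).det =
      |(fderiv ℝ (transition (n := n) x₀ x₁) (extChartAt (𝓡 n) x₀ x)).det| *
        √(metricMatrix x₁ (extChartAt (𝓡 n) x₁ x)).det := by
  have hdet := det_eq_sq_mul_of_inner_eq (inner_metricOperator_transition h₀ h₁)
  rw [← det_metricOperator, ← det_metricOperator, hdet, Real.sqrt_mul (sq_nonneg _),
    Real.sqrt_sq_eq_abs]

variable [MeasurableSpace M] [BorelSpace M]

theorem chartVolume_eq {x₀ x₁ : M} {A : Set M} (hA : MeasurableSet A)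
    (h₀ : A ⊆ (extChartAt (𝓡 n) x₀).source) (h₁ : A ⊆ (extChartAt (𝓡 n) x₁).source) :
    chartVolume (n := n) x₀ A = chartVolume (n := n) x₁ A := by
  rw [chartVolume, chartVolume, map_extChartAt_symm_withDensity_apply x₀ _ _ hA,
    map_extChartAt_symm_withDensity_apply x₁ _ _ hA, inter_eq_right.2 h₀, inter_eq_right.2 h₁]
  have htransition : EqOn (transition (n := n) x₀ x₁ ∘ extChartAt (𝓡 n) x₀)
      (extChartAt (𝓡 n) x₁) A := fun x hx ↦
    congrArg (extChartAt (𝓡 n) x₁) ((extChartAt (𝓡 n) x₀).left_inv (h₀ hx))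
  have himage := measurableSet_image_extChartAt (I := 𝓡 n) hA h₀
  rw [← htransition.image_eq, image_comp, lintegral_image_eq_lintegral_abs_det_fderiv_mul volume
    himage (f' := fderiv ℝ (transition (n := n) x₀ x₁))]
  · refine setLIntegral_congr_fun himage ?_
    rintro _ ⟨x, hx, rfl⟩
    have hx₁ : transition x₀ x₁ (extChartAt (𝓡 n) x₀ x) = extChartAt (𝓡 n) x₁ x := htransition hx
    simp only [hx₁, ← ENNReal.ofReal_mul (abs_nonneg _),
      sqrt_det_metricMatrix_eq (h₀ hx) (h₁ hx)]
  · rintro _ ⟨x, hx, rfl⟩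
    exact ((contDiffAt_transition (h₀ hx) (h₁ hx)).differentiableAt
      (by simp)).hasFDerivAt.hasFDerivWithinAt
  · exact (((extChartAt (𝓡 n) x₁).injOn.mono h₁).congr htransition.symm).image_of_comp

variable [SecondCountableTopology M] [Nonempty M]

variable (n M) in
theorem hasChartDensity_riemannianVolume : HasChartDensity (𝓡 n)
    (fun (x₀ : M) y ↦ √(metricMatrix x₀ y).det) volume (riemannianVolume n) := by
  intro x₀ A hA hAs
  set D := disjointed (fun j ↦ (chartAt (EuclideanSpace ℝ (Fin n)) (chartCenter n M j)).source)
  have hD (i : ℕ) : MeasurableSet (D i) :=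
    MeasurableSet.disjointed (fun j ↦ (chartAt _ _).open_source.measurableSet) i
  have hcover : ⋃ i, D i = univ :=
    iUnion_disjointed.trans (exists_chartCenter n M).choose_spec
  have hpiece (i : ℕ) : (chartVolume (n := n) (chartCenter n M i)).restrict (D i) A =
      chartVolume (n := n) x₀ (A ∩ D i) := by
    rw [Measure.restrict_apply hA]
    refine chartVolume_eq (hA.inter (hD i)) ?_ (inter_subset_left.trans hAs)
    rw [extChartAt_source]
    exact inter_subset_right.trans (disjointed_subset _ i)
  rw [riemannianVolume, Measure.sum_apply _ hA, tsum_congr hpiece, ← measure_iUnion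
    (fun i j hij ↦ (disjoint_disjointed _ hij).mono inter_subset_right inter_subset_right)
    (fun i ↦ hA.inter (hD i)), ← inter_iUnion, hcover, inter_univ, chartVolume,
    map_extChartAt_symm_withDensity_apply x₀ _ _ hA, inter_eq_right.2 hAs]

end Volume

theorem measurable_indicator_of_continuousOn {α β : Type*} [TopologicalSpace α]
    [MeasurableSpace α] [OpensMeasurableSpace α] [TopologicalSpace β] [MeasurableSpace β]
    [BorelSpace β] [Zero β] {f : α → β} {s : Set α} (hf : ContinuousOn f s)
    (hs : MeasurableSet s) : Measurable (s.indicator f) := by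
  classical
  rw [← piecewise_eq_indicator]
  exact hf.measurable_piecewise continuousOn_const hs

section TangentGaussian

variable {n : ℕ} {M : Type*} [TopologicalSpace M] [ChartedSpace (EuclideanSpace ℝ (Fin n)) M]
  [RiemannianBundle (fun x : M ↦ TangentSpace (𝓡 n) x)]

theorem tangentGaussian_map_neg (x : M) :
    (tangentGaussian (n := n) x).map Neg.neg = tangentGaussian x :=
  stdGaussian_map (LinearIsometryEquiv.neg ℝ)

instance isProbabilityMeasure_tangentGaussian (x : M) :
    IsProbabilityMeasure (tangentGaussian (n := n) x) :=
  isProbabilityMeasure_stdGaussian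

/-- The density at `z = (y, w)` of the standard Gaussian of the tangent space over `y`, in the
coordinates `w` given by the chart centred at `x₀`. -/
def fibreDensity (x₀ : M) (z : Coord n × Coord n) : ℝ :=
  gaussianConst n * (√(metricMatrix x₀ z.1).det *
    Real.exp (-inner ℝ z.2 (metricOperator x₀ z.1 z.2) / 2))

theorem sqrt_det_mul_fibreDensity (x₀ : M) (z : Coord n × Coord n) :
    √(metricMatrix x₀ z.1).det * fibreDensity x₀ z =
      LocalMetric.density (metricOperator x₀) (gaussianConst n) z := by
  rw [fibreDensity, LocalMetric.density, det_metricOperator]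
  linear_combination (gaussianConst n *
    Real.exp (-inner ℝ z.2 (metricOperator x₀ z.1 z.2) / 2)) *
      Real.mul_self_sqrt (det_metricMatrix_nonneg x₀ z.1)

variable [IsManifold (𝓡 n) ∞ M] {x₀ x : M}

theorem fibreDensity_pos {z : Coord n × Coord n} (hz : z.1 ∈ (extChartAt (𝓡 n) x₀).target) :
    0 < fibreDensity x₀ z := by
  have hdet : 0 < (metricMatrix x₀ z.1).det :=
    (det_metricMatrix_nonneg x₀ z.1).lt_of_ne'
      ((Matrix.isUnit_iff_isUnit_det _).1 (isUnit_metricMatrix hz)).ne_zero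
  have := gaussianConst_pos n
  unfold fibreDensity
  positivity

theorem tangentGaussian_preimage (hx : x ∈ (extChartAt (𝓡 n) x₀).source) {B : Set (Coord n)}
    (hB : MeasurableSet B) : tangentGaussian x (ofTangent x₀ x ⁻¹' B) =
      ∫⁻ w in B, ENNReal.ofReal (fibreDensity x₀ (extChartAt (𝓡 n) x₀ x, w)) := by
  have hfinrank : Module.finrank ℝ (TangentSpace (𝓡 n) x) = n :=
    finrank_euclideanSpace_fin (𝕜 := ℝ) (n := n)
  let e : TangentSpace (𝓡 n) x ≃ₗᵢ[ℝ] Coord n :=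
    ((stdOrthonormalBasis ℝ (TangentSpace (𝓡 n) x)).reindex (finCongr hfinrank)).repr
  let L : Coord n →L[ℝ] Coord n :=
    (ofTangent x₀ x).comp (e.symm.toContinuousLinearEquiv : Coord n →L[ℝ] TangentSpace (𝓡 n) x)
  have hisometry (u w : Coord n) :
      inner ℝ (L u) (metricOperator x₀ (extChartAt (𝓡 n) x₀ x) (L w)) = inner ℝ u w :=
    (inner_metricOperator_ofTangent hx (e.symm u) (e.symm w)).trans (e.symm.inner_map_map u w)
  have hpreimage : tangentGaussian x (ofTangent x₀ x ⁻¹' B) = stdGaussian (Coord n) (L ⁻¹' B) := by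
    have hL : e ⁻¹' (L ⁻¹' B) = ofTangent x₀ x ⁻¹' B := by
      ext v
      exact iff_of_eq (congrArg (ofTangent x₀ x · ∈ B) (e.symm_apply_apply v))
    rw [← stdGaussian_map e, Measure.map_apply e.continuous.measurable
      (L.continuous.measurable hB), hL]
    rfl
  rw [hpreimage, stdGaussian_preimage hisometry hB, finrank_euclideanSpace_fin,
    det_metricOperator]
  rfl

theorem volume_eq_zero_of_tangentGaussian (hx : x ∈ (extChartAt (𝓡 n) x₀).source)
    {B : Set (Coord n)} (hB : MeasurableSet B)
    (h : tangentGaussian x (ofTangent x₀ x ⁻¹' B) = 0) : volume B = 0 := by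
  rw [tangentGaussian_preimage hx hB] at h
  by_contra hne
  have hmeas : Measurable fun w ↦
      ENNReal.ofReal (fibreDensity x₀ (extChartAt (𝓡 n) x₀ x, w)) := by
    have hexp : Measurable fun w : Coord n ↦ Real.exp
        (-inner ℝ w (metricOperator x₀ (extChartAt (𝓡 n) x₀ x) w) / 2) := by fun_prop
    simp only [fibreDensity]
    exact ((hexp.const_mul _).const_mul _).ennreal_ofReal
  refine (setLIntegral_pos_iff hmeas).2 ?_ |>.ne' h
  have hsupport : (Function.support fun w ↦
      ENNReal.ofReal (fibreDensity x₀ (extChartAt (𝓡 n) x₀ x, w))) = univ :=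
    eq_univ_of_forall fun w ↦
      (ENNReal.ofReal_pos.2 (fibreDensity_pos ((extChartAt (𝓡 n) x₀).map_source hx))).ne'
  rwa [hsupport, univ_inter, pos_iff_ne_zero]

variable [IsContMDiffRiemannianBundle (𝓡 n) ∞ (EuclideanSpace ℝ (Fin n))
      (fun x : M ↦ TangentSpace (𝓡 n) x)]

theorem continuousOn_det_metricMatrix (x₀ : M) :
    ContinuousOn (fun y ↦ (metricMatrix x₀ y).det) (extChartAt (𝓡 n) x₀).target :=
  (contDiff_clm_det.differentiable one_ne_zero |>.continuous.comp_continuousOn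
    (contDiffOn_metricOperator x₀).continuousOn).congr fun y _ ↦ (det_metricOperator x₀ y).symm

theorem continuousOn_fibreDensity (x₀ : M) :
    ContinuousOn (fibreDensity (n := n) x₀) ((extChartAt (𝓡 n) x₀).target ×ˢ univ) := by
  have hfst {β : Type} [TopologicalSpace β] {f : Coord n → β}
      (hf : ContinuousOn f (extChartAt (𝓡 n) x₀).target) :
      ContinuousOn (fun z : Coord n × Coord n ↦ f z.1) ((extChartAt (𝓡 n) x₀).target ×ˢ univ) :=
    hf.comp continuousOn_fst fun z hz ↦ hz.1
  have henergy : ContinuousOn (fun z : Coord n × Coord n ↦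
      inner ℝ z.2 (metricOperator x₀ z.1 z.2)) ((extChartAt (𝓡 n) x₀).target ×ˢ univ) :=
    continuousOn_snd.inner ((hfst (contDiffOn_metricOperator x₀).continuousOn).clm_apply
      continuousOn_snd)
  exact continuousOn_const.mul ((hfst (continuousOn_det_metricMatrix x₀)).sqrt.mul
    (henergy.neg.div_const 2).rexp)

end TangentGaussian

section PhaseMeasure

variable {n : ℕ} {M : Type*} [TopologicalSpace M] [ChartedSpace (EuclideanSpace ℝ (Fin n)) M]
  [IsManifold (𝓡 n) ∞ M]

theorem continuous_fibre (x : M) :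
    Continuous fun u : TangentSpace (𝓡 n) x ↦ (⟨x, u⟩ : TangentBundle (𝓡 n) M) :=
  FiberBundle.continuous_totalSpaceMk (Coord n) (TangentSpace (𝓡 n) : M → Type _) x

theorem image_extChartAt_tangent_subset {p₀ : TangentBundle (𝓡 n) M}
    {A : Set (TangentBundle (𝓡 n) M)} (hA : A ⊆ (extChartAt (𝓡 n).tangent p₀).source) :
    extChartAt (𝓡 n).tangent p₀ '' A ⊆ (extChartAt (𝓡 n) p₀.1).target ×ˢ univ := by
  rw [← extChartAt_tangent_target]
  exact ((extChartAt (𝓡 n).tangent p₀).mapsTo.mono_left hA).image_subset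

theorem preimage_proj_source_inter {p₀ : TangentBundle (𝓡 n) M}
    {A : Set (TangentBundle (𝓡 n) M)} (hA : A ⊆ (extChartAt (𝓡 n).tangent p₀).source) :
    TotalSpace.proj ⁻¹' (extChartAt (𝓡 n) p₀.1).source ∩ A = A :=
  inter_eq_right.2 fun _ hp ↦ mem_extChartAt_tangent_source.1 (hA hp)

theorem measurableSet_preimage_proj [MeasurableSpace M] [BorelSpace M] {s : Set M}
    (hs : MeasurableSet s) :
    MeasurableSet (TotalSpace.proj ⁻¹' s : Set (TangentBundle (𝓡 n) M)) :=
  (FiberBundle.continuous_proj (Coord n) (TangentSpace (𝓡 n) : M → Type _)).measurable hs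

variable [RiemannianBundle (fun x : M ↦ TangentSpace (𝓡 n) x)]

/-- The Gaussian distribution of the tangent space at `x`, as a measure on the tangent bundle. -/
def fibreGaussian (x : M) : Measure (TangentBundle (𝓡 n) M) :=
  (tangentGaussian x).map fun u ↦ ⟨x, u⟩

variable {A : Set (TangentBundle (𝓡 n) M)}

theorem fibreGaussian_apply (x : M) (hA : MeasurableSet A) :
    fibreGaussian x A = tangentGaussian x {u | (⟨x, u⟩ : TangentBundle (𝓡 n) M) ∈ A} :=
  Measure.map_apply (continuous_fibre x).measurable hA

theorem fibreGaussian_preimage_dilate_neg (x : M) (hA : MeasurableSet A) :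
    fibreGaussian x (dilate (-1) ⁻¹' A) = fibreGaussian x A := by
  have hfibre : MeasurableSet {u : TangentSpace (𝓡 n) x | (⟨x, u⟩ : TangentBundle (𝓡 n) M) ∈ A} :=
    (continuous_fibre x).measurable hA
  rw [fibreGaussian_apply x ((continuous_dilate (-1)).measurable hA), fibreGaussian_apply x hA]
  conv_rhs => rw [← tangentGaussian_map_neg x, Measure.map_apply measurable_neg hfibre]
  congr 1
  ext u
  rw [mem_ofPred_eq, mem_preimage, dilate, neg_one_smul]
  rfl

theorem fibreGaussian_eq_lintegral {p₀ : TangentBundle (𝓡 n) M} {x : M}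
    (hx : x ∈ (extChartAt (𝓡 n) p₀.1).source) (hA : MeasurableSet A)
    (hAs : A ⊆ (extChartAt (𝓡 n).tangent p₀).source) :
    fibreGaussian x A = ∫⁻ w, (extChartAt (𝓡 n).tangent p₀ '' A).indicator
      (fun z ↦ ENNReal.ofReal (fibreDensity p₀.1 z)) (extChartAt (𝓡 n) p₀.1 x, w) := by
  have hslice : MeasurableSet {w | (extChartAt (𝓡 n) p₀.1 x, w) ∈
      extChartAt (𝓡 n).tangent p₀ '' A} :=
    (measurableSet_image_extChartAt (I := (𝓡 n).tangent) hA hAs).preimage measurable_prodMk_left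
  have hpreimage : {u : TangentSpace (𝓡 n) x | (⟨x, u⟩ : TangentBundle (𝓡 n) M) ∈ A} =
      ofTangent p₀.1 x ⁻¹' {w | (extChartAt (𝓡 n) p₀.1 x, w) ∈
        extChartAt (𝓡 n).tangent p₀ '' A} := by
    ext u
    have hu : (⟨x, u⟩ : TangentBundle (𝓡 n) M) ∈ (extChartAt (𝓡 n).tangent p₀).source :=
      mem_extChartAt_tangent_source.2 hx
    rw [mem_preimage, mem_ofPred_eq, mem_ofPred_eq, ← extChartAt_tangent_apply (p := ⟨x, u⟩) hx,
      (extChartAt (𝓡 n).tangent p₀).injOn.mem_image_iff hAs hu]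
  rw [fibreGaussian_apply x hA, hpreimage, tangentGaussian_preimage hx hslice,
    ← lintegral_indicator hslice]
  rfl

theorem measurable_indicator_fibreDensity [IsContMDiffRiemannianBundle (𝓡 n) ∞
    (EuclideanSpace ℝ (Fin n)) (fun x : M ↦ TangentSpace (𝓡 n) x)] {p₀ : TangentBundle (𝓡 n) M}
    (hA : MeasurableSet A) (hAs : A ⊆ (extChartAt (𝓡 n).tangent p₀).source) :
    Measurable ((extChartAt (𝓡 n).tangent p₀ '' A).indicator
      fun z ↦ ENNReal.ofReal (fibreDensity p₀.1 z)) := by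
  refine measurable_indicator_of_continuousOn ?_
    (measurableSet_image_extChartAt (I := (𝓡 n).tangent) hA hAs)
  exact ENNReal.continuous_ofReal.comp_continuousOn
    ((continuousOn_fibreDensity p₀.1).mono (image_extChartAt_tangent_subset hAs))

variable [MeasurableSpace M] [BorelSpace M]

theorem fibreGaussian_preimage_proj_inter {s : Set M} (hs : MeasurableSet s)
    (hA : MeasurableSet A) (x : M) :
    fibreGaussian x (TotalSpace.proj ⁻¹' s ∩ A) = s.indicator (fun x ↦ fibreGaussian x A) x := by
  rw [fibreGaussian_apply x ((measurableSet_preimage_proj hs).inter hA)]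
  by_cases hx : x ∈ s
  · rw [indicator_of_mem hx, fibreGaussian_apply x hA]
    exact congrArg _ (Set.ext fun u ↦ and_iff_right hx)
  · rw [indicator_of_notMem hx]
    exact measure_mono_null (fun u hu ↦ hx hu.1) measure_empty

variable [IsContMDiffRiemannianBundle (𝓡 n) ∞ (EuclideanSpace ℝ (Fin n))
      (fun x : M ↦ TangentSpace (𝓡 n) x)]

theorem measurable_fibreGaussian_of_subset {p₀ : TangentBundle (𝓡 n) M} (hA : MeasurableSet A)
    (hAs : A ⊆ (extChartAt (𝓡 n).tangent p₀).source) :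
    Measurable fun x ↦ fibreGaussian x A := by
  have hs := measurableSet_extChartAt_source (I := 𝓡 n) p₀.1
  have hchart : Measurable ((extChartAt (𝓡 n) p₀.1).source.indicator (extChartAt (𝓡 n) p₀.1)) :=
    measurable_indicator_of_continuousOn (continuousOn_extChartAt p₀.1) hs
  have hintegral : Measurable fun y ↦ ∫⁻ w, (extChartAt (𝓡 n).tangent p₀ '' A).indicator
      (fun z ↦ ENNReal.ofReal (fibreDensity p₀.1 z)) (y, w) :=
    (measurable_indicator_fibreDensity hA hAs).lintegral_prod_right'
  convert (hintegral.comp hchart).indicator hs using 1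
  funext x
  rw [← preimage_proj_source_inter hAs, fibreGaussian_preimage_proj_inter hs hA,
    preimage_proj_source_inter hAs]
  revert x
  refine congrFun (indicator_congr fun x hx ↦ ?_)
  rw [fibreGaussian_eq_lintegral hx hA hAs, Function.comp_apply, indicator_of_mem hx]

variable [SecondCountableTopology M]

theorem measurable_fibreGaussian : Measurable (fibreGaussian (n := n) (M := M)) := by
  refine Measure.measurable_of_measurable_coe _ fun A hA B hB ↦ ?_
  obtain ⟨c, hc, hcover⟩ := TopologicalSpace.countable_cover_nhds
    (fun x : M ↦ extChartAt_source_mem_nhds (I := 𝓡 n) x)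
  let s (x₀ : M) : Set M := (extChartAt (𝓡 n) x₀).source
  have hs (x₀ : M) : MeasurableSet (s x₀) := measurableSet_extChartAt_source x₀
  let f (x₀ x : M) : ℝ≥0∞ := fibreGaussian x (TotalSpace.proj ⁻¹' s x₀ ∩ A)
  have hf (x₀ : M) : Measurable (f x₀) :=
    measurable_fibreGaussian_of_subset (p₀ := ⟨x₀, 0⟩) ((measurableSet_preimage_proj (hs x₀)).inter
      hA) fun p hp ↦ mem_extChartAt_tangent_source.2 hp.1
  have hunion : (fun x ↦ fibreGaussian x A) ⁻¹' B = ⋃ x₀ ∈ c, s x₀ ∩ f x₀ ⁻¹' B := by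
    have heq (x₀ x : M) (hx : x ∈ s x₀) : f x₀ x = fibreGaussian x A := by
      rw [← indicator_of_mem hx fun x ↦ fibreGaussian x A,
        ← fibreGaussian_preimage_proj_inter (hs x₀) hA x]
    ext x
    obtain ⟨x₀, hx₀, hx⟩ := mem_iUnion₂.1 (hcover ▸ mem_univ x)
    simp only [mem_preimage, mem_iUnion, mem_inter_iff, exists_prop]
    exact ⟨fun h ↦ ⟨x₀, hx₀, hx, (heq x₀ x hx).symm ▸ h⟩,
      fun ⟨x₁, _, hx₁, h⟩ ↦ heq x₁ x hx₁ ▸ h⟩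
  rw [hunion]
  exact MeasurableSet.biUnion hc fun x₀ _ ↦ (hs x₀).inter (hf x₀ hB)

variable [Nonempty M]

variable (n M) in
/-- The Liouville measure of the tangent bundle, weighted so that its conditional distributions
on the tangent spaces are the standard Gaussian ones and its projection is the volume. -/
def phaseMeasure : Measure (TangentBundle (𝓡 n) M) :=
  (riemannianVolume n).bind fibreGaussian

theorem phaseMeasure_apply (hA : MeasurableSet A) :
    phaseMeasure n M A = ∫⁻ x, fibreGaussian x A ∂riemannianVolume n :=
  Measure.bind_apply hA measurable_fibreGaussian.aemeasurable

theorem phaseMeasure_preimage_proj_inter {s : Set M} (hs : MeasurableSet s)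
    (hA : MeasurableSet A) : phaseMeasure n M (TotalSpace.proj ⁻¹' s ∩ A) =
      ∫⁻ x in s, fibreGaussian x A ∂riemannianVolume n := by
  rw [phaseMeasure_apply ((measurableSet_preimage_proj hs).inter hA), ← lintegral_indicator hs]
  exact lintegral_congr (fibreGaussian_preimage_proj_inter hs hA)

theorem measurePreserving_dilate_neg :
    MeasurePreserving (dilate (n := n) (M := M) (-1)) (phaseMeasure n M) (phaseMeasure n M) := by
  have hmeas := (continuous_dilate (n := n) (M := M) (-1)).measurable
  refine ⟨hmeas, Measure.ext fun A hA ↦ ?_⟩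
  rw [Measure.map_apply hmeas hA, phaseMeasure_apply hA, phaseMeasure_apply (hmeas hA)]
  exact lintegral_congr fun x ↦ fibreGaussian_preimage_dilate_neg x hA

variable (n M) in
theorem hasChartDensity_phaseMeasure : HasChartDensity (𝓡 n).tangent
    (fun p₀ : TangentBundle (𝓡 n) M ↦
      LocalMetric.density (metricOperator p₀.1) (gaussianConst n)) volume (phaseMeasure n M) := by
  intro p₀ A hA hAs
  have hs := measurableSet_extChartAt_source (I := 𝓡 n) p₀.1
  have ht := measurableSet_extChartAt_target (I := 𝓡 n) p₀.1
  have hI := measurableSet_image_extChartAt (I := (𝓡 n).tangent) hA hAs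
  have hIt := image_extChartAt_tangent_subset hAs
  set F := (extChartAt (𝓡 n).tangent p₀ '' A).indicator
    fun z ↦ ENNReal.ofReal (fibreDensity p₀.1 z) with hF
  have hFmeas : Measurable F := measurable_indicator_fibreDensity hA hAs
  have hdensity : ∀ z ∈ extChartAt (𝓡 n).tangent p₀ '' A,
      ENNReal.ofReal (LocalMetric.density (metricOperator p₀.1) (gaussianConst n) z) =
        ENNReal.ofReal √(metricMatrix p₀.1 z.1).det * F z := by
    intro z hz
    rw [hF, indicator_of_mem hz, ← ENNReal.ofReal_mul (Real.sqrt_nonneg _),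
      sqrt_det_mul_fibreDensity]
  calc phaseMeasure n M A
    _ = ∫⁻ x in (extChartAt (𝓡 n) p₀.1).source, fibreGaussian x A ∂riemannianVolume n := by
      rw [← phaseMeasure_preimage_proj_inter hs hA, preimage_proj_source_inter hAs]
    _ = ∫⁻ y in (extChartAt (𝓡 n) p₀.1).target, ∫⁻ w,
          ENNReal.ofReal √(metricMatrix p₀.1 y).det * F (y, w) := by
      rw [(hasChartDensity_riemannianVolume n M).setLIntegral_source
        (continuousOn_det_metricMatrix p₀.1).sqrt (measurable_fibreGaussian_of_subset hA hAs)]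
      refine setLIntegral_congr_fun ht fun y hy ↦ ?_
      rw [fibreGaussian_eq_lintegral ((extChartAt (𝓡 n) p₀.1).map_target hy) hA hAs,
        (extChartAt (𝓡 n) p₀.1).right_inv hy, lintegral_const_mul' _ _ ENNReal.ofReal_ne_top]
    _ = ∫⁻ z in (extChartAt (𝓡 n) p₀.1).target ×ˢ univ,
          ENNReal.ofReal √(metricMatrix p₀.1 z.1).det * F z := by
      have hsqrt : ContinuousOn (fun z : Coord n × Coord n ↦ √(metricMatrix p₀.1 z.1).det)
          ((extChartAt (𝓡 n) p₀.1).target ×ˢ univ) :=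
        (continuousOn_det_metricMatrix p₀.1).sqrt.comp continuousOn_fst fun z hz ↦ hz.1
      rw [Measure.volume_eq_prod, setLIntegral_prod
        (fun z ↦ ENNReal.ofReal √(metricMatrix p₀.1 z.1).det * F z)
        ((hsqrt.aemeasurable (ht.prod .univ)).ennreal_ofReal.mul hFmeas.aemeasurable)]
      simp only [Measure.restrict_univ]
    _ = ∫⁻ z in extChartAt (𝓡 n).tangent p₀ '' A, ENNReal.ofReal
          (LocalMetric.density (metricOperator p₀.1) (gaussianConst n) z) := by
      rw [setLIntegral_congr_fun hI hdensity, ← inter_eq_left.2 hIt, ← setLIntegral_indicator hI]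
      refine lintegral_congr fun z ↦ ?_
      rw [indicator_mul_right, hF, indicator_indicator, inter_self]

end PhaseMeasure

section PhaseFlow

variable {n : ℕ} {M : Type*} [MetricSpace M] [ChartedSpace (EuclideanSpace ℝ (Fin n)) M]
  [IsManifold (𝓡 n) ∞ M] [RiemannianBundle (fun x : M ↦ TangentSpace (𝓡 n) x)]
  [IsContMDiffRiemannianBundle (𝓡 n) ∞ (EuclideanSpace ℝ (Fin n))
      (fun x : M ↦ TangentSpace (𝓡 n) x)]
  [IsRiemannianManifold (𝓡 n) M] [CompleteSpace M]

theorem mdifferentiable_geodesicFlow (t : ℝ) : MDiff (geodesicFlow n M t) :=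
  mdifferentiable_flow _ (contMDiff_geodesicField.of_le ENat.LEInfty.out) t

variable (n M) in
/-- The geodesic flow followed by the reversal of velocities. -/
def reversedFlow (t : ℝ) (p : TangentBundle (𝓡 n) M) : TangentBundle (𝓡 n) M :=
  dilate (-1) (geodesicFlow n M t p)

theorem involutive_reversedFlow (t : ℝ) : Function.Involutive (reversedFlow n M t) := fun p ↦ by
  have hflow : geodesicFlow n M (-t) (geodesicFlow n M t p) = p :=
    flow_neg_flow _ (contMDiff_geodesicField.of_le ENat.LEInfty.out) t p
  rw [reversedFlow, reversedFlow, geodesicFlow_dilate, neg_one_mul, hflow, dilate, dilate,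
    neg_one_smul, neg_one_smul, neg_neg]

variable [SecondCountableTopology M] [MeasurableSpace M] [BorelSpace M] [Nonempty M]

theorem measurePreserving_geodesicFlow (t : ℝ) :
    MeasurePreserving (geodesicFlow n M t) (phaseMeasure n M) (phaseMeasure n M) := by
  have : (volume : Measure (Coord n × Coord n)).IsAddHaarMeasure := by
    rw [Measure.volume_eq_prod]
    infer_instance
  have hbase {p₀ : TangentBundle (𝓡 n) M} {z : Coord n × Coord n}
      (hz : z ∈ (extChartAt (𝓡 n).tangent p₀).target) : z.1 ∈ (extChartAt (𝓡 n) p₀.1).target :=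
    (extChartAt_tangent_target (p₀ := p₀) ▸ hz).1
  refine (hasChartDensity_phaseMeasure n M).measurePreserving_flow
    (contMDiff_geodesicField.of_le ENat.LEInfty.out) (fun p₀ z hz ↦ ?_) (fun p₀ z hz ↦ ?_)
    (fun p₀ z hz ↦ ?_) t
  · rw [← sqrt_det_mul_fibreDensity]
    exact mul_nonneg (Real.sqrt_nonneg _) (fibreDensity_pos (hbase hz)).le
  · exact LocalMetric.differentiableAt_density (differentiableAt_metricOperator (hbase hz)) _
  · have hfield : chartField (geodesicField n M) p₀ =ᶠ[𝓝 z] chartSpray p₀.1 :=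
      ((isOpen_extChartAt_target p₀).eventually_mem hz).mono fun w hw ↦
        chartField_geodesicField hw
    rw [hfield.fderiv_eq, chartField_geodesicField hz]
    exact LocalMetric.density_continuity_equation (isSelfAdjoint_metricOperator p₀.1)
      (isUnit_metricOperator (hbase hz))
      ((contDiffAt_metricOperator (hbase hz)).of_le ENat.LEInfty.out) _

theorem measurePreserving_reversedFlow (t : ℝ) :
    MeasurePreserving (reversedFlow n M t) (phaseMeasure n M) (phaseMeasure n M) :=
  measurePreserving_dilate_neg.comp (measurePreserving_geodesicFlow t)

end PhaseFlow

section GaussianStep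

variable {n : ℕ} {M : Type*} [MetricSpace M] [ChartedSpace (EuclideanSpace ℝ (Fin n)) M]
  [IsManifold (𝓡 n) ∞ M] [RiemannianBundle (fun x : M ↦ TangentSpace (𝓡 n) x)]

variable (n) in
/-- The distribution of the endpoint `exp_x (t u)` of a geodesic with standard Gaussian initial
velocity `u`, which is the transition probability of the unrestricted walk. -/
def gaussianStep [MeasurableSpace M] (t : ℝ) (x : M) : Measure M :=
  (tangentGaussian x).map fun u : TangentSpace (𝓡 n) x ↦ expMap x (t • u)

variable [IsContMDiffRiemannianBundle (𝓡 n) ∞ (EuclideanSpace ℝ (Fin n))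
      (fun x : M ↦ TangentSpace (𝓡 n) x)]
  [IsRiemannianManifold (𝓡 n) M] [CompleteSpace M]

theorem continuous_proj_geodesicFlow (t : ℝ) :
    Continuous fun p : TangentBundle (𝓡 n) M ↦ (geodesicFlow n M t p).1 :=
  (FiberBundle.continuous_proj (Coord n) (TangentSpace (𝓡 n) : M → Type _)).comp
    (mdifferentiable_geodesicFlow t).continuous

theorem continuous_expMap_smul (t : ℝ) (x : M) :
    Continuous fun u : TangentSpace (𝓡 n) x ↦ expMap x (t • u) := by
  simp_rw [expMap_smul]
  exact (continuous_proj_geodesicFlow t).comp (continuous_fibre x)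

variable [MeasurableSpace M] [BorelSpace M] {A B : Set M}

theorem gaussianStep_apply (t : ℝ) (x : M) (hB : MeasurableSet B) :
    gaussianStep n t x B = tangentGaussian x {u : TangentSpace (𝓡 n) x | expMap x (t • u) ∈ B} :=
  Measure.map_apply (continuous_expMap_smul t x).measurable hB

theorem measurableSet_proj_geodesicFlow_mem (t : ℝ) (hB : MeasurableSet B) :
    MeasurableSet {p : TangentBundle (𝓡 n) M | (geodesicFlow n M t p).1 ∈ B} :=
  (continuous_proj_geodesicFlow t).measurable hB

theorem gaussianStep_eq_fibreGaussian (t : ℝ) (x : M) (hB : MeasurableSet B) :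
    gaussianStep n t x B = fibreGaussian x {p | (geodesicFlow n M t p).1 ∈ B} := by
  rw [gaussianStep_apply t x hB,
    fibreGaussian_apply x (measurableSet_proj_geodesicFlow_mem t hB)]
  simp only [expMap_smul, mem_ofPred_eq]

variable [SecondCountableTopology M]

theorem measurable_gaussianStep_apply (t : ℝ) (hB : MeasurableSet B) :
    Measurable fun x ↦ gaussianStep n t x B := by
  simp only [gaussianStep_eq_fibreGaussian t _ hB]
  exact (Measure.measurable_coe (measurableSet_proj_geodesicFlow_mem t hB)).comp
    measurable_fibreGaussian

theorem setLIntegral_gaussianStep_comm [Nonempty M] (t : ℝ) (hA : MeasurableSet A)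
    (hB : MeasurableSet B) :
    ∫⁻ x in A, gaussianStep n t x B ∂riemannianVolume n =
      ∫⁻ x in B, gaussianStep n t x A ∂riemannianVolume n := by
  have hmeas {C : Set M} (hC : MeasurableSet C) :=
    measurableSet_proj_geodesicFlow_mem (n := n) t hC
  simp only [gaussianStep_eq_fibreGaussian t _ hA, gaussianStep_eq_fibreGaussian t _ hB]
  rw [← phaseMeasure_preimage_proj_inter hA (hmeas hB),
    ← phaseMeasure_preimage_proj_inter hB (hmeas hA),
    ← (measurePreserving_reversedFlow t).measure_preimage
      ((measurableSet_preimage_proj hB).inter (hmeas hA)).nullMeasurableSet]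
  congr 1
  ext p
  have hinv := congrArg TotalSpace.proj (involutive_reversedFlow t p)
  have hproj : (geodesicFlow n M t (reversedFlow n M t p)).1 = p.1 := hinv
  rw [mem_preimage, mem_inter_iff, mem_inter_iff, mem_ofPred_eq, mem_ofPred_eq, hproj]
  exact and_comm

end GaussianStep

section Uniqueness

variable {α : Type*} [MeasurableSpace α] {P : Kernel α α} {μ₁ μ₂ : Measure α}

theorem invariant_inf [IsMarkovKernel P] [IsFiniteMeasure μ₁] (h₁ : P.Invariant μ₁)
    (h₂ : P.Invariant μ₂) : P.Invariant (μ₁ ⊓ μ₂) := by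
  have hbind {μ : Measure α} (hμ : P.Invariant μ) (hle : μ₁ ⊓ μ₂ ≤ μ) :
      (μ₁ ⊓ μ₂).bind P ≤ μ := by
    refine Measure.le_iff.2 fun A hA ↦ ?_
    rw [Measure.bind_apply hA P.aemeasurable, ← hμ.def, Measure.bind_apply hA P.aemeasurable]
    exact lintegral_mono' hle le_rfl
  have : IsFiniteMeasure (μ₁ ⊓ μ₂) := isFiniteMeasure_of_le μ₁ inf_le_left
  exact Measure.eq_of_le_of_measure_univ_eq
    (le_inf (hbind h₁ inf_le_left) (hbind h₂ inf_le_right)) Measure.comp_apply_univ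

theorem invariant_sub {μ lam : Measure α} [IsFiniteMeasure lam] (hμ : P.Invariant μ)
    (hlam : P.Invariant lam) (hle : lam ≤ μ) : P.Invariant (μ - lam) := by
  have hsum : (μ - lam).bind P + lam = μ := by
    calc (μ - lam).bind P + lam = (μ - lam).bind P + lam.bind P := by rw [hlam.def]
      _ = (μ - lam + lam).bind P := Measure.comp_add.symm
      _ = μ := by rw [Measure.sub_add_cancel_of_le hle, hμ.def]
  rw [Kernel.Invariant, ← Measure.add_sub_cancel (μ := (μ - lam).bind P) (ν := lam), hsum]

theorem absolutelyContinuous_of_invariant {ν μ : Measure α} (hac : ∀ x, ν ≪ P x)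
    (hμ : P.Invariant μ) (hne : μ ≠ 0) : ν ≪ μ := by
  refine Measure.AbsolutelyContinuous.mk fun A hA hnull ↦ ?_
  rw [← hμ.def, Measure.bind_apply hA P.aemeasurable,
    lintegral_eq_zero_iff (P.measurable_coe hA)] at hnull
  have := ae_neBot.2 hne
  obtain ⟨x, hx⟩ := hnull.exists
  exact hac x hx

theorem disjoint_sub_inf [IsFiniteMeasure μ₁] : Disjoint (μ₁ - μ₁ ⊓ μ₂) (μ₂ - μ₁ ⊓ μ₂) := by
  have : IsFiniteMeasure (μ₁ ⊓ μ₂) := isFiniteMeasure_of_le μ₁ inf_le_left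
  refine disjoint_iff_inf_le.2 ?_
  set ξ := (μ₁ - μ₁ ⊓ μ₂) ⊓ (μ₂ - μ₁ ⊓ μ₂)
  have hle : ξ + μ₁ ⊓ μ₂ ≤ μ₁ ⊓ μ₂ := le_inf
    ((add_le_add_left inf_le_left _).trans_eq (Measure.sub_add_cancel_of_le inf_le_left))
    ((add_le_add_left inf_le_right _).trans_eq (Measure.sub_add_cancel_of_le inf_le_right))
  have hcancel : ξ + μ₁ ⊓ μ₂ - μ₁ ⊓ μ₂ = ξ := Measure.add_sub_cancel
  calc ξ = ξ + μ₁ ⊓ μ₂ - μ₁ ⊓ μ₂ := hcancel.symm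
    _ ≤ 0 := Measure.sub_le_of_le_add (by rwa [zero_add])
    _ ≤ ⊥ := Measure.zero_le _

theorem eq_of_invariant_of_absolutelyContinuous [IsMarkovKernel P] {ν : Measure α} (hν : ν ≠ 0)
    (hac : ∀ x, ν ≪ P x) [IsProbabilityMeasure μ₁] [IsProbabilityMeasure μ₂]
    (h₁ : P.Invariant μ₁) (h₂ : P.Invariant μ₂) : μ₁ = μ₂ := by
  have : IsFiniteMeasure (μ₁ ⊓ μ₂) := isFiniteMeasure_of_le μ₁ inf_le_left
  have hinf := invariant_inf h₁ h₂
  have hdominates {μ : Measure α} (hμ : P.Invariant μ) (hle : μ₁ ⊓ μ₂ ≤ μ)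
      (hne : μ - μ₁ ⊓ μ₂ ≠ 0) : ν ≪ μ - μ₁ ⊓ μ₂ :=
    absolutelyContinuous_of_invariant hac (invariant_sub hμ hinf hle) hne
  have hzero : μ₁ - μ₁ ⊓ μ₂ = 0 ∨ μ₂ - μ₁ ⊓ μ₂ = 0 := by
    by_contra! hne
    have hself := (Measure.mutuallySingular_of_disjoint disjoint_sub_inf).mono_ac
      (hdominates h₁ inf_le_left hne.1) (hdominates h₂ inf_le_right hne.2)
    exact hν (Measure.MutuallySingular.self_iff ν |>.1 hself)
  have heq {μ : Measure α} (hle : μ₁ ⊓ μ₂ ≤ μ) (h : μ - μ₁ ⊓ μ₂ = 0) : μ = μ₁ ⊓ μ₂ := by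
    rw [← Measure.sub_add_cancel_of_le hle, h, zero_add]
  rcases hzero with h | h
  · exact Measure.eq_of_le_of_isProbabilityMeasure ((heq inf_le_left h).trans_le inf_le_right)
  · exact (Measure.eq_of_le_of_isProbabilityMeasure
      ((heq inf_le_right h).trans_le inf_le_left)).symm

end Uniqueness

section Support

variable {n : ℕ} {M : Type*} [MetricSpace M] [ChartedSpace (EuclideanSpace ℝ (Fin n)) M]
  [IsManifold (𝓡 n) ∞ M] [RiemannianBundle (fun x : M ↦ TangentSpace (𝓡 n) x)]
  [IsContMDiffRiemannianBundle (𝓡 n) ∞ (EuclideanSpace ℝ (Fin n))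
      (fun x : M ↦ TangentSpace (𝓡 n) x)]
  [IsRiemannianManifold (𝓡 n) M] [CompleteSpace M] {x : M}

theorem mdifferentiable_expMap_smul_toTangent (t : ℝ) (x : M) :
    MDifferentiable (𝓡 n) (𝓡 n) fun w : Coord n ↦ expMap x (t • toTangent x x w) := by
  have hx := mem_extChartAt_source (I := 𝓡 n) x
  have hfibre : MDifferentiable (𝓡 n) (𝓡 n).tangent
      fun w : Coord n ↦ (⟨x, toTangent x x w⟩ : TangentBundle (𝓡 n) M) := fun w₀ ↦ by
    refine (mdifferentiableAt_totalSpace ..).2 ⟨mdifferentiableAt_const,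
      mdifferentiableAt_id.congr_of_eventuallyEq (.of_forall fun w ↦ ?_)⟩
    exact (Trivialization.continuousLinearMapAt_apply_of_mem (R := ℝ)
      (trivializationAt (Coord n) (TangentSpace (𝓡 n)) x)
      (FiberBundle.mem_baseSet_trivializationAt' x) _).symm.trans (ofTangent_toTangent_self hx w)
  simp_rw [expMap_smul]
  exact (Bundle.mdifferentiable_proj _).comp ((mdifferentiable_geodesicFlow t).comp hfibre)

variable [SecondCountableTopology M] [MeasurableSpace M] [BorelSpace M] [Nonempty M]

theorem riemannianVolume_eq_zero_of_gaussianStep {t : ℝ} (ht : t ≠ 0) {N : Set M}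
    (hN : MeasurableSet N) (hreach : ∀ y ∈ N, ∃ v : TangentSpace (𝓡 n) x, expMap x v = y)
    (hnull : gaussianStep n t x N = 0) : riemannianVolume n N = 0 := by
  have hx := mem_extChartAt_source (I := 𝓡 n) x
  set f := fun w : Coord n ↦ expMap x (t • toTangent x x w)
  have hf : MDifferentiable (𝓡 n) (𝓡 n) f := mdifferentiable_expMap_smul_toTangent t x
  have hf_ofTangent (u : TangentSpace (𝓡 n) x) : f (ofTangent x x u) = expMap x (t • u) := by
    simp only [f, toTangent_ofTangent hx]
  have hS : volume (f ⁻¹' N) = 0 := by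
    refine volume_eq_zero_of_tangentGaussian hx (hf.continuous.measurable hN) ?_
    rw [gaussianStep_apply t x hN] at hnull
    simpa only [preimage, mem_ofPred_eq, hf_ofTangent] using hnull
  refine (hasChartDensity_riemannianVolume n M).measure_eq_zero_of_subset_image hf hS hN
    fun y hy ↦ ?_
  obtain ⟨v, rfl⟩ := hreach y hy
  have hv : f (ofTangent x x (t⁻¹ • v)) = expMap x v := by rw [hf_ofTangent, smul_inv_smul₀ ht]
  exact ⟨_, by rwa [mem_preimage, hv], hv⟩

end Support

section Walk

variable {n : ℕ} {M : Type*} [MetricSpace M] [ChartedSpace (EuclideanSpace ℝ (Fin n)) M]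
  [RiemannianBundle (fun x : M ↦ TangentSpace (𝓡 n) x)] {K : Set M}

theorem walkUpdate_mem_iff {δ : ℝ} {x : K} {u : TangentSpace (𝓡 n) (x : M)} {B : Set K} :
    walkUpdate δ K x u ∈ B ↔ expMap (x : M) (δ • u) ∈ ((↑) '' B : Set M) ∨
      expMap (x : M) (δ • u) ∈ Kᶜ ∧ x ∈ B := by
  by_cases h : expMap (x : M) (δ • u) ∈ K <;> simp [walkUpdate, h]

variable [IsManifold (𝓡 n) ∞ M] [IsContMDiffRiemannianBundle (𝓡 n) ∞ (EuclideanSpace ℝ (Fin n))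
      (fun x : M ↦ TangentSpace (𝓡 n) x)]
  [IsRiemannianManifold (𝓡 n) M] [CompleteSpace M] [MeasurableSpace M] [BorelSpace M]

theorem measurable_walkUpdate (δ : ℝ) (hK : MeasurableSet K) (x : K) :
    Measurable (walkUpdate (n := n) δ K x) := fun B hB ↦ by
  have hexp := (continuous_expMap_smul (n := n) δ (x : M)).measurable
  simp only [preimage, walkUpdate_mem_iff]
  exact (hexp (hK.subtype_image hB)).union ((hexp hK.compl).inter (.const _))

theorem oneStep_apply (δ : ℝ) (hK : MeasurableSet K) (x : K) {B : Set K} (hB : MeasurableSet B) :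
    oneStep n δ K x B = gaussianStep n δ (x : M) ((↑) '' B) +
      ((↑) '' B : Set M).indicator (fun y ↦ gaussianStep n δ y Kᶜ) x := by
  have hBM : MeasurableSet ((↑) '' B : Set M) := hK.subtype_image hB
  have hdisj : Disjoint ((↑) '' B : Set M) Kᶜ :=
    disjoint_compl_right.mono_left (Subtype.coe_image_subset K B)
  rw [oneStep, Measure.map_apply (measurable_walkUpdate δ hK x) hB]
  by_cases hx : x ∈ B
  · rw [indicator_of_mem (mem_image_of_mem _ hx), ← measure_union hdisj hK.compl,
      gaussianStep_apply δ _ (hBM.union hK.compl)]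
    simp only [preimage, walkUpdate_mem_iff, hx, and_true, mem_union]
  · rw [indicator_of_notMem (by simpa using hx), add_zero, gaussianStep_apply δ _ hBM]
    simp only [preimage, walkUpdate_mem_iff, hx, and_false, or_false]

variable [SecondCountableTopology M]

variable (n) in
/-- The transition kernel of the geodesic walk in `K`. -/
def walkKernel (δ : ℝ) (hK : MeasurableSet K) : Kernel K K where
  toFun := oneStep n δ K
  measurable' := by
    refine Measure.measurable_of_measurable_coe _ fun B hB ↦ ?_
    simp only [oneStep_apply δ hK _ hB]
    exact ((measurable_gaussianStep_apply δ (hK.subtype_image hB)).add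
      ((measurable_gaussianStep_apply δ hK.compl).indicator (hK.subtype_image hB))).comp
        measurable_subtype_coe

instance isMarkovKernel_walkKernel (δ : ℝ) (hK : MeasurableSet K) :
    IsMarkovKernel (walkKernel n δ hK) :=
  ⟨fun x ↦ Measure.isProbabilityMeasure_map (measurable_walkUpdate δ hK x).aemeasurable⟩

variable [Nonempty M]

theorem setLIntegral_walkKernel (δ : ℝ) (hK : MeasurableSet K) (A : Set K) {B : Set K}
    (hB : MeasurableSet B) :
    ∫⁻ x in A, walkKernel n δ hK x B ∂((riemannianVolume n).comap Subtype.val) =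
      ∫⁻ x in ((↑) '' A : Set M), gaussianStep n δ x ((↑) '' B) ∂riemannianVolume n +
      ∫⁻ x in ((↑) '' B ∩ (↑) '' A : Set M), gaussianStep n δ x Kᶜ ∂riemannianVolume n := by
  have hBM : MeasurableSet ((↑) '' B : Set M) := hK.subtype_image hB
  calc ∫⁻ x in A, walkKernel n δ hK x B ∂((riemannianVolume n).comap Subtype.val)
    _ = ∫⁻ x in A, (gaussianStep n δ (x : M) ((↑) '' B) + ((↑) '' B : Set M).indicator
          (fun y ↦ gaussianStep n δ y Kᶜ) x) ∂((riemannianVolume n).comap Subtype.val) :=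
      lintegral_congr fun x ↦ oneStep_apply δ hK x hB
    _ = ∫⁻ x in ((↑) '' A : Set M), (gaussianStep n δ x ((↑) '' B) + ((↑) '' B : Set M).indicator
          (fun y ↦ gaussianStep n δ y Kᶜ) x) ∂riemannianVolume n :=
      setLIntegral_subtype hK A fun x ↦ gaussianStep n δ x ((↑) '' B) +
        ((↑) '' B : Set M).indicator (fun y ↦ gaussianStep n δ y Kᶜ) x
    _ = _ := by
      rw [lintegral_add_left (measurable_gaussianStep_apply δ hBM),
        setLIntegral_indicator hBM]

theorem isReversible_walkKernel (δ : ℝ) (hK : MeasurableSet K) :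
    (walkKernel n δ hK).IsReversible ((riemannianVolume n).comap Subtype.val) :=
  fun A B hA hB ↦ by
    rw [setLIntegral_walkKernel δ hK A hB, setLIntegral_walkKernel δ hK B hA, inter_comm,
      setLIntegral_gaussianStep_comm δ (hK.subtype_image hA) (hK.subtype_image hB)]

theorem absolutelyContinuous_walkKernel {δ : ℝ} (hδ : δ ≠ 0) (hK : MeasurableSet K) {x : K}
    (hreach : ∀ y ∈ K, ∃ v : TangentSpace (𝓡 n) (x : M), expMap (x : M) v = y) :
    (riemannianVolume n).comap Subtype.val ≪ walkKernel n δ hK x := by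
  refine Measure.AbsolutelyContinuous.mk fun N hN hnull ↦ ?_
  have hstep : gaussianStep n δ (x : M) ((↑) '' N) = 0 :=
    (add_eq_zero.1 ((oneStep_apply δ hK x hN).symm.trans hnull)).1
  rw [comap_subtype_coe_apply hK]
  exact riemannianVolume_eq_zero_of_gaussianStep hδ (hK.subtype_image hN)
    (fun y hy ↦ hreach y (Subtype.coe_image_subset K N hy)) hstep

end Walk

section UniformDistribution

variable {n : ℕ} {M : Type*} [MetricSpace M] [ChartedSpace (EuclideanSpace ℝ (Fin n)) M]
  [RiemannianBundle (fun x : M ↦ TangentSpace (𝓡 n) x)] [MeasurableSpace M] [Nonempty M]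
  [SecondCountableTopology M]
  {K : Set M}

theorem comap_riemannianVolume_univ (hK : MeasurableSet K) :
    (riemannianVolume n).comap (Subtype.val : K → M) univ = riemannianVolume n K := by
  rw [comap_subtype_coe_apply hK, image_univ, Subtype.range_coe]

theorem isProbabilityMeasure_uniformDistribution (hK : MeasurableSet K)
    (h₀ : riemannianVolume n K ≠ 0) (htop : riemannianVolume n K ≠ ⊤) :
    IsProbabilityMeasure (uniformDistribution n K) :=
  ⟨by rw [uniformDistribution, Measure.smul_apply, comap_riemannianVolume_univ hK, smul_eq_mul,
    ENNReal.inv_mul_cancel h₀ htop]⟩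

theorem invariant_uniformDistribution {P : Kernel K K} [IsMarkovKernel P]
    (hrev : P.IsReversible ((riemannianVolume n).comap Subtype.val)) :
    P.Invariant (uniformDistribution n K) := by
  rw [Kernel.Invariant, uniformDistribution, Measure.comp_smul, hrev.invariant.def]

end UniformDistribution

end GeodesicWalk

end

theorem mainTheorem10_general {n : ℕ} {M : Type*} [MetricSpace M]
    [ChartedSpace (EuclideanSpace ℝ (Fin n)) M] [IsManifold (𝓡 n) ∞ M]
    [RiemannianBundle (fun x : M ↦ TangentSpace (𝓡 n) x)]
    [IsContMDiffRiemannianBundle (𝓡 n) ∞ (EuclideanSpace ℝ (Fin n))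
      (fun x : M ↦ TangentSpace (𝓡 n) x)]
    [IsRiemannianManifold (𝓡 n) M] [CompleteSpace M] [Nonempty M]
    [SecondCountableTopology M] [MeasurableSpace M] [BorelSpace M]
    (δ : ℝ) (K : Set M) (hK : MeasurableSet K) :
    ∃ P : Kernel K K, IsMarkovKernel P ∧ (∀ x : K, P x = GeodesicWalk.oneStep n δ K x) ∧
      P.IsReversible ((GeodesicWalk.riemannianVolume n).comap Subtype.val) ∧
      (δ ≠ 0 →
        (∀ x ∈ K, ∀ y ∈ K, ∃ v : TangentSpace (𝓡 n) x, GeodesicWalk.expMap x v = y) →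
        GeodesicWalk.riemannianVolume n K ≠ 0 → GeodesicWalk.riemannianVolume n K ≠ ⊤ →
          IsProbabilityMeasure (GeodesicWalk.uniformDistribution n K) ∧
          P.Invariant (GeodesicWalk.uniformDistribution n K) ∧
          ∀ μ : Measure K, IsProbabilityMeasure μ → P.Invariant μ →
            μ = GeodesicWalk.uniformDistribution n K) := by
  have hrev := GeodesicWalk.isReversible_walkKernel (n := n) δ hK
  refine ⟨GeodesicWalk.walkKernel n δ hK, inferInstance, fun x ↦ rfl, hrev,
    fun hδ hreach h₀ htop ↦ ?_⟩
  have hprob := GeodesicWalk.isProbabilityMeasure_uniformDistribution hK h₀ htop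
  have hinv := GeodesicWalk.invariant_uniformDistribution hrev
  have hvol : (GeodesicWalk.riemannianVolume n).comap (Subtype.val : K → M) ≠ 0 := fun h ↦
    h₀ (by rw [← GeodesicWalk.comap_riemannianVolume_univ hK, h, Measure.coe_zero, Pi.zero_apply])
  have hac (x : K) := GeodesicWalk.absolutelyContinuous_walkKernel hδ hK (hreach x x.2)
  exact ⟨hprob, hinv, fun μ _ hμ ↦
    GeodesicWalk.eq_of_invariant_of_absolutelyContinuous hvol hac hμ hinv⟩

theorem mainTheorem10 {n : ℕ} {M : Type*} [MetricSpace M]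
    [ChartedSpace (EuclideanSpace ℝ (Fin n)) M] [IsManifold (𝓡 n) ∞ M]
    [RiemannianBundle (fun x : M ↦ TangentSpace (𝓡 n) x)]
    [IsContMDiffRiemannianBundle (𝓡 n) ∞ (EuclideanSpace ℝ (Fin n))
      (fun x : M ↦ TangentSpace (𝓡 n) x)]
    [IsRiemannianManifold (𝓡 n) M] [CompleteSpace M] [ConnectedSpace M]
    [SecondCountableTopology M] [MeasurableSpace M] [BorelSpace M]
    (δ : ℝ) (hδ : 0 < δ) (K : Set M) (hK : MeasurableSet K) :
    ∃ P : Kernel K K, IsMarkovKernel P ∧ (∀ x : K, P x = GeodesicWalk.oneStep n δ K x) ∧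
      P.IsReversible ((GeodesicWalk.riemannianVolume n).comap Subtype.val) ∧
      (GeodesicWalk.GeodesicallyConvex n K → GeodesicWalk.riemannianVolume n K ≠ 0 →
        GeodesicWalk.riemannianVolume n K ≠ ⊤ →
          IsProbabilityMeasure (GeodesicWalk.uniformDistribution n K) ∧
          P.Invariant (GeodesicWalk.uniformDistribution n K) ∧
          ∀ μ : Measure K, IsProbabilityMeasure μ → P.Invariant μ →
            μ = GeodesicWalk.uniformDistribution n K) := by
  obtain ⟨P, hP, hstep, hrev, hunif⟩ := mainTheorem10_general (n := n) δ K hK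
  exact ⟨P, hP, hstep, hrev, fun hconv ↦ hunif hδ.ne' fun _ hx _ hy ↦ hconv.exists_expMap_eq hx hy⟩
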